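/- **Conventions.** A generalized Cartan matrix is a real matrix $A=(a_{i,j})_{i,j\in I}$, $I$ countable, such that $QA$ is symmetric for some positive diagonal matrix $Q$, $a_{i,j}\le 0$ for $i\ne j$, and, whenever $a_{i,i}>0$, $a_{i,i}=2$ and $a_{i,j}\in\mathbb Z$ for all $j$. Let $\mathfrak g(A)$ be the complex Lie algebra generated by $h_i,e_i,f_i$ $(i\in I)$ with relations $[h_i,e_k]=a_{i,k}e_k$, $[h_i,f_k]=-a_{i,k}f_k$, $[e_i,f_j]=\delta_{i,j}h_i$; $\operatorname{ad}(e_i)^{1-a_{i,j}}e_j=\operatorname{ad}(f_i)^{1-a_{i,j}}f_j=0$ if $a_{i,i}>0$, $i\neq j$; and $[e_i,e_j]=[f_i,f_j]=0$ if $a_{i,j}=0$. A Borcherds-Kac-Moody Lie algebra is one of the form $(\mathfrak g(A)/C).D$ with $C$ a central ideal and $D$ a commutative Lie algebra acting by degree derivations (diagonally on the $e_i$, $f_i$); its Cartan subalgebra $\mathfrak h$ is spanned by the $h_i$ and $D$, and its simple roots are the $\alpha_i\in\mathfrak h^*$ with $[t,e_i]=\alpha_i(t)e_i$ for $t\in\mathfrak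 h$. Such a Lie algebra $\mathfrak g$ is *Fricke* if $\dim\mathfrak h=2$; there is exactly one $i_0$ with $a_{i_0,i_0}>0$; no $a_{i,i}$ vanishes; for some $Q$ as above and some nondegenerate symmetric bilinear form on $\mathfrak h^*$ with $(\alpha_i,\lambda)=Q_{i,i}\lambda(h_i)$ for all $i\in I$ and $\lambda\in\mathfrak h^*$ there is $\rho\in\mathfrak h^*$ with $(\rho,\rho)=0$ and $(\alpha_i,\rho)=-\tfrac12(\alpha_i,\alpha_i)$ for all $i$; and for every real $B$ only finitely many $i\in I$ satisfy $(\alpha_i,\alpha_i)>-B$. Fix such data. For $a,b\in\mathbb Z$, let $\mathfrak g_{a,b}$ be the root space of weight $-a\rho-b(\rho+\alpha_{i_0})$ (so the real simple root has bidegree $(1,-1)$ and $\rho$ corresponds to $(-1,0)$). Let $N\ge1$, and let a group $H$ act on $\mathfrak g$ by Lie algebra automorphisms preserving every $\mathfrak g_{a,b}$. Place $\mathfrak g_{a,b}$ in degree $(a,b/N)\in\mathbb Z\times\frac1N\mathbb Z$. The action is *level $N$ q-compatible* if, for $(a,b)\ne(0,0)$, the isomorphism class of the $H$-module $\mathfrak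 g_{a,b}$ depends only on $ab$ and on the residues of $a$ and $b$ modulo $N$. In that case let $V^{k,r}_n$ ($k\in\mathbb Z/N\mathbb Z$, $r\in\frac1N\mathbb Z/\mathbb Z$, $n\in\frac1N\mathbb Z$) be any $H$-modules with $\mathfrak g_{a,b}\cong V^{a,b/N}_{ab/N}$ as $H$-modules for all $(a,b)\neq(0,0)$. For $h\in H$ and integers $k,\ell,m$ put $$f_{k,\ell,m}(q)=\sum_{n\in\frac1N\mathbb Z}\ \sum_{\substack{r\in\frac1N\mathbb Z/\mathbb Z\\ kr-n\in\mathbb Z}} e^{2\pi i\ell r}\operatorname{Tr}(h^m|V^{k,r}_n)\,q^n ,$$ $$\hat T_nf_{k,\ell,m}(q)=\frac1n\sum_{\substack{ad=n\\0\le b<d}}f_{dk,\,a\ell-bk,\,am}\bigl(e^{2\pi i b/d}q^{a/d}\bigr),$$ where substituting $e^{2\pi i b/d}q^{a/d}$ replaces $q^x$ by $e^{2\pi i bx/d}q^{ax/d}$ for $x\in\frac1N\mathbb Z$. (A class $(k,r,n)$ not attained by any $(a,b/N)$ may be given any module; where that module is infinite dimensional, the trace is read as $0$.) **Proposition.** Let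 $\mathfrak g$ be a Fricke Lie algebra with a level $N$ q-compatible action of a group $H$, and let $h\in H$. Then all $\mathfrak g_{a,b}$ are finite dimensional, $f_{1,0,1}(q)$ is a formal series in $q^{1/N}$ with only finitely many nonzero terms of negative exponent, and it is Hecke-monic: for every $n\ge1$ the series $n\hat T_nf_{1,0,1}(q)$ equals $P_n(f_{1,0,1}(q))$ for some monic polynomial $P_n\in\mathbb C[X]$ of degree $n$. -/

import Mathlib

open scoped BigOperators

/-! ### Borcherds-Kac-Moody Lie algebras -/

/-- A generalized Cartan matrix (in the sense of Borcherds). -/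
structure IsGeneralizedCartanMatrix {I : Type*} (A : Matrix I I ℝ) : Prop where
  countable : Countable I
  symmetrizable : ∃ Q : I → ℝ, (∀ i, 0 < Q i) ∧ ∀ i j, Q i * A i j = Q j * A j i
  off_diag_nonpos : ∀ i j, i ≠ j → A i j ≤ 0
  diag_eq_two : ∀ i, 0 < A i i → A i i = 2
  integral : ∀ i, 0 < A i i → ∀ j, ∃ z : ℤ, A i j = z

/-- The generators `h_i`, `e_i`, `f_i`. -/
inductive BKMGenerator (I : Type*)
  | h : I → BKMGenerator I
  | e : I → BKMGenerator I
  | f : I → BKMGenerator I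

namespace BKM

/-- The free Lie algebra on the symbols `h_i`, `e_i`, `f_i`. -/
abbrev Free (I : Type*) := FreeLieAlgebra ℂ (BKMGenerator I)

variable {I : Type*}

/-- The generator `h_i` of the free Lie algebra. -/
noncomputable abbrev freeH (i : I) : Free I := FreeLieAlgebra.of ℂ (BKMGenerator.h i)

/-- The generator `e_i` of the free Lie algebra. -/
noncomputable abbrev freeE (i : I) : Free I := FreeLieAlgebra.of ℂ (BKMGenerator.e i)

/-- The generator `f_i` of the free Lie algebra. -/
noncomputable abbrev freeF (i : I) : Free I := FreeLieAlgebra.of ℂ (BKMGenerator.f i)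

/-- The defining relators. In the Serre relators `a_{i,j} = -n`, so that the exponent `n + 1` is
`1 - a_{i,j} = 1 - 2 a_{i,j} / a_{i,i}`. -/
inductive IsRelator (A : Matrix I I ℝ) : Free I → Prop
  | he (i k : I) : IsRelator A (⁅freeH i, freeE k⁆ - (A i k : ℂ) • freeE k)
  | hf (i k : I) : IsRelator A (⁅freeH i, freeF k⁆ + (A i k : ℂ) • freeF k)
  | ef_same (i : I) : IsRelator A (⁅freeE i, freeF i⁆ - freeH i)
  | ef_ne (i j : I) (hij : i ≠ j) : IsRelator A ⁅freeE i, freeF j⁆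
  | serre_e (i j : I) (n : ℕ) (hi : 0 < A i i) (hij : i ≠ j) (hn : A i j = -(n : ℝ)) :
      IsRelator A (((LieAlgebra.ad ℂ (Free I) (freeE i)) ^ (n + 1)) (freeE j))
  | serre_f (i j : I) (n : ℕ) (hi : 0 < A i i) (hij : i ≠ j) (hn : A i j = -(n : ℝ)) :
      IsRelator A (((LieAlgebra.ad ℂ (Free I) (freeF i)) ^ (n + 1)) (freeF j))
  | orth_e (i j : I) (hij : A i j = 0) : IsRelator A ⁅freeE i, freeE j⁆
  | orth_f (i j : I) (hij : A i j = 0) : IsRelator A ⁅freeF i, freeF j⁆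

/-- The ideal generated by the defining relators. -/
noncomputable def relatorIdeal (A : Matrix I I ℝ) : LieIdeal ℂ (Free I) :=
  LieSubmodule.lieSpan ℂ (Free I) {x | IsRelator A x}

/-- The universal Borcherds-Kac-Moody Lie algebra `𝔤(A)`. -/
abbrev Universal (A : Matrix I I ℝ) := Free I ⧸ relatorIdeal A

/-- The image of a generator in `𝔤(A)`. -/
noncomputable def gen (A : Matrix I I ℝ) (x : BKMGenerator I) : Universal A :=
  LieSubmodule.Quotient.mk (N := relatorIdeal A) (FreeLieAlgebra.of ℂ x)

end BKM

/-- A presentation of `𝔤` as a Borcherds-Kac-Moody Lie algebra `(𝔤(A)/C).D` with a chosen Cartan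
subalgebra: `C = ker φ` is a central ideal, the image `𝔤(A)/C` is an ideal of `𝔤`, and `D` is a
commutative complement that acts by degree derivations, i.e. diagonally on the `e_i` and `f_i`.
The Cartan subalgebra is spanned by `D` and the `h_i`, and `α i` is the `i`-th simple root. -/
structure BorcherdsKacMoody {I : Type*} (A : Matrix I I ℝ) (𝔤 : Type*)
    [LieRing 𝔤] [LieAlgebra ℂ 𝔤] where
  cartanMatrix : IsGeneralizedCartanMatrix A
  φ : BKM.Universal A →ₗ⁅ℂ⁆ 𝔤
  ker_le_center : φ.ker ≤ LieAlgebra.center ℂ (BKM.Universal A)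
  lie_mem_range : ∀ x y : 𝔤, y ∈ φ.range → ⁅x, y⁆ ∈ φ.range
  D : LieSubalgebra ℂ 𝔤
  abelian_D : IsLieAbelian D
  isCompl : IsCompl φ.range.toSubmodule D.toSubmodule
  /-- The Cartan subalgebra. -/
  cartan : Submodule ℂ 𝔤
  cartan_eq : cartan =
    Submodule.span ℂ (Set.range fun i => φ (BKM.gen A (BKMGenerator.h i))) ⊔ D.toSubmodule
  /-- The simple roots. -/
  α : I → Module.Dual ℂ cartan
  /-- The simple coroots. -/
  coroot : I → cartan
  coroot_eq : ∀ i, (coroot i : 𝔤) = φ (BKM.gen A (BKMGenerator.h i))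
  α_coroot : ∀ i j, α j (coroot i) = (A i j : ℂ)
  lie_e : ∀ (t : cartan) (i : I), ⁅(t : 𝔤), φ (BKM.gen A (BKMGenerator.e i))⁆ =
    α i t • φ (BKM.gen A (BKMGenerator.e i))
  lie_f : ∀ (t : cartan) (i : I), ⁅(t : 𝔤), φ (BKM.gen A (BKMGenerator.f i))⁆ =
    -(α i t • φ (BKM.gen A (BKMGenerator.f i)))

/-! ### Fricke Lie algebras -/

/-- The structure of a Fricke Lie algebra on `𝔤`. The form on the dual of the Cartan subalgebra is
the standard one: `(α i, l) = Q i * l (h_i)`, so that `(α i, α j) = Q i * A i j`. -/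
structure FrickeLieAlgebra {I : Type*} (A : Matrix I I ℝ) (𝔤 : Type*)
    [LieRing 𝔤] [LieAlgebra ℂ 𝔤] extends BorcherdsKacMoody A 𝔤 where
  rank_eq_two : Module.finrank ℂ cartan = 2
  /-- The index of the unique real simple root. -/
  i₀ : I
  real_iff : ∀ i, 0 < A i i ↔ i = i₀
  norm_ne_zero : ∀ i, A i i ≠ 0
  Q : I → ℝ
  Q_pos : ∀ i, 0 < Q i
  form : LinearMap.BilinForm ℂ (Module.Dual ℂ cartan)
  form_symm : form.IsSymm
  form_nondegenerate : form.Nondegenerate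
  form_α : ∀ i l, form (α i) l = (Q i : ℂ) * l (coroot i)
  /-- The Weyl vector. -/
  ρ : Module.Dual ℂ cartan
  weyl_norm : form ρ ρ = 0
  weyl : ∀ i, form (α i) ρ = -(form (α i) (α i) / 2)
  finite_norm_gt : ∀ B : ℝ, {i : I | -B < Q i * A i i}.Finite

namespace FrickeLieAlgebra

variable {I : Type*} {A : Matrix I I ℝ} {𝔤 : Type*} [LieRing 𝔤] [LieAlgebra ℂ 𝔤]

/-- The weight of bidegree `(a, b)`, in the coordinates of the root space in which the Weyl vector
is `(-1, 0)` and the real simple root is `(1, -1)`. -/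
noncomputable def weight (F : FrickeLieAlgebra A 𝔤) (a b : ℤ) : Module.Dual ℂ F.cartan :=
  (a : ℂ) • (-F.ρ) + (b : ℂ) • (-F.ρ - F.α F.i₀)

/-- The homogeneous piece `𝔤_{a,b}`: the root space of bidegree `(a, b)`. When the grading is by
`ℤ × (1/N)ℤ`, this is the piece of degree `(a, b/N)`. -/
noncomputable def piece (F : FrickeLieAlgebra A 𝔤) (a b : ℤ) : Submodule ℂ 𝔤 :=
  ⨅ t : F.cartan, Module.End.eigenspace (LieAlgebra.ad ℂ 𝔤 (t : 𝔤)) (F.weight a b t)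

end FrickeLieAlgebra

/-! ### Group actions and q-compatibility -/

/-- An action of a group `H` on a Fricke Lie algebra by homogeneous Lie algebra automorphisms. -/
structure HomogeneousAction {I : Type*} {A : Matrix I I ℝ} {𝔤 : Type*} [LieRing 𝔤]
    [LieAlgebra ℂ 𝔤] (F : FrickeLieAlgebra A 𝔤) (H : Type*) [Group H] where
  act : Representation ℂ H 𝔤
  act_lie : ∀ (g : H) (x y : 𝔤), act g ⁅x, y⁆ = ⁅act g x, act g y⁆
  act_mem : ∀ (g : H) (a b : ℤ), ∀ x ∈ F.piece a b, act g x ∈ F.piece a b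

namespace HomogeneousAction

variable {I : Type*} {A : Matrix I I ℝ} {𝔤 : Type*} [LieRing 𝔤] [LieAlgebra ℂ 𝔤]
  {F : FrickeLieAlgebra A 𝔤} {H : Type*} [Group H]

/-- The `H`-module `𝔤_{a,b}`. -/
noncomputable def pieceRep (σ : HomogeneousAction F H) (a b : ℤ) :
    Representation ℂ H (F.piece a b) :=
  σ.act.subrepresentation (F.piece a b) fun g x hx => σ.act_mem g a b x hx

/-- Level `N` q-compatibility: the `H`-module structure on the piece of degree `(a, b/N)`, for
`(a, b) ≠ (0, 0)`, depends only on the value of `ab/N` and the residues of `a` and `b` mod `N`. -/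
def IsQCompatible (σ : HomogeneousAction F H) (N : ℕ) : Prop :=
  ∀ a b a' b' : ℤ, (a, b) ≠ (0, 0) → (a', b') ≠ (0, 0) → a * b = a' * b' →
    (a : ZMod N) = (a' : ZMod N) → (b : ZMod N) = (b' : ZMod N) →
    Nonempty ((σ.pieceRep a b).Equiv (σ.pieceRep a' b'))

end HomogeneousAction

/-- A system of `H`-modules `V^{k,r}_n` that replace the pieces of the Lie algebra. The module
`V k s M` stands for `V^{k,r}_n` with `r = s/N` and `n = M/N`; the piece of degree `(a, b/N)` is
isomorphic to `V^{a,b/N}_{ab/N}`. -/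
structure QModules.{w, u₁, u₂, u₃} {I : Type u₁} {A : Matrix I I ℝ} {𝔤 : Type u₂} [LieRing 𝔤] [LieAlgebra ℂ 𝔤]
    {F : FrickeLieAlgebra A 𝔤} {H : Type u₃} [Group H] (σ : HomogeneousAction F H) (N : ℕ) where
  V : ZMod N → ZMod N → ℤ → Type w
  [addCommGroup : ∀ k s M, AddCommGroup (V k s M)]
  [module : ∀ k s M, Module ℂ (V k s M)]
  rep : ∀ k s M, Representation ℂ H (V k s M)
  equiv : ∀ a b : ℤ, (a, b) ≠ (0, 0) →
    Nonempty ((σ.pieceRep a b).Equiv (rep (a : ZMod N) (b : ZMod N) (a * b)))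

attribute [instance] QModules.addCommGroup QModules.module

/-- A level `N` q-compatible action has such a system of modules. -/
theorem HomogeneousAction.IsQCompatible.nonempty_qModules.{w, u₁, u₃} {I : Type u₁}
    {A : Matrix I I ℝ} {𝔤 : Type w} [LieRing 𝔤] [LieAlgebra ℂ 𝔤] {F : FrickeLieAlgebra A 𝔤} {H : Type u₃} [Group H]
    {σ : HomogeneousAction F H} {N : ℕ} (hσ : σ.IsQCompatible N) :
    Nonempty (QModules.{w, u₁, w, u₃} σ N) := by
  classical
  let P (k s : ZMod N) (M : ℤ) (p : ℤ × ℤ) : Prop :=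
    p ≠ (0, 0) ∧ (p.1 : ZMod N) = k ∧ (p.2 : ZMod N) = s ∧ p.1 * p.2 = M
  let c (k s : ZMod N) (M : ℤ) : ℤ × ℤ := if h : ∃ p, P k s M p then h.choose else (0, 0)
  refine ⟨{ V := fun k s M => F.piece (c k s M).1 (c k s M).2
            rep := fun k s M => σ.pieceRep (c k s M).1 (c k s M).2
            equiv := fun a b hab => ?_ }⟩
  have hex : ∃ p, P (a : ZMod N) (b : ZMod N) (a * b) p := ⟨(a, b), hab, rfl, rfl, rfl⟩
  have hc : P (a : ZMod N) (b : ZMod N) (a * b) (c a b (a * b)) := by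
    simp only [c, dif_pos hex]
    exact hex.choose_spec
  exact hσ a b _ _ hab hc.1 hc.2.2.2.symm hc.2.1.symm hc.2.2.1.symm

/-! ### Trace functions and equivariant Hecke operators

A formal series `∑ c(x) q^x` with rational exponents is given by its coefficient function
`c : ℚ → ℂ`. -/

open Classical in
/-- The trace functions
`f_{k,l,m}(q) = ∑_{n ∈ (1/N)ℤ} ∑_{r ∈ (1/N)ℤ/ℤ, kr - n ∈ ℤ} e^{2πi l r} Tr(h^m | V^{k,r}_n) q^n`,
with `r = s/N` for `s : ZMod N`. -/
noncomputable def QModules.traceFunction {I : Type*} {A : Matrix I I ℝ} {𝔤 : Type*} [LieRing 𝔤]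
    [LieAlgebra ℂ 𝔤] {F : FrickeLieAlgebra A 𝔤} {H : Type*} [Group H]
    {σ : HomogeneousAction F H} {N : ℕ} [NeZero N] (W : QModules σ N) (h : H) (k l m : ℤ) :
    ℚ → ℂ := fun n =>
  if ∃ M : ℤ, n = (M : ℚ) / (N : ℚ) then
    ∑ s : ZMod N, if (k : ZMod N) * s = ((((N : ℚ) * n).num : ℤ) : ZMod N) then
      Complex.exp (2 * Real.pi * Complex.I * (l : ℂ) * ((s.val : ℂ) / (N : ℂ))) *
        LinearMap.trace ℂ _ (W.rep (k : ZMod N) s (((N : ℚ) * n).num) (h ^ m))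
    else 0
  else 0

/-- The coefficients of `f(e^{2πi b/d} q^{a/d})`: the term `c(y) q^y` of `f` contributes
`e^{2πi b y/d} c(y) q^{a y/d}`. -/
noncomputable def twistedSubst (f : ℚ → ℂ) (a b d : ℕ) : ℚ → ℂ := fun x =>
  let y : ℚ := x * (d : ℚ) / (a : ℚ)
  Complex.exp (2 * Real.pi * Complex.I * ((b : ℂ) * (y : ℂ) / (d : ℂ))) * f y

/-- The equivariant Hecke operator
`T̂_n f_{k,l,m}(q) = (1/n) ∑_{ad = n, 0 ≤ b < d} f_{dk, al - bk, am}(e^{2πi b/d} q^{a/d})`. -/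
noncomputable def equivariantHecke (n : ℕ) (f : ℤ → ℤ → ℤ → ℚ → ℂ) (k l m : ℤ) : ℚ → ℂ := fun x =>
  (1 / (n : ℂ)) * ∑ p ∈ n.divisorsAntidiagonal, ∑ b ∈ Finset.range p.2,
    twistedSubst (f ((p.2 : ℤ) * k) ((p.1 : ℤ) * l - (b : ℤ) * k) ((p.1 : ℤ) * m)) p.1 b p.2 x

/-- `f_{k,l,m}` is Hecke-monic: it is a genuine generalized power series (so that polynomials in it
make sense), and `n T̂_n f_{k,l,m}` is a monic polynomial of degree `n` in it for all `n ≥ 1`. -/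
def IsHeckeMonic (f : ℤ → ℤ → ℤ → ℚ → ℂ) (k l m : ℤ) : Prop :=
  ∃ S : HahnSeries ℚ ℂ, S.coeff = f k l m ∧
    ∀ n : ℕ, 1 ≤ n → ∃ P : Polynomial ℂ, P.Monic ∧ P.natDegree = n ∧
      ∀ x : ℚ, (n : ℂ) * equivariantHecke n f k l m x = (Polynomial.aeval S P).coeff x

/-! The Weyl vector is isotropic and every simple root has nonzero norm, so the Weyl condition
forces every simple root to have bidegree `(1, b i)`, with `b = -1` for the real one and `b ≥ 1` for
the others (`nonempty_coordinates`). The positive part `n` is therefore the sum of the pieces with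
first coordinate at least `1`, and its weights lie in a cone that makes every sum finite.

Let `L_m` be the generating series in the second coordinate of the supertraces of `h` on the part of
the exterior algebra of `n` with first coordinate `m`. The standard cobracket, corrected by Cartan
terms so that it kills the simple root vectors, extends to an odd derivation `D` of the exterior
algebra. With the Chevalley-Eilenberg boundary `∂`, the Laplacian `∂D + D∂` acts on weight `w` by a
nonzero multiple of `(w.1 - 1) * w.2`, which is `(w + ρ, w + ρ)` up to a constant
(`laplacian_eq_smul`). Cyclicity of the trace then makes the supertrace vanish unless `w.1 = 1` or
`w.2 = 0` (`supertrace_map_eq_zero`). Hence `L_m` is a constant for `m ≥ 2`. This plays the role of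
the twisted denominator formula.

Newton's identities (`newton_supertrace`, `newton_series`) read `n L_n = -∑ U_k L_{n-k}`, where
`U_k` is the sum over `ad = k` of `d` times the series of traces of `h^a` on the pieces with first
coordinate `d`, the piece `(d, e)` being placed at exponent `ae`. Since `L_0 = 1`, `L_1 = -U_1` and
the other `L_m` are constants, each `U_n` is a monic polynomial of degree `n` in `U_1`
(`exists_monic_eval₂_eq`).

Finally, the sum over `b` in the Hecke operator is a character sum. It selects exactly those classes
`(k, r, n)` that come from an actual piece of the Lie algebra, so that `n T̂_n f_{1,0,1} = U_n`
(`sum_twistedSubst_eq`); the case `n = 1` gives `f_{1,0,1} = U_1`. -/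

namespace ExteriorAlgebra

/-! ### Even and odd operators on an exterior algebra -/

variable {R V : Type*} [CommRing R] [AddCommGroup V] [Module R V]

/-- Induction over left multiplication by vectors. -/
theorem leftInduction {C : ExteriorAlgebra R V → Prop} (one : C 1)
    (smul : ∀ (r : R) x, C x → C (r • x)) (add : ∀ x y, C x → C y → C (x + y))
    (ι_mul : ∀ x v, C x → C (ι R v * x)) (x : ExteriorAlgebra R V) : C x := by
  refine CliffordAlgebra.left_induction (Q := (0 : QuadraticForm R V)) (P := C) ?_ add ?_ x
  · intro r
    rw [Algebra.algebraMap_eq_smul_one]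
    exact smul r 1 one
  · exact fun x v hx => ι_mul x v hx

/-- The odd operator `D` with `D 1 = 0` and `D (v w) = g v w - v D w`. -/
noncomputable def oddExtension (g : V →ₗ[R] ExteriorAlgebra R V →ₗ[R] ExteriorAlgebra R V)
    (hg : ∀ v w, ι R v * g v w = g v (ι R v * w)) :
    ExteriorAlgebra R V →ₗ[R] ExteriorAlgebra R V :=
  CliffordAlgebra.foldr' (0 : QuadraticForm R V)
    (LinearMap.mk₂ R (fun v p => g v p.1 - ι R v * p.2)
      (by intros; simp [add_mul]; abel) (by intros; simp [smul_sub])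
      (by intros; simp [mul_add]; abel) (by intros; simp [smul_sub]))
    (by
      intro v x fx
      -- Compatibility with `v² = 0`: the rule applied twice to `v v x` leaves `g v (v x) - v g v
      -- x`, which `hg` kills.
      have h1 : CliffordAlgebra.ι (0 : QuadraticForm R V) v = ι R v := rfl
      simp only [LinearMap.mk₂_apply, h1, mul_sub, ← mul_assoc, ι_sq_zero, zero_mul, sub_zero,
        _root_.zero_apply, zero_smul, hg, sub_self]) 0

theorem oddExtension_one (g : V →ₗ[R] ExteriorAlgebra R V →ₗ[R] ExteriorAlgebra R V) (hg) :
    oddExtension g hg 1 = 0 := by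
  rw [oddExtension, ← map_one (algebraMap R _), CliffordAlgebra.foldr'_algebraMap, smul_zero]

theorem oddExtension_ι_mul (g : V →ₗ[R] ExteriorAlgebra R V →ₗ[R] ExteriorAlgebra R V) (hg)
    (v : V) (w : ExteriorAlgebra R V) :
    oddExtension g hg (ι R v * w) = g v w - ι R v * oddExtension g hg w :=
  CliffordAlgebra.foldr'_ι_mul (0 : QuadraticForm R V) _ _ _ _ _

/-- The derivation of the exterior algebra that extends a linear endomorphism. -/
noncomputable def derivation (T : V →ₗ[R] V) : ExteriorAlgebra R V →ₗ[R] ExteriorAlgebra R V :=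
  CliffordAlgebra.foldr' (0 : QuadraticForm R V)
    (LinearMap.mk₂ R (fun v p => ι R (T v) * p.1 + ι R v * p.2)
      (by intros; simp [add_mul]; abel) (by intros; simp)
      (by intros; simp [mul_add]; abel) (by intros; simp))
    (by
      intro v x fx
      have h1 : CliffordAlgebra.ι (0 : QuadraticForm R V) v = ι R v := rfl
      simp only [LinearMap.mk₂_apply, h1, mul_add, ← mul_assoc, ι_sq_zero, zero_mul, add_zero,
        _root_.zero_apply, zero_smul]
      rw [← add_mul, ι_add_mul_swap, zero_mul]) 0

@[simp] theorem derivation_one (T : V →ₗ[R] V) : derivation T 1 = 0 := by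
  rw [derivation, ← map_one (algebraMap R _), CliffordAlgebra.foldr'_algebraMap, smul_zero]

theorem derivation_ι_mul (T : V →ₗ[R] V) (v : V) (w : ExteriorAlgebra R V) :
    derivation T (ι R v * w) = ι R (T v) * w + ι R v * derivation T w :=
  CliffordAlgebra.foldr'_ι_mul (0 : QuadraticForm R V) _ _ _ _ _

@[simp] theorem derivation_ι (T : V →ₗ[R] V) (v : V) : derivation T (ι R v) = ι R (T v) := by
  simpa using derivation_ι_mul T v 1

theorem derivation_mul (T : V →ₗ[R] V) (x y : ExteriorAlgebra R V) :
    derivation T (x * y) = derivation T x * y + x * derivation T y := by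
  induction x using leftInduction with
  | one => simp
  | smul r x hx => simp [hx]
  | add x y hx hy => simp only [add_mul, map_add, hx, hy]; abel
  | ι_mul x v hx => simp only [mul_assoc, derivation_ι_mul, hx, add_mul, mul_add]; abel

theorem derivation_add (S T : V →ₗ[R] V) : derivation (S + T) = derivation S + derivation T := by
  refine LinearMap.ext fun w => ?_
  induction w using leftInduction with
  | one => simp
  | smul r x hx => simp only [map_smul, hx]
  | add x y hx hy => simp only [map_add, hx, hy]
  | ι_mul x v hx =>
    simp only [derivation_ι_mul, hx, LinearMap.add_apply, map_add, add_mul, mul_add]; abel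

theorem derivation_smul (r : R) (T : V →ₗ[R] V) : derivation (r • T) = r • derivation T := by
  refine LinearMap.ext fun w => ?_
  induction w using leftInduction with
  | one => simp
  | smul r x hx => simp only [map_smul, hx]
  | add x y hx hy => simp only [map_add, hx, hy]
  | ι_mul x v hx => simp [derivation_ι_mul, hx]

theorem derivation_lie (S T : V →ₗ[R] V) (w : ExteriorAlgebra R V) :
    derivation (S * T - T * S) w = derivation S (derivation T w) - derivation T (derivation S w) := by
  induction w using leftInduction with
  | one => simp
  | smul r x hx => simp only [map_smul, hx, smul_sub]
  | add x y hx hy => simp only [map_add, hx, hy]; abel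
  | ι_mul x v hx =>
    simp only [derivation_ι_mul, hx, map_add, LinearMap.sub_apply, Module.End.mul_apply, map_sub,
      sub_mul, mul_sub]
    abel

/-- Passing a vector across two odd factors produces two signs. This is the compatibility that makes
`oddDerivation` well defined. -/
theorem commute_ι_of_mem_sq {p : ExteriorAlgebra R V}
    (hp : p ∈ LinearMap.range (ι R (M := V)) * LinearMap.range (ι R (M := V))) (v : V) :
    p * ι R v = ι R v * p := by
  induction hp using Submodule.mul_induction_on' with
  | mem_mul_mem a ha b hb =>
    obtain ⟨y, rfl⟩ := ha
    obtain ⟨z, rfl⟩ := hb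
    have h1 := eq_neg_of_add_eq_zero_left (ι_add_mul_swap (R := R) z v)
    have h2 := eq_neg_of_add_eq_zero_left (ι_add_mul_swap (R := R) y v)
    rw [mul_assoc, h1, mul_neg, ← mul_assoc, h2, neg_mul, neg_neg, mul_assoc]
  | add x hx y hy h1 h2 => rw [add_mul, mul_add, h1, h2]

theorem derivation_mem_sq (T : V →ₗ[R] V) {p : ExteriorAlgebra R V}
    (hp : p ∈ LinearMap.range (ι R (M := V)) * LinearMap.range (ι R (M := V))) :
    derivation T p ∈ LinearMap.range (ι R (M := V)) * LinearMap.range (ι R (M := V)) := by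
  induction hp using Submodule.mul_induction_on' with
  | mem_mul_mem a ha b hb =>
    obtain ⟨y, rfl⟩ := ha
    obtain ⟨z, rfl⟩ := hb
    rw [derivation_mul, derivation_ι, derivation_ι]
    exact add_mem (Submodule.mul_mem_mul ⟨_, rfl⟩ ⟨_, rfl⟩) (Submodule.mul_mem_mul ⟨_, rfl⟩ ⟨_, rfl⟩)
  | add x hx y hy h1 h2 => rw [map_add]; exact add_mem h1 h2

/-- The odd derivation that extends a linear map into the exterior square. -/
noncomputable def oddDerivation (δ : V →ₗ[R] ExteriorAlgebra R V)
    (hδ : ∀ x, δ x ∈ LinearMap.range (ι R (M := V)) * LinearMap.range (ι R (M := V))) :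
    ExteriorAlgebra R V →ₗ[R] ExteriorAlgebra R V :=
  oddExtension ((LinearMap.mul R _).comp δ) fun v w => by
    simp only [LinearMap.comp_apply, LinearMap.mul_apply', ← mul_assoc,
      commute_ι_of_mem_sq (hδ v)]

theorem oddDerivation_one (δ : V →ₗ[R] ExteriorAlgebra R V) (hδ) : oddDerivation δ hδ 1 = 0 :=
  oddExtension_one _ _

theorem oddDerivation_ι_mul (δ : V →ₗ[R] ExteriorAlgebra R V) (hδ) (v : V)
    (w : ExteriorAlgebra R V) :
    oddDerivation δ hδ (ι R v * w) = δ v * w - ι R v * oddDerivation δ hδ w :=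
  oddExtension_ι_mul _ _ v w

/-! ### The adjoint action and the Chevalley-Eilenberg boundary -/

section Lie

variable {L : Type*} [LieRing L] [LieAlgebra R L]

/-- The adjoint action of a Lie algebra on its exterior algebra. -/
noncomputable def adjoint : L →ₗ[R] ExteriorAlgebra R L →ₗ[R] ExteriorAlgebra R L where
  toFun x := derivation (LieAlgebra.ad R L x : L →ₗ[R] L)
  map_add' x y := by rw [map_add, derivation_add]
  map_smul' r x := by rw [map_smul, derivation_smul, RingHom.id_apply]

theorem adjoint_one (x : L) : adjoint (R := R) x 1 = 0 := derivation_one _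

theorem adjoint_ι_mul (x y : L) (w : ExteriorAlgebra R L) :
    adjoint x (ι R y * w) = ι R ⁅x, y⁆ * w + ι R y * adjoint x w := derivation_ι_mul _ _ _

theorem adjoint_ι (x y : L) : adjoint x (ι R y) = ι R ⁅x, y⁆ := derivation_ι _ _

theorem adjoint_mul (x : L) (u w : ExteriorAlgebra R L) :
    adjoint x (u * w) = adjoint x u * w + u * adjoint x w := derivation_mul _ _ _

theorem adjoint_lie (x y : L) (w : ExteriorAlgebra R L) :
    adjoint ⁅x, y⁆ w = adjoint x (adjoint y w) - adjoint y (adjoint x w) := by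
  have h : (LieAlgebra.ad R L ⁅x, y⁆ : L →ₗ[R] L) =
      LieAlgebra.ad R L x * LieAlgebra.ad R L y - LieAlgebra.ad R L y * LieAlgebra.ad R L x := by
    ext z
    simp
  simp only [adjoint, LinearMap.coe_mk, AddHom.coe_mk, h, derivation_lie]

/-- The Chevalley-Eilenberg boundary. -/
noncomputable def boundary : ExteriorAlgebra R L →ₗ[R] ExteriorAlgebra R L :=
  oddExtension adjoint fun v w => by rw [adjoint_ι_mul, lie_self, map_zero, zero_mul, zero_add]

theorem boundary_one : boundary (1 : ExteriorAlgebra R L) = 0 := oddExtension_one _ _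

theorem boundary_ι_mul (x : L) (w : ExteriorAlgebra R L) :
    boundary (ι R x * w) = adjoint x w - ι R x * boundary w := oddExtension_ι_mul _ _ _ _

theorem boundary_ι (x : L) : boundary (ι R x) = 0 := by
  simpa [adjoint_one, boundary_one] using boundary_ι_mul x (1 : ExteriorAlgebra R L)

theorem boundary_ι_mul_ι (x y : L) : boundary (ι R x * ι R y) = ι R ⁅x, y⁆ := by
  rw [boundary_ι_mul, boundary_ι, adjoint_ι, mul_zero, sub_zero]

theorem boundary_adjoint (x : L) (w : ExteriorAlgebra R L) :
    boundary (adjoint x w) = adjoint x (boundary w) := by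
  induction w using leftInduction with
  | one => simp [adjoint_one, boundary_one]
  | smul r x hx => simp only [map_smul, hx]
  | add x y hx hy => simp only [map_add, hx, hy]
  | ι_mul w v hw =>
    simp only [adjoint_ι_mul, map_add, boundary_ι_mul, hw, map_sub, adjoint_lie]
    abel

theorem boundary_mem_range_of_mem_sq {p : ExteriorAlgebra R L}
    (hp : p ∈ LinearMap.range (ι R (M := L)) * LinearMap.range (ι R (M := L))) :
    boundary p ∈ LinearMap.range (ι R (M := L)) := by
  induction hp using Submodule.mul_induction_on' with
  | mem_mul_mem a ha b hb =>
    obtain ⟨y, rfl⟩ := ha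
    obtain ⟨z, rfl⟩ := hb
    exact ⟨_, (boundary_ι_mul_ι y z).symm⟩
  | add x hx y hy h1 h2 => rw [map_add]; exact add_mem h1 h2

theorem boundary_map (g : L →ₗ[R] L) (hg : ∀ x y, g ⁅x, y⁆ = ⁅g x, g y⁆)
    (w : ExteriorAlgebra R L) : boundary (map g w) = map g (boundary w) := by
  have key : ∀ x (w : ExteriorAlgebra R L), adjoint (g x) (map g w) = map g (adjoint x w) := by
    intro x w
    induction w using leftInduction with
    | one => simp [adjoint_one]
    | smul r x hx => simp only [map_smul, hx]
    | add x y hx hy => simp only [map_add, hx, hy]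
    | ι_mul w v hw => simp only [map_mul, map_apply_ι, adjoint_ι_mul, map_add, hw, hg]
  induction w using leftInduction with
  | one => simp [boundary_one]
  | smul r x hx => simp only [map_smul, hx]
  | add x y hx hy => simp only [map_add, hx, hy]
  | ι_mul w v hw => simp only [map_mul, map_apply_ι, boundary_ι_mul, map_sub, hw, key]

/-- The defect of the product rule for the boundary of a product with an element of the exterior
square. -/
theorem boundary_mul_defect {p : ExteriorAlgebra R L}
    (hp : p ∈ LinearMap.range (ι R (M := L)) * LinearMap.range (ι R (M := L))) (v : L)
    (w : ExteriorAlgebra R L) :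
    boundary (p * (ι R v * w)) - p * boundary (ι R v * w) - boundary p * (ι R v * w) =
      adjoint v p * w - ι R v * (boundary (p * w) - p * boundary w - boundary p * w) := by
  -- The boundary is a second-order operator, so its defect obeys a first-order rule in `w`. In the
  -- expansion `p` commutes with `v`, while `boundary p` is a vector and anticommutes with it.
  obtain ⟨z, hz⟩ := boundary_mem_range_of_mem_sq hp
  have h1 := eq_neg_of_add_eq_zero_left (ι_add_mul_swap (R := R) z v)
  have h2 : boundary p * (ι R v * w) = -(ι R v * (boundary p * w)) := by
    rw [← hz, ← mul_assoc, h1, neg_mul, mul_assoc]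
  have h3 : ∀ u, p * (ι R v * u) = ι R v * (p * u) := fun u => by
    rw [← mul_assoc, commute_ι_of_mem_sq hp, mul_assoc]
  rw [h2, h3, boundary_ι_mul, adjoint_mul, boundary_ι_mul, mul_sub p, h3, mul_sub, mul_sub]
  abel

end Lie

end ExteriorAlgebra

/-! ### Traces of compressions to subspaces -/

section TraceOn

variable {K V W : Type*} [Field K] [AddCommGroup V] [Module K V]

/-- A projection onto a subspace. -/
noncomputable def Submodule.someProjection (p : Submodule K V) : V →ₗ[K] p :=
  (p.subtype.exists_leftInverse_of_injective p.ker_subtype).choose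

theorem Submodule.someProjection_coe (p : Submodule K V) (x : p) : p.someProjection x = x :=
  LinearMap.congr_fun (p.subtype.exists_leftInverse_of_injective p.ker_subtype).choose_spec x

theorem Submodule.coe_someProjection {p : Submodule K V} {x : V} (hx : x ∈ p) :
    (p.someProjection x : V) = x :=
  congrArg Subtype.val (p.someProjection_coe ⟨x, hx⟩)

/-- The trace of the compression of an endomorphism to a subspace. -/
noncomputable def LinearMap.traceOn (p : Submodule K V) : (V →ₗ[K] V) →ₗ[K] K where
  toFun T := LinearMap.trace K p (p.someProjection ∘ₗ T ∘ₗ p.subtype)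
  map_add' S T := by rw [LinearMap.add_comp, LinearMap.comp_add, map_add]
  map_smul' r T := by rw [LinearMap.smul_comp, LinearMap.comp_smul, map_smul, RingHom.id_apply]

namespace LinearMap

theorem traceOn_apply (p : Submodule K V) (T : V →ₗ[K] V) :
    traceOn p T = LinearMap.trace K p (p.someProjection ∘ₗ T ∘ₗ p.subtype) := rfl

theorem traceOn_congr {p : Submodule K V} {S T : V →ₗ[K] V} (h : ∀ x ∈ p, S x = T x) :
    traceOn p S = traceOn p T := by
  rw [traceOn_apply, traceOn_apply]
  congr 1
  ext x
  simp [h x x.2]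

theorem traceOn_eq_zero {p : Submodule K V} {T : V →ₗ[K] V} (h : ∀ x ∈ p, T x = 0) :
    traceOn p T = 0 := by
  rw [traceOn_congr (T := 0) h, map_zero]

theorem traceOn_eq_trace {p : Submodule K V} {T : V →ₗ[K] V} (U : p →ₗ[K] p)
    (h : ∀ x : p, (U x : V) = T x) : traceOn p T = LinearMap.trace K p U := by
  rw [traceOn_apply]
  congr 1
  ext x
  simp only [LinearMap.comp_apply, Submodule.subtype_apply, ← h, Submodule.someProjection_coe]

/-- `S` and `T` need only exchange `p` and `q`: each compression then factors through the other
subspace and cyclicity of the trace applies. Every supertrace argument below rests on this. -/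
theorem traceOn_mul_comm {p q : Submodule K V} [FiniteDimensional K p] [FiniteDimensional K q]
    {S T : V →ₗ[K] V} (hS : ∀ x ∈ q, S x ∈ p) (hT : ∀ x ∈ p, T x ∈ q) :
    traceOn p (S ∘ₗ T) = traceOn q (T ∘ₗ S) := by
  have h1 : p.someProjection ∘ₗ (S ∘ₗ T) ∘ₗ p.subtype =
      (p.someProjection ∘ₗ S ∘ₗ q.subtype) ∘ₗ (q.someProjection ∘ₗ T ∘ₗ p.subtype) := by
    ext x
    simp [Submodule.coe_someProjection (hT x x.2)]
  have h2 : q.someProjection ∘ₗ (T ∘ₗ S) ∘ₗ q.subtype =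
      (q.someProjection ∘ₗ T ∘ₗ p.subtype) ∘ₗ (p.someProjection ∘ₗ S ∘ₗ q.subtype) := by
    ext x
    simp [Submodule.coe_someProjection (hS x x.2)]
  rw [traceOn_apply, traceOn_apply, h1, h2, LinearMap.trace_comp_comm']

theorem traceOn_eq_sum {p : Submodule K V} {J : Type*} [Fintype J] (b : Module.Basis J K p)
    (π : V →ₗ[K] p) (hπ : ∀ x : p, π x = x) {T : V →ₗ[K] V} (hT : ∀ x ∈ p, T x ∈ p) :
    traceOn p T = ∑ j, b.coord j (π (T (b j))) := by
  classical
  rw [traceOn_eq_trace (T.restrict hT) fun x => rfl, LinearMap.trace_eq_matrix_trace K b,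
    Matrix.trace]
  refine Finset.sum_congr rfl fun j _ => ?_
  rw [Matrix.diag_apply, LinearMap.toMatrix_apply, Module.Basis.coord_apply]
  congr 2
  rw [← hπ ((T.restrict hT) (b j)), LinearMap.coe_restrict_apply]

end LinearMap

end TraceOn

/-! ### The bigraded exterior algebra, supertraces and Newton's identities -/

namespace ExteriorAlgebra

variable {K V : Type*} [Field K] [AddCommGroup V] [Module K V]

/-- Products of `k` homogeneous vectors of total weight `w`. -/
inductive IsMonomial (P : ℤ × ℤ → Submodule K V) : ℕ → ℤ × ℤ → ExteriorAlgebra K V → Prop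
  | one : IsMonomial P 0 0 1
  | ι_mul {k w u} (l : ℤ × ℤ) (x : V) (hx : x ∈ P l) (hu : IsMonomial P k w u) :
      IsMonomial P (k + 1) (l + w) (ι K x * u)

/-- The part of exterior degree `k` and weight `w`. -/
def graded (P : ℤ × ℤ → Submodule K V) (k : ℕ) (w : ℤ × ℤ) : Submodule K (ExteriorAlgebra K V) :=
  Submodule.span K {u | IsMonomial P k w u}

variable {P : ℤ × ℤ → Submodule K V}

theorem IsMonomial.mem {k w u} (hu : IsMonomial P k w u) : u ∈ graded P k w :=
  Submodule.subset_span hu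

theorem map_mem_of_monomial {A : Type*} [AddCommGroup A] [Module K A] {k w}
    (T : ExteriorAlgebra K V →ₗ[K] A) (q : Submodule K A)
    (h : ∀ u, IsMonomial P k w u → T u ∈ q) {u} (hu : u ∈ graded P k w) : T u ∈ q := by
  have : graded P k w ≤ q.comap T := Submodule.span_le.2 h
  exact this hu

theorem eq_of_monomial {A : Type*} [AddCommGroup A] [Module K A] {k w}
    (S T : ExteriorAlgebra K V →ₗ[K] A)
    (h : ∀ u, IsMonomial P k w u → S u = T u) {u} (hu : u ∈ graded P k w) : S u = T u := by
  have := map_mem_of_monomial (P := P) (S - T) ⊥ (k := k) (w := w)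
    (fun u hu => by simp [h u hu]) hu
  rwa [Submodule.mem_bot, LinearMap.sub_apply, sub_eq_zero] at this

theorem ι_mul_mem_graded {k : ℕ} {l w : ℤ × ℤ} {x : V} (hx : x ∈ P l) {u}
    (hu : u ∈ graded P k w) : ι K x * u ∈ graded P (k + 1) (l + w) :=
  map_mem_of_monomial (LinearMap.mulLeft K (ι K x)) _
    (fun _ hu => (IsMonomial.ι_mul l x hx hu).mem) hu

theorem ι_mem_graded {l : ℤ × ℤ} {x : V} (hx : x ∈ P l) : ι K x ∈ graded P 1 l := by
  simpa using ι_mul_mem_graded hx (IsMonomial.one (P := P)).mem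

theorem graded_mul_mem {k m : ℕ} {w z : ℤ × ℤ} {u v} (hu : u ∈ graded P k w)
    (hv : v ∈ graded P m z) : u * v ∈ graded P (k + m) (w + z) := by
  refine map_mem_of_monomial (LinearMap.mulRight K v) _ (fun u hu => ?_) hu
  clear * - hu hv
  induction hu with
  | one => simpa using hv
  | ι_mul l x hx _ ih =>
    rw [LinearMap.mulRight_apply] at ih ⊢
    have h := ι_mul_mem_graded hx ih
    rwa [← mul_assoc, ← add_assoc, Nat.add_right_comm] at h

/-- The weights lie in the cone `a ≥ 1`, `a + b ≥ 0`. -/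
def ConeSupported (P : ℤ × ℤ → Submodule K V) : Prop :=
  ∀ l, ∀ x ∈ P l, x ≠ 0 → 1 ≤ l.1 ∧ 0 ≤ l.1 + l.2

theorem ConeSupported.monomial (hP : ConeSupported P) {k w u} (hu : IsMonomial P k w u)
    (h0 : u ≠ 0) : (k : ℤ) ≤ w.1 ∧ 0 ≤ w.1 + w.2 := by
  induction hu with
  | one => simp
  | ι_mul l x hx _ ih =>
    have h1 := hP l x hx (by rintro rfl; simp at h0)
    have h2 := ih (right_ne_zero_of_mul h0)
    simp only [Prod.fst_add, Prod.snd_add]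
    omega

/-- Each factor contributes at least `1` to the first coordinate and at least `0` to the sum of the
coordinates. In particular only the exterior degrees `k ≤ w.1` occur in weight `w`. -/
theorem ConeSupported.graded_eq_bot (hP : ConeSupported P) {k : ℕ} {w : ℤ × ℤ}
    (h : w.1 < k ∨ w.1 + w.2 < 0) : graded P k w = ⊥ := by
  refine Submodule.span_eq_bot.2 fun u hu => ?_
  by_contra h0
  have := hP.monomial hu h0
  omega

theorem graded_zero_of_ne {w : ℤ × ℤ} (hw : w ≠ 0) : graded P 0 w = ⊥ := by
  refine Submodule.span_eq_bot.2 fun u hu => ?_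
  cases hu
  exact absurd rfl hw

theorem graded_zero_zero : graded P 0 0 = Submodule.span K {1} := by
  refine congrArg _ (Set.ext fun u => ⟨fun hu => ?_, ?_⟩)
  · generalize hw : (0 : ℤ × ℤ) = w at hu
    cases hu
    rfl
  · rintro rfl
    exact .one

/-- Split off the first factor of a monomial. The cone conditions on that factor and on the rest
confine its weight to a finite box, and induction on `k` handles the rest. -/
theorem ConeSupported.graded_finiteDimensional (hP : ConeSupported P)
    (hfd : ∀ l, FiniteDimensional K (P l)) (k : ℕ) (w : ℤ × ℤ) :
    FiniteDimensional K (graded P k w) := by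
  rw [← Submodule.fg_iff_finiteDimensional]
  induction k generalizing w with
  | zero =>
    by_cases hw : w = 0
    · rw [hw, graded_zero_zero]
      exact Submodule.fg_span (Set.finite_singleton _)
    · rw [graded_zero_of_ne hw]
      exact Submodule.fg_bot
  | succ k ih =>
    have hfg : (⨆ l ∈ Finset.Icc ((1 : ℤ), -w.1) (w.1, w.1 + w.2),
        (P l).map (ι K) * graded P k (w - l)).FG :=
      Submodule.fg_biSup _ _ fun l _ =>
        (((Submodule.fg_iff_finiteDimensional _).2 (hfd l)).map _).mul (ih _)
    have := (Submodule.fg_iff_finiteDimensional _).1 hfg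
    refine (Submodule.fg_iff_finiteDimensional _).2
      (Submodule.finiteDimensional_of_le (Submodule.span_le.2 fun u hu => ?_ :
        graded P (k + 1) w ≤ ⨆ l ∈ Finset.Icc ((1 : ℤ), -w.1) (w.1, w.1 + w.2),
        (P l).map (ι K) * graded P k (w - l)))
    by_cases h0 : u = 0
    · rw [h0]; exact zero_mem _
    cases hu with
    | @ι_mul _ z v l x hx hv =>
      have h1 := hP l x hx (by rintro rfl; simp at h0)
      have h2 := hP.monomial hv (right_ne_zero_of_mul h0)
      have hl : l ∈ Finset.Icc ((1 : ℤ), -(l + z).1) ((l + z).1, (l + z).1 + (l + z).2) := by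
        simp only [Finset.mem_Icc, Prod.le_def, Prod.fst_add, Prod.snd_add]
        omega
      refine Submodule.mem_iSup_of_mem l (Submodule.mem_iSup_of_mem hl
        (Submodule.mul_mem_mul (Submodule.mem_map_of_mem hx) ?_))
      rw [add_sub_cancel_left]
      exact hv.mem

theorem map_mem_graded {g : V →ₗ[K] V} (hg : ∀ l, ∀ x ∈ P l, g x ∈ P l) {k w} {u}
    (hu : u ∈ graded P k w) : map g u ∈ graded P k w := by
  refine map_mem_of_monomial (map g).toLinearMap _ (fun u hu => ?_) hu
  clear * - hu hg
  rw [AlgHom.toLinearMap_apply]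
  induction hu with
  | one => rw [map_one]; exact IsMonomial.one.mem
  | ι_mul l x hx _ ih => rw [map_mul, map_apply_ι]; exact ι_mul_mem_graded (hg l x hx) ih

/-- Contraction with a linear form. -/
noncomputable def contract (φ : Module.Dual K V) : ExteriorAlgebra K V →ₗ[K] ExteriorAlgebra K V :=
  CliffordAlgebra.contractLeft (Q := (0 : QuadraticForm K V)) φ

theorem contract_one (φ : Module.Dual K V) : contract φ 1 = 0 :=
  CliffordAlgebra.contractLeft_one (Q := (0 : QuadraticForm K V)) φ

theorem contract_ι_mul (φ : Module.Dual K V) (x : V) (u : ExteriorAlgebra K V) :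
    contract φ (ι K x * u) = φ x • u - ι K x * contract φ u :=
  CliffordAlgebra.contractLeft_ι_mul (Q := (0 : QuadraticForm K V)) (d := φ) x u

theorem contract_graded_zero (φ : Module.Dual K V) {w u} (hu : u ∈ graded P 0 w) :
    contract φ u = 0 := by
  refine (Submodule.mem_bot K).1 (map_mem_of_monomial (contract φ) ⊥ (fun u hu => ?_) hu)
  cases hu
  exact (Submodule.mem_bot K).2 (contract_one φ)

theorem contract_mem_graded {φ : Module.Dual K V} {l : ℤ × ℤ}
    (hφ : ∀ m, m ≠ l → ∀ x ∈ P m, φ x = 0) {k w u} (hu : u ∈ graded P (k + 1) w) :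
    contract φ u ∈ graded P k (w - l) := by
  refine map_mem_of_monomial (contract φ) _ (fun u hu => ?_) hu
  generalize hj : k + 1 = j at hu
  clear * - hu hφ hj
  induction hu generalizing k with
  | one => omega
  | @ι_mul j z v m x hx hv ih =>
    obtain rfl : k = j := by omega
    rw [contract_ι_mul]
    refine sub_mem ?_ ?_
    · by_cases hm : m = l
      · rw [hm, add_sub_cancel_left]
        exact Submodule.smul_mem _ _ hv.mem
      · rw [hφ m hm x hx, zero_smul]
        exact zero_mem _
    · cases k with
      | zero => rw [contract_graded_zero φ hv.mem, mul_zero]; exact zero_mem _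
      | succ k => rw [add_sub_assoc]; exact ι_mul_mem_graded hx (ih rfl)

/-- The supertrace on the part of weight `w`. -/
noncomputable def supertrace (P : ℤ × ℤ → Submodule K V) (w : ℤ × ℤ) :
    (ExteriorAlgebra K V →ₗ[K] ExteriorAlgebra K V) →ₗ[K] K :=
  ∑ k ∈ Finset.range (w.1.toNat + 1), (-1 : K) ^ k • LinearMap.traceOn (graded P k w)

/-- The truncation in `supertrace` is immaterial, because the omitted exterior degrees vanish. This
allows index shifts between different weights. -/
theorem ConeSupported.supertrace_eq (hP : ConeSupported P) {w : ℤ × ℤ} {M : ℕ} (hM : w.1 < M)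
    (T : ExteriorAlgebra K V →ₗ[K] ExteriorAlgebra K V) :
    supertrace P w T = ∑ k ∈ Finset.range M, (-1 : K) ^ k * LinearMap.traceOn (graded P k w) T := by
  have key : ∀ M : ℕ, w.1.toNat + 1 ≤ M → ∑ k ∈ Finset.range (w.1.toNat + 1),
      (-1 : K) ^ k * LinearMap.traceOn (graded P k w) T =
      ∑ k ∈ Finset.range M, (-1 : K) ^ k * LinearMap.traceOn (graded P k w) T := by
    intro M hM
    refine Finset.sum_subset (Finset.range_mono hM) fun k _ hk => ?_
    rw [Finset.mem_range] at hk
    rw [hP.graded_eq_bot (Or.inl (by omega)), LinearMap.traceOn_eq_zero, mul_zero]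
    intro x hx
    rw [(Submodule.mem_bot K).1 hx, map_zero]
  simp only [supertrace, LinearMap.sum_apply, LinearMap.smul_apply, smul_eq_mul]
  by_cases h : w.1.toNat + 1 ≤ M
  · exact key M h
  · have h0 : w.1 < 0 ∧ M = 0 := by omega
    rw [h0.2, Finset.sum_range_zero]
    refine Finset.sum_eq_zero fun k _ => ?_
    rw [hP.graded_eq_bot (Or.inl (by omega)), LinearMap.traceOn_eq_zero, mul_zero]
    intro x hx
    rw [(Submodule.mem_bot K).1 hx, map_zero]

theorem ConeSupported.supertrace_eq_zero (hP : ConeSupported P) {w : ℤ × ℤ} (hw : w.1 < 0)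
    (T : ExteriorAlgebra K V →ₗ[K] ExteriorAlgebra K V) : supertrace P w T = 0 := by
  rw [hP.supertrace_eq (M := 0) (by exact_mod_cast hw), Finset.sum_range_zero]

theorem supertrace_congr {w : ℤ × ℤ} {S T : ExteriorAlgebra K V →ₗ[K] ExteriorAlgebra K V}
    (h : ∀ k, ∀ u ∈ graded P k w, S u = T u) : supertrace P w S = supertrace P w T := by
  simp only [supertrace, LinearMap.sum_apply, LinearMap.smul_apply]
  exact Finset.sum_congr rfl fun k _ => by rw [LinearMap.traceOn_congr (h k)]

/-- Move multiplication by `v` once around the trace: it passes `map g` and becomes multiplication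
by `g v`, cyclicity puts it to the right of the contraction, and the relation `c v = φ v - v c` for
the contraction `c` restores the original order. The weight drops by `l`, and the drop in exterior
degree reverses the sign. -/
theorem supertrace_map_contract (hP : ConeSupported P) (hfd : ∀ l, FiniteDimensional K (P l))
    {g : V →ₗ[K] V} (hg : ∀ l, ∀ x ∈ P l, g x ∈ P l) {l : ℤ × ℤ} {v : V} (hv : v ∈ P l)
    (hl : 0 ≤ l.1)
    {φ : Module.Dual K V} (hφ : ∀ m, m ≠ l → ∀ x ∈ P m, φ x = 0) (w : ℤ × ℤ) :
    supertrace P w ((map g).toLinearMap ∘ₗ LinearMap.mulLeft K (ι K v) ∘ₗ contract φ) =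
      -(φ (g v) * supertrace P (w - l) (map g).toLinearMap) + supertrace P (w - l)
        ((map g).toLinearMap ∘ₗ LinearMap.mulLeft K (ι K (g v)) ∘ₗ contract φ) := by
  have := hP.graded_finiteDimensional hfd
  have h1 : (map g).toLinearMap ∘ₗ LinearMap.mulLeft K (ι K v) ∘ₗ contract φ =
      LinearMap.mulLeft K (ι K (g v)) ∘ₗ ((map g).toLinearMap ∘ₗ contract φ) := by
    refine LinearMap.ext fun u => ?_
    simp
  have h2 : ((map g).toLinearMap ∘ₗ contract φ) ∘ₗ LinearMap.mulLeft K (ι K (g v)) =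
      φ (g v) • (map g).toLinearMap -
        (map g).toLinearMap ∘ₗ LinearMap.mulLeft K (ι K (g v)) ∘ₗ contract φ := by
    refine LinearMap.ext fun u => ?_
    simp [contract_ι_mul]
  have hM : w.1 < (w.1.toNat + 1 : ℕ) := by omega
  rw [hP.supertrace_eq (M := w.1.toNat + 2) (by omega), Finset.sum_range_succ',
    LinearMap.traceOn_eq_zero (p := graded P 0 w) (fun x hx => by
      simp [contract_graded_zero φ hx]), mul_zero, add_zero]
  have h3 : ∀ k, LinearMap.traceOn (graded P (k + 1) w)
      ((map g).toLinearMap ∘ₗ LinearMap.mulLeft K (ι K v) ∘ₗ contract φ) =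
      φ (g v) * LinearMap.traceOn (graded P k (w - l)) (map g).toLinearMap -
      LinearMap.traceOn (graded P k (w - l))
        ((map g).toLinearMap ∘ₗ LinearMap.mulLeft K (ι K (g v)) ∘ₗ contract φ) := by
    intro k
    rw [h1, LinearMap.traceOn_mul_comm (q := graded P k (w - l)), h2, map_sub, map_smul,
      smul_eq_mul]
    · intro x hx
      have := ι_mul_mem_graded (hg l v hv) hx
      rwa [add_sub_cancel] at this
    · intro x hx
      exact map_mem_graded hg (contract_mem_graded hφ hx)
  have hM' : (w - l).1 < (w.1.toNat + 1 : ℕ) := by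
    rw [Prod.fst_sub]; omega
  rw [hP.supertrace_eq hM', hP.supertrace_eq hM', Finset.mul_sum, ← Finset.sum_neg_distrib,
    ← Finset.sum_add_distrib]
  refine Finset.sum_congr rfl fun k _ => ?_
  rw [h3]
  ring

/-- Repeating the rotation unrolls a geometric series in `g`. The remainder sits in weight `w - n •
l`, hence vanishes for large `n` when `1 ≤ l.1`. -/
theorem supertrace_map_contract_iterate (hP : ConeSupported P)
    (hfd : ∀ l, FiniteDimensional K (P l))
    {g : V →ₗ[K] V} (hg : ∀ l, ∀ x ∈ P l, g x ∈ P l) {l : ℤ × ℤ} {v : V} (hv : v ∈ P l)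
    (hl : 0 ≤ l.1)
    {φ : Module.Dual K V} (hφ : ∀ m, m ≠ l → ∀ x ∈ P m, φ x = 0) (n : ℕ) (w : ℤ × ℤ) :
    supertrace P w ((map g).toLinearMap ∘ₗ LinearMap.mulLeft K (ι K v) ∘ₗ contract φ) =
      -(∑ i ∈ Finset.range n, φ ((g ^ (i + 1)) v) *
          supertrace P (w - (i + 1) • l) (map g).toLinearMap) + supertrace P (w - n • l)
        ((map g).toLinearMap ∘ₗ LinearMap.mulLeft K (ι K ((g ^ n) v)) ∘ₗ contract φ) := by
  have hpow : ∀ n, (g ^ n) v ∈ P l := by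
    intro n
    induction n with
    | zero => simpa using hv
    | succ n ih => rw [pow_succ', Module.End.mul_apply]; exact hg l _ ih
  induction n with
  | zero => simp
  | succ n ih =>
    rw [ih, supertrace_map_contract hP hfd hg (hpow n) hl hφ, Finset.sum_range_succ,
      ← Module.End.mul_apply, ← pow_succ', sub_sub, ← succ_nsmul]
    ring

/-- The pieces need not span `V`, so the projection is taken along a complement of `P l` that
contains all the other pieces. -/
theorem exists_projection (hind : iSupIndep P) (l : ℤ × ℤ) :
    ∃ π : V →ₗ[K] P l, (∀ x : P l, π x = x) ∧ ∀ m, m ≠ l → ∀ x ∈ P m, π x = 0 := by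
  obtain ⟨q, hq, hc⟩ := (hind l).symm.exists_isCompl
  refine ⟨(P l).projectionOnto q hc.symm, fun x => ?_, fun m hm x hx => ?_⟩
  · exact Submodule.projectionOnto_apply_left _ x
  · exact (Submodule.projectionOnto_apply_eq_zero_iff _).2
      (hq (Submodule.mem_iSup_of_mem m (Submodule.mem_iSup_of_mem hm hx)))

/-- Newton's identities for the supertraces on the exterior algebra of a graded space. -/
theorem newton_supertrace (hP : ConeSupported P) (hfd : ∀ l, FiniteDimensional K (P l))
    (hind : iSupIndep P) {g : V →ₗ[K] V} (hg : ∀ l, ∀ x ∈ P l, g x ∈ P l) (w : ℤ × ℤ) :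
    (w.1 : K) * supertrace P w (map g).toLinearMap =
      -∑ l ∈ Finset.Icc ((1 : ℤ), -w.1) (w.1, w.1 + w.2), (l.1 : K) *
        ∑ i ∈ Finset.range (w.1.toNat + 1), LinearMap.traceOn (P l) (g ^ (i + 1)) *
          supertrace P (w - (i + 1) • l) (map g).toLinearMap := by
  choose π hπ1 hπ2 using exists_projection hind
  let b := fun l => Module.finBasis K (P l)
  -- `N l` is the number operator that counts factors from `P l`: the even derivation extending the
  -- projection `π l`, written with a basis and its dual basis.
  let N : ℤ × ℤ → ExteriorAlgebra K V →ₗ[K] ExteriorAlgebra K V := fun l =>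
    ∑ j, LinearMap.mulLeft K (ι K (b l j : V)) ∘ₗ contract ((b l).coord j ∘ₗ π l)
  have hN1 : ∀ l, N l 1 = 0 := fun l => by
    simp [N, LinearMap.sum_apply, contract_one]
  have hN : ∀ l x u, N l (ι K x * u) = ι K (π l x : V) * u + ι K x * N l u := by
    intro l x u
    have h1 : (π l x : V) = ∑ j, (b l).coord j (π l x) • (b l j : V) := by
      conv_lhs => rw [← (b l).sum_repr (π l x)]
      simp only [Submodule.coe_sum, Submodule.coe_smul, Module.Basis.coord_apply]
    rw [h1]
    simp only [N, LinearMap.sum_apply, LinearMap.comp_apply, LinearMap.mulLeft_apply,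
      contract_ι_mul, map_sum, Finset.sum_mul, Finset.mul_sum, ← Finset.sum_add_distrib]
    refine Finset.sum_congr rfl fun j _ => ?_
    have h2 := eq_neg_of_add_eq_zero_left (ι_add_mul_swap (R := K) (b l j : V) x)
    rw [mul_sub, ← mul_assoc _ (ι K x), h2, map_smul, smul_mul_assoc, mul_smul_comm, neg_mul,
      sub_neg_eq_add, mul_assoc]
  set S := Finset.Icc ((1 : ℤ), -w.1) (w.1, w.1 + w.2) with hS
  -- Euler's identity for the first coordinate. The two bounds on `z` pass to submonomials and keep
  -- the weight of every factor inside the box `S`.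
  have hdeg : ∀ k z u, IsMonomial P k z u → z.1 ≤ w.1 → z.1 + z.2 ≤ w.1 + w.2 →
      ∑ l ∈ S, (l.1 : K) • N l u = (z.1 : K) • u := by
    intro k z u hu
    induction hu with
    | one => intros; simp [hN1]
    | @ι_mul k z u l x hx hu ih =>
      intro hz1 hz2
      by_cases h0 : ι K x * u = 0
      · simp [h0]
      have h1 := hP l x hx (by rintro rfl; simp at h0)
      have h2 := hP.monomial hu (right_ne_zero_of_mul h0)
      simp only [Prod.fst_add, Prod.snd_add] at hz1 hz2
      have hl : l ∈ S := by
        simp only [hS, Finset.mem_Icc, Prod.le_def]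
        omega
      have h3 : ∀ m ∈ S, (m.1 : K) • (ι K (π m x : V) * u) =
          if m = l then (l.1 : K) • (ι K x * u) else 0 := by
        intro m _
        split_ifs with hm
        · subst hm
          have := hπ1 m ⟨x, hx⟩
          simp only at this
          rw [this]
        · rw [hπ2 m l (Ne.symm hm) x hx]
          simp
      simp only [hN, smul_add, Finset.sum_add_distrib]
      rw [Finset.sum_congr rfl h3, Finset.sum_ite_eq', if_pos hl]
      simp only [← mul_smul_comm, ← Finset.mul_sum]
      rw [ih (by omega) (by omega)]
      simp only [Prod.fst_add, Int.cast_add, mul_smul_comm, add_smul, mul_add]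
  have htr : ∀ l ∈ S, supertrace P w ((map g).toLinearMap ∘ₗ N l) =
      -∑ i ∈ Finset.range (w.1.toNat + 1), LinearMap.traceOn (P l) (g ^ (i + 1)) *
          supertrace P (w - (i + 1) • l) (map g).toLinearMap := by
    intro l hl
    have hl1 : 1 ≤ l.1 := by
      simp only [hS, Finset.mem_Icc, Prod.le_def] at hl
      omega
    have hpow : ∀ n, ∀ x ∈ P l, (g ^ n) x ∈ P l := by
      intro n x hx
      induction n with
      | zero => simpa using hx
      | succ n ih => rw [pow_succ', Module.End.mul_apply]; exact hg l _ ih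
    have h1 : (map g).toLinearMap ∘ₗ N l = ∑ j, (map g).toLinearMap ∘ₗ
        LinearMap.mulLeft K (ι K (b l j : V)) ∘ₗ contract ((b l).coord j ∘ₗ π l) := by
      refine LinearMap.ext fun u => ?_
      simp [N, LinearMap.sum_apply]
    rw [h1, map_sum]
    have h2 : ∀ j, supertrace P w ((map g).toLinearMap ∘ₗ
        LinearMap.mulLeft K (ι K (b l j : V)) ∘ₗ contract ((b l).coord j ∘ₗ π l)) =
        -∑ i ∈ Finset.range (w.1.toNat + 1), (b l).coord j (π l ((g ^ (i + 1)) (b l j))) *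
          supertrace P (w - (i + 1) • l) (map g).toLinearMap := by
      intro j
      rw [supertrace_map_contract_iterate hP hfd hg (b l j).2 (by omega)
        (fun m hm x hx => by rw [LinearMap.comp_apply, hπ2 l m hm x hx, map_zero])
        (w.1.toNat + 1) w, hP.supertrace_eq_zero (w := w - (w.1.toNat + 1) • l), add_zero]
      · rfl
      -- After `w.1.toNat + 1` rotations the first coordinate is negative because `1 ≤ l.1`, so the
      -- remainder is zero.
      · have h3 : w.1 < ((w.1.toNat + 1 : ℕ) : ℤ) := by omega
        generalize w.1.toNat + 1 = n at h3 ⊢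
        change w.1 - n • l.1 < 0
        rw [nsmul_eq_mul]
        nlinarith
    simp only [h2, Finset.sum_neg_distrib]
    rw [Finset.sum_comm]
    refine congrArg _ (Finset.sum_congr rfl fun i _ => ?_)
    rw [← Finset.sum_mul, LinearMap.traceOn_eq_sum (b l) (π l) (hπ1 l) (hpow _)]
  have h4 : (w.1 : K) * supertrace P w (map g).toLinearMap =
      supertrace P w (∑ l ∈ S, (l.1 : K) • ((map g).toLinearMap ∘ₗ N l)) := by
    rw [← smul_eq_mul, ← map_smul]
    refine supertrace_congr fun k u hu => eq_of_monomial _ _ (fun u hu => ?_) hu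
    have := congrArg (map g) (hdeg k w u hu le_rfl le_rfl)
    simp only [map_sum, map_smul] at this
    simp [LinearMap.sum_apply, this]
  rw [h4, map_sum, ← Finset.sum_neg_distrib]
  refine Finset.sum_congr rfl fun l hl => ?_
  rw [map_smul, htr l hl, smul_eq_mul, mul_neg]

end ExteriorAlgebra

/-! ### The Laplacian of a twisted cobracket and the vanishing of supertraces -/

namespace ExteriorAlgebra

variable {K L : Type*} [Field K] [LieRing L] [LieAlgebra K L] {P : ℤ × ℤ → Submodule K L}

theorem adjoint_mem_graded (hbr : ∀ l m, ∀ x ∈ P l, ∀ y ∈ P m, ⁅x, y⁆ ∈ P (l + m)) {l : ℤ × ℤ}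
    {x : L} (hx : x ∈ P l) {k w u} (hu : u ∈ graded P k w) :
    adjoint x u ∈ graded P k (l + w) := by
  refine map_mem_of_monomial (adjoint x) _ (fun u hu => ?_) hu
  clear * - hu hbr hx
  induction hu with
  | one => rw [adjoint_one]; exact zero_mem _
  | ι_mul m y hy hu ih =>
    rw [adjoint_ι_mul]
    refine add_mem ?_ ?_
    · rw [← add_assoc]; exact ι_mul_mem_graded (hbr _ _ _ hx _ hy) hu.mem
    · rw [add_left_comm]; exact ι_mul_mem_graded hy ih

theorem boundary_graded_zero {w u} (hu : u ∈ graded P 0 w) : boundary u = 0 := by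
  refine (Submodule.mem_bot K).1 (map_mem_of_monomial boundary ⊥ (fun u hu => ?_) hu)
  cases hu
  exact (Submodule.mem_bot K).2 boundary_one

theorem boundary_mem_graded (hbr : ∀ l m, ∀ x ∈ P l, ∀ y ∈ P m, ⁅x, y⁆ ∈ P (l + m)) {k w u}
    (hu : u ∈ graded P (k + 1) w) : boundary u ∈ graded P k w := by
  refine map_mem_of_monomial boundary _ (fun u hu => ?_) hu
  generalize hj : k + 1 = j at hu
  clear * - hu hbr hj
  induction hu generalizing k with
  | one => omega
  | @ι_mul j z v m x hx hv ih =>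
    obtain rfl : k = j := by omega
    rw [boundary_ι_mul]
    refine sub_mem (adjoint_mem_graded hbr hx hv.mem) ?_
    cases k with
    | zero => rw [boundary_graded_zero hv.mem, mul_zero]; exact zero_mem _
    | succ k => exact ι_mul_mem_graded hx (ih rfl)

theorem oddDerivation_mem_graded {δ : L →ₗ[K] ExteriorAlgebra K L} (hδ)
    (hgr : ∀ l, ∀ x ∈ P l, δ x ∈ graded P 2 l) {k w u} (hu : u ∈ graded P k w) :
    oddDerivation δ hδ u ∈ graded P (k + 1) w := by
  refine map_mem_of_monomial (oddDerivation δ hδ) _ (fun u hu => ?_) hu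
  clear * - hu hgr
  induction hu with
  | one => rw [oddDerivation_one]; exact zero_mem _
  | @ι_mul k z v m x hx hv ih =>
    rw [oddDerivation_ι_mul]
    refine sub_mem ?_ (ι_mul_mem_graded hx ih)
    rw [show k + 1 + 1 = 2 + k by ring]
    exact graded_mul_mem (hgr m x hx) hv.mem

variable {δ : L →ₗ[K] ExteriorAlgebra K L} {κ : K}

/-- For an honest cocycle the commutator of `D` with the adjoint action of `x` cancels the
second-order defect of the boundary at `δ x`. Both terms are determined by their behaviour under
multiplication by vectors, so only the twist of the cocycle condition survives, and it adds up over
the factors of `u` to the pairing of `l` with the total weight. -/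
theorem twisted_commutator
    (hδ : ∀ x, δ x ∈ LinearMap.range (ι K (M := L)) * LinearMap.range (ι K (M := L)))
    (hcoc : ∀ l m, ∀ x ∈ P l, ∀ y ∈ P m, δ ⁅x, y⁆ = adjoint x (δ y) - adjoint y (δ x) +
      (κ * ((l.1 : K) * m.2 + l.2 * m.1)) • (ι K x * ι K y))
    {l : ℤ × ℤ} {x : L} (hx : x ∈ P l) {k w u} (hu : IsMonomial P k w u) :
    oddDerivation δ hδ (adjoint x u) - adjoint x (oddDerivation δ hδ u) +
      (boundary (δ x * u) - δ x * boundary u - boundary (δ x) * u) =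
      (κ * ((l.1 : K) * w.2 + l.2 * w.1)) • (ι K x * u) := by
  induction hu with
  | one => simp [adjoint_one, boundary_one, oddDerivation_one]
  | @ι_mul k z u m v hv hu ih =>
    have h1 : oddDerivation δ hδ (adjoint x (ι K v * u)) -
        adjoint x (oddDerivation δ hδ (ι K v * u)) = (δ ⁅x, v⁆ - adjoint x (δ v)) * u -
        ι K v * (oddDerivation δ hδ (adjoint x u) - adjoint x (oddDerivation δ hδ u)) := by
      rw [adjoint_ι_mul, map_add, oddDerivation_ι_mul, oddDerivation_ι_mul, oddDerivation_ι_mul,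
        map_sub, adjoint_mul, adjoint_ι_mul, sub_mul, mul_sub]
      abel
    rw [h1, boundary_mul_defect (hδ x), hcoc l m x hx v hv]
    have h3 : ι K v * (ι K x * u) = -(ι K x * (ι K v * u)) := by
      rw [← mul_assoc, eq_neg_of_add_eq_zero_left (ι_add_mul_swap (R := K) v x), neg_mul,
        mul_assoc]
    have h5 : (κ * ((l.1 : K) * (m + z).2 + l.2 * (m + z).1)) =
        κ * ((l.1 : K) * m.2 + l.2 * m.1) + κ * ((l.1 : K) * z.2 + l.2 * z.1) := by
      simp only [Prod.snd_add, Prod.fst_add, Int.cast_add]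
      ring
    rw [h5, add_smul]
    generalize κ * ((l.1 : K) * m.2 + l.2 * m.1) = c
    generalize κ * ((l.1 : K) * z.2 + l.2 * z.1) = d at ih ⊢
    have h2 := congrArg (ι K v * ·) ih
    rw [mul_add, mul_smul_comm, h3, smul_neg] at h2
    rw [show adjoint x (δ v) - adjoint v (δ x) + c • (ι K x * ι K v) - adjoint x (δ v) =
      c • (ι K x * ι K v) - adjoint v (δ x) by abel, sub_mul, smul_mul_assoc, mul_assoc,
      ← neg_eq_iff_eq_neg.2 h2]
    abel

/-- The Laplacian of a twisted cocycle acts by a scalar on each weight space. -/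
theorem laplacian_eq_smul
    (hδ : ∀ x, δ x ∈ LinearMap.range (ι K (M := L)) * LinearMap.range (ι K (M := L)))
    (hcoc : ∀ l m, ∀ x ∈ P l, ∀ y ∈ P m, δ ⁅x, y⁆ = adjoint x (δ y) - adjoint y (δ x) +
      (κ * ((l.1 : K) * m.2 + l.2 * m.1)) • (ι K x * ι K y))
    (hone : ∀ l, ∀ x ∈ P l, boundary (δ x) = (κ * (((l.1 : K) - 1) * l.2)) • ι K x)
    {k w u} (hu : u ∈ graded P k w) :
    boundary (oddDerivation δ hδ u) + oddDerivation δ hδ (boundary u) =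
      (κ * (((w.1 : K) - 1) * w.2)) • u := by
  refine eq_of_monomial (boundary ∘ₗ oddDerivation δ hδ + oddDerivation δ hδ ∘ₗ boundary)
    ((κ * (((w.1 : K) - 1) * w.2)) • LinearMap.id) (fun u hu => ?_) hu
  clear * - hu hcoc hone
  simp only [LinearMap.add_apply, LinearMap.comp_apply, LinearMap.smul_apply, LinearMap.id_apply]
  induction hu with
  | one => simp [boundary_one, oddDerivation_one]
  | @ι_mul k z u l x hx hu ih =>
    have h1 := twisted_commutator hδ hcoc hx hu
    -- The Laplacian of `x u` is the twisted commutator, plus `∂(δ x) u`, plus `x` times the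
    -- Laplacian of `u`. The scalars add up because `(w.1 - 1) * w.2` has polarization `l.1 * z.2 +
    -- l.2 * z.1`.
    have h2 : boundary (oddDerivation δ hδ (ι K x * u)) +
        oddDerivation δ hδ (boundary (ι K x * u)) =
        (oddDerivation δ hδ (adjoint x u) - adjoint x (oddDerivation δ hδ u) +
        (boundary (δ x * u) - δ x * boundary u - boundary (δ x) * u)) + boundary (δ x) * u +
        ι K x * (boundary (oddDerivation δ hδ u) + oddDerivation δ hδ (boundary u)) := by
      simp only [oddDerivation_ι_mul, boundary_ι_mul, map_sub, mul_add]
      abel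
    rw [h2, h1, ih, hone l x hx, smul_mul_assoc, mul_smul_comm, ← add_smul, ← add_smul]
    congr 1
    simp only [Prod.snd_add, Prod.fst_add, Int.cast_add]
    ring

/-- The Laplacian is a nonzero scalar on weight `w`, and the supertrace of its product with `map g`
telescopes: cyclicity moves the boundary around and shifts the exterior degree by one. Neither `∂² =
0` nor a computation of homology is needed. -/
theorem supertrace_map_eq_zero (hP : ConeSupported P) (hfd : ∀ l, FiniteDimensional K (P l))
    (hbr : ∀ l m, ∀ x ∈ P l, ∀ y ∈ P m, ⁅x, y⁆ ∈ P (l + m))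
    (hδ : ∀ x, δ x ∈ LinearMap.range (ι K (M := L)) * LinearMap.range (ι K (M := L)))
    (hgr : ∀ l, ∀ x ∈ P l, δ x ∈ graded P 2 l)
    (hcoc : ∀ l m, ∀ x ∈ P l, ∀ y ∈ P m, δ ⁅x, y⁆ = adjoint x (δ y) - adjoint y (δ x) +
      (κ * ((l.1 : K) * m.2 + l.2 * m.1)) • (ι K x * ι K y))
    (hone : ∀ l, ∀ x ∈ P l, boundary (δ x) = (κ * (((l.1 : K) - 1) * l.2)) • ι K x)
    {g : L →ₗ[K] L} (hg : ∀ l, ∀ x ∈ P l, g x ∈ P l) (hlie : ∀ x y, g ⁅x, y⁆ = ⁅g x, g y⁆)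
    {w : ℤ × ℤ} (hw : κ * (((w.1 : K) - 1) * w.2) ≠ 0) :
    supertrace P w (map g).toLinearMap = 0 := by
  have := hP.graded_finiteDimensional hfd
  have hM : w.1 < (w.1.toNat + 1 : ℕ) := by omega
  have hΓ : ∀ k, ∀ u ∈ graded P k w, (map g).toLinearMap u ∈ graded P k w :=
    fun k u hu => map_mem_graded hg hu
  have hΓd : ∀ u, boundary ((map g).toLinearMap u) = (map g).toLinearMap (boundary u) :=
    fun u => boundary_map g hlie u
  have hlap : ∀ k, ∀ u ∈ graded P k w, _ := fun k u hu => laplacian_eq_smul hδ hcoc hone hu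
  have hD : ∀ k, ∀ u ∈ graded P k w, oddDerivation δ hδ u ∈ graded P (k + 1) w :=
    fun k u hu => oddDerivation_mem_graded hδ hgr hu
  generalize (map g : ExteriorAlgebra K L →ₐ[K] _).toLinearMap = Γ at hΓ hΓd ⊢
  generalize oddDerivation δ hδ = D at hD hlap
  -- The other half of the Laplacian has trace `t (k + 1)` in degree `k`. Both ends of the telescope
  -- vanish: the boundary kills degree `0`, and there is nothing in degree `w.1.toNat + 1`.
  let t : ℕ → K := fun k => LinearMap.traceOn (graded P k w) (Γ ∘ₗ D ∘ₗ boundary)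
  have ht0 : t 0 = 0 := LinearMap.traceOn_eq_zero fun u hu => by
    rw [LinearMap.comp_apply, LinearMap.comp_apply, boundary_graded_zero hu, map_zero, map_zero]
  have htM : t (w.1.toNat + 1) = 0 := LinearMap.traceOn_eq_zero fun u hu => by
    rw [hP.graded_eq_bot (Or.inl hM)] at hu
    rw [(Submodule.mem_bot K).1 hu, map_zero]
  have h1 : ∀ k, LinearMap.traceOn (graded P k w) (boundary ∘ₗ (Γ ∘ₗ D)) = t (k + 1) := fun k => by
    rw [LinearMap.traceOn_mul_comm (q := graded P (k + 1) w)]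
    · rw [LinearMap.comp_assoc]
    · exact fun x hx => boundary_mem_graded hbr hx
    · exact fun x hx => hΓ _ _ (hD _ _ hx)
  have h2 : ∀ k, (κ * (((w.1 : K) - 1) * w.2)) * LinearMap.traceOn (graded P k w) Γ =
      t (k + 1) + t k := fun k => by
    rw [← h1, ← map_add, ← smul_eq_mul, ← map_smul]
    refine LinearMap.traceOn_congr fun u hu => ?_
    have h3 := congrArg Γ (hlap k u hu)
    rw [map_add, map_smul] at h3
    rw [LinearMap.smul_apply, ← h3, LinearMap.add_apply, LinearMap.comp_apply,
      LinearMap.comp_apply, LinearMap.comp_apply, LinearMap.comp_apply, hΓd]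
  have h3 : ∀ M, ∑ k ∈ Finset.range M, (-1 : K) ^ k * (t (k + 1) + t k) =
      t 0 - (-1) ^ M * t M := fun M => by
    induction M with
    | zero => simp
    | succ M ih => rw [Finset.sum_range_succ, ih, pow_succ]; ring
  rw [hP.supertrace_eq hM]
  refine (mul_eq_zero.1 ?_).resolve_left hw
  have h4 := h3 (w.1.toNat + 1)
  simp only [ht0, htM, mul_zero, sub_zero, ← h2] at h4
  rw [Finset.mul_sum, ← h4]
  exact Finset.sum_congr rfl fun k _ => by ring

end ExteriorAlgebra

/-! ### Chevalley relations and the triangular decomposition -/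

theorem FreeLieAlgebra.subalgebra_eq_top {R X : Type*} [CommRing R]
    (S : LieSubalgebra R (FreeLieAlgebra R X)) (hS : ∀ x, FreeLieAlgebra.of R x ∈ S)
    (z : FreeLieAlgebra R X) : z ∈ S := by
  have h : S.incl.comp (FreeLieAlgebra.lift R fun x => (⟨_, hS x⟩ : S)) = LieHom.id := by
    refine FreeLieAlgebra.hom_ext fun x => ?_
    rw [LieHom.comp_apply, FreeLieAlgebra.lift_of_apply]
    rfl
  have h1 := LieHom.congr_fun h z
  rw [LieHom.comp_apply, LieHom.id_apply] at h1
  rw [← h1]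
  exact SetLike.coe_mem _

namespace BKM

variable {I : Type*} {L : Type*} [LieRing L] [LieAlgebra ℂ L]

/-- The relations between the Chevalley generators that do not involve the Serre relations. -/
structure ChevalleyRelations (A : Matrix I I ℝ) (h e f : I → L) : Prop where
  he : ∀ i k, ⁅h i, e k⁆ = (A i k : ℂ) • e k
  hf : ∀ i k, ⁅h i, f k⁆ = -((A i k : ℂ) • f k)
  ef_same : ∀ i, ⁅e i, f i⁆ = h i
  ef_ne : ∀ i j, i ≠ j → ⁅e i, f j⁆ = 0

/-- Right-normed brackets of vectors `e i` of weight `(1, b i)`. -/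
inductive IsBracket (e : I → L) (b : I → ℤ) : ℤ × ℤ → L → Prop
  | base (i : I) : IsBracket e b (1, b i) (e i)
  | step {l x} (i : I) (hx : IsBracket e b l x) : IsBracket e b ((1, b i) + l) ⁅e i, x⁆

/-- The span of the right-normed brackets. -/
def bracketSpan (e : I → L) (b : I → ℤ) : Submodule ℂ L :=
  Submodule.span ℂ {x | ∃ l, IsBracket e b l x}

omit [LieAlgebra ℂ L] in
theorem IsBracket.one_le {e : I → L} {b : I → ℤ} {l x} (hx : IsBracket e b l x) : 1 ≤ l.1 := by
  induction hx with
  | base i => simp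
  | step i _ ih => simp only [Prod.fst_add]; omega

omit [LieAlgebra ℂ L] in
theorem IsBracket.cone {e : I → L} {b : I → ℤ} (hb : ∀ i, -1 ≤ b i) {l x}
    (hx : IsBracket e b l x) : 0 ≤ l.1 + l.2 := by
  induction hx with
  | base i => have := hb i; simp only; omega
  | step i _ ih => have := hb i; simp only [Prod.fst_add, Prod.snd_add]; omega

theorem IsBracket.mem {e : I → L} {b : I → ℤ} {l x} (hx : IsBracket e b l x) :
    x ∈ bracketSpan e b := Submodule.subset_span ⟨l, hx⟩

theorem IsBracket.mem_lieSubalgebra {e : I → L} {b : I → ℤ} {l x} (hx : IsBracket e b l x)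
    (S : LieSubalgebra ℂ L) (hS : ∀ i, e i ∈ S) : x ∈ S := by
  induction hx with
  | base i => exact hS i
  | step i _ ih => exact S.lie_mem (hS i) ih

theorem lie_mem_of_span {s : Set L} {q : Submodule ℂ L} (z : L) (h : ∀ x ∈ s, ⁅z, x⁆ ∈ q) {x : L}
    (hx : x ∈ Submodule.span ℂ s) : ⁅z, x⁆ ∈ q := by
  have : Submodule.span ℂ s ≤ q.comap (LieAlgebra.ad ℂ L z : L →ₗ[ℂ] L) := Submodule.span_le.2 h
  exact this hx

theorem lie_e_mem_bracketSpan (e : I → L) (b : I → ℤ) (i : I) {x} (hx : x ∈ bracketSpan e b) :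
    ⁅e i, x⁆ ∈ bracketSpan e b :=
  lie_mem_of_span (e i) (by rintro x ⟨l, hx⟩; exact (hx.step i).mem) hx

omit [LieAlgebra ℂ L] in
-- In a bracket of weight `w` the part after the outermost `e i` lies in the cone, so `b i ≤ w.1 +
-- w.2` leaves finitely many `i`. The remaining part has smaller first coordinate.
theorem finite_isBracket (e : I → L) {b : I → ℤ} (hb : ∀ i, -1 ≤ b i)
    (hfin : ∀ M, {i | b i ≤ M}.Finite) (w : ℤ × ℤ) : {x | IsBracket e b w x}.Finite := by
  obtain ⟨n, hn⟩ : ∃ n : ℕ, w.1 ≤ n := ⟨w.1.toNat, Int.self_le_toNat _⟩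
  induction n generalizing w with
  | zero =>
    convert Set.finite_empty
    ext x
    simp only [Set.mem_ofPred_eq, Set.mem_empty_iff_false, iff_false]
    intro hx
    have := hx.one_le
    push_cast at hn
    omega
  | succ n ih =>
    have h1 : {x | IsBracket e b w x} ⊆ (⋃ i ∈ {i | b i ≤ w.1 + w.2}, {e i}) ∪
        ⋃ i ∈ {i | b i ≤ w.1 + w.2}, (fun x => ⁅e i, x⁆) '' {x | IsBracket e b (w - (1, b i)) x} := by
      intro x hx
      simp only [Set.mem_ofPred_eq] at hx
      cases hx with
      | base i =>
        left
        simp only [Set.mem_iUnion, Set.mem_ofPred_eq, Set.mem_singleton_iff]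
        exact ⟨i, by omega, rfl⟩
      | @step l y i hy =>
        right
        have h2 := hy.cone hb
        simp only [Set.mem_iUnion, Set.mem_ofPred_eq, Set.mem_image, Prod.fst_add, Prod.snd_add]
        refine ⟨i, by omega, y, ?_, rfl⟩
        rwa [add_sub_cancel_left]
    refine Set.Finite.subset (Set.Finite.union ((hfin _).biUnion fun i _ => Set.finite_singleton _)
      ((hfin _).biUnion fun i _ => (ih _ ?_).image _)) h1
    simp only [Prod.fst_sub]
    push_cast at hn
    omega

namespace ChevalleyRelations

variable {A : Matrix I I ℝ} {h e f : I → L}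

/-- The Chevalley involution, which transfers each statement about `e` to `f`. -/
theorem symm (R : ChevalleyRelations A h e f) : ChevalleyRelations A (-h) f e where
  he i k := by rw [Pi.neg_apply, neg_lie, R.hf, neg_neg]
  hf i k := by rw [Pi.neg_apply, neg_lie, R.he]
  ef_same i := by rw [Pi.neg_apply, ← lie_skew, R.ef_same]
  ef_ne i j hij := by rw [← lie_skew, R.ef_ne j i hij.symm, neg_zero]

theorem hh (R : ChevalleyRelations A h e f) (i j : I) : ⁅h i, h j⁆ = 0 := by
  rw [← R.ef_same j, leibniz_lie, R.he, R.hf, smul_lie, lie_neg, lie_smul, add_neg_cancel]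

theorem lie_h_mem_bracketSpan (R : ChevalleyRelations A h e f) (b : I → ℤ) (i : I) {x}
    (hx : x ∈ bracketSpan e b) : ⁅h i, x⁆ ∈ bracketSpan e b := by
  refine lie_mem_of_span (h i) ?_ hx
  rintro x ⟨l, hx⟩
  induction hx with
  | base k => rw [R.he]; exact Submodule.smul_mem _ _ (IsBracket.base k).mem
  | step k hx ih =>
    rw [leibniz_lie, R.he, smul_lie]
    exact add_mem (Submodule.smul_mem _ _ (hx.step k).mem) (lie_e_mem_bracketSpan _ _ _ ih)

theorem lie_f_mem (R : ChevalleyRelations A h e f) (b : I → ℤ) (i : I) {x}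
    (hx : x ∈ bracketSpan e b) :
    ⁅f i, x⁆ ∈ bracketSpan e b ⊔ Submodule.span ℂ (Set.range h) := by
  have hbase : ∀ k, ⁅f i, e k⁆ ∈ Submodule.span ℂ (Set.range h) := by
    intro k
    rw [← lie_skew]
    refine neg_mem ?_
    by_cases hk : k = i
    · rw [hk, R.ef_same]; exact Submodule.subset_span ⟨i, rfl⟩
    · rw [R.ef_ne k i hk]; exact zero_mem _
  have hbracket : ∀ k, ∀ y ∈ Submodule.span ℂ (Set.range h), ⁅e k, y⁆ ∈ bracketSpan e b := by
    intro k y hy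
    refine lie_mem_of_span (e k) ?_ hy
    rintro _ ⟨j, rfl⟩
    rw [← lie_skew, R.he]
    exact neg_mem (Submodule.smul_mem _ _ (IsBracket.base k).mem)
  refine lie_mem_of_span (f i) ?_ hx
  rintro x ⟨l, hx⟩
  induction hx with
  | base k => exact Submodule.mem_sup_right (hbase k)
  | @step l x k hx ih =>
    rw [leibniz_lie]
    refine Submodule.mem_sup_left (add_mem ?_ ?_)
    · rw [← lie_skew]
      refine neg_mem (lie_mem_of_span x ?_ (hbase k))
      rintro _ ⟨j, rfl⟩
      rw [← lie_skew]
      exact neg_mem (R.lie_h_mem_bracketSpan b j hx.mem)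
    · obtain ⟨y, hy, z, hz, hyz⟩ := Submodule.mem_sup.1 ih
      rw [← hyz, lie_add]
      exact add_mem (lie_e_mem_bracketSpan _ _ _ hy) (hbracket k z hz)

/-- The sum of the negative part, the span of the coroots and the positive part. -/
def triangular (h e f : I → L) (b : I → ℤ) : Submodule ℂ L :=
  bracketSpan e b ⊔ Submodule.span ℂ (Set.range h) ⊔ bracketSpan f b

theorem lie_h_mem_triangular (R : ChevalleyRelations A h e f) (b : I → ℤ) (i : I) {x}
    (hx : x ∈ triangular h e f b) : ⁅h i, x⁆ ∈ triangular h e f b := by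
  obtain ⟨y, hy, z, hz, rfl⟩ := Submodule.mem_sup.1 hx
  obtain ⟨u, hu, v, hv, rfl⟩ := Submodule.mem_sup.1 hy
  rw [lie_add, lie_add]
  refine add_mem (add_mem ?_ ?_) ?_
  · exact Submodule.mem_sup_left (Submodule.mem_sup_left (R.lie_h_mem_bracketSpan b i hu))
  · refine lie_mem_of_span (h i) ?_ hv
    rintro _ ⟨j, rfl⟩
    rw [R.hh]
    exact zero_mem _
  · refine Submodule.mem_sup_right ?_
    have := R.symm.lie_h_mem_bracketSpan b i hz
    rw [Pi.neg_apply, neg_lie] at this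
    exact neg_mem_iff.1 this

theorem lie_f_mem_triangular (R : ChevalleyRelations A h e f) (b : I → ℤ) (i : I) {x}
    (hx : x ∈ triangular h e f b) : ⁅f i, x⁆ ∈ triangular h e f b := by
  obtain ⟨y, hy, z, hz, rfl⟩ := Submodule.mem_sup.1 hx
  obtain ⟨u, hu, v, hv, rfl⟩ := Submodule.mem_sup.1 hy
  rw [lie_add, lie_add]
  refine add_mem (add_mem ?_ ?_) ?_
  · exact Submodule.mem_sup_left (R.lie_f_mem b i hu)
  · refine Submodule.mem_sup_right (lie_mem_of_span (f i) ?_ hv)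
    rintro _ ⟨j, rfl⟩
    rw [← lie_skew, R.hf, neg_neg]
    exact Submodule.smul_mem _ _ (IsBracket.base i).mem
  · exact Submodule.mem_sup_right (lie_e_mem_bracketSpan f b i hz)

theorem triangular_symm : triangular (-h) f e (b := fun _ => (0 : ℤ)) =
    triangular h e f (fun _ => (0 : ℤ)) := by
  have h1 : Submodule.span ℂ (Set.range (-h)) = Submodule.span ℂ (Set.range h) := by
    rw [← Submodule.span_neg (Set.range h)]
    congr 1
    ext x
    simp [neg_eq_iff_eq_neg]
  rw [triangular, triangular, h1, sup_comm, sup_comm (bracketSpan f _), ← sup_assoc]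

/-- The integers `b` only label brackets. Replacing them by zero makes `triangular` invariant under
the Chevalley involution. -/
theorem bracketSpan_eq (e : I → L) (b b' : I → ℤ) : bracketSpan e b = bracketSpan e b' := by
  have key : ∀ b b' : I → ℤ, bracketSpan e b ≤ bracketSpan e b' := by
    intro b b'
    refine Submodule.span_le.2 ?_
    rintro x ⟨l, hx⟩
    induction hx with
    | base i => exact (IsBracket.base i).mem
    | step i _ ih => exact lie_e_mem_bracketSpan e b' i ih
  exact le_antisymm (key b b') (key b' b)

theorem lie_e_mem_triangular (R : ChevalleyRelations A h e f) (b : I → ℤ) (i : I) {x}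
    (hx : x ∈ triangular h e f b) : ⁅e i, x⁆ ∈ triangular h e f b := by
  have h1 : triangular h e f b = triangular (-h) f e (fun _ => (0 : ℤ)) := by
    rw [triangular_symm, triangular, triangular, bracketSpan_eq e b fun _ => 0,
      bracketSpan_eq f b fun _ => 0]
  rw [h1] at hx ⊢
  exact R.symm.lie_f_mem_triangular _ i hx

/-- The triangular decomposition. -/
theorem mem_triangular (R : ChevalleyRelations A h e f) (b : I → ℤ) (p : Free I →ₗ⁅ℂ⁆ L)
    (hh : ∀ i, p (freeH i) = h i) (he : ∀ i, p (freeE i) = e i) (hf : ∀ i, p (freeF i) = f i)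
    (z : Free I) : p z ∈ triangular h e f b := by
  -- The elements that normalize the triangular sum form a subalgebra containing the generators.
  -- Once this is known, the preimage of the sum is itself a subalgebra containing the generators.
  have h1 : ∀ z : Free I, ∀ x ∈ triangular h e f b, ⁅p z, x⁆ ∈ triangular h e f b := by
    let S : LieSubalgebra ℂ (Free I) :=
      { carrier := {z | ∀ x ∈ triangular h e f b, ⁅p z, x⁆ ∈ triangular h e f b}
        add_mem' := fun {z w} hz hw x hx => by
          rw [map_add, add_lie]; exact add_mem (hz x hx) (hw x hx)
        zero_mem' := fun x _ => by rw [map_zero, zero_lie]; exact zero_mem _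
        smul_mem' := fun c z hz x hx => by
          rw [map_smul, smul_lie]; exact Submodule.smul_mem _ _ (hz x hx)
        lie_mem' := fun {z w} hz hw x hx => by
          rw [LieHom.map_lie, lie_lie]
          exact sub_mem (hz _ (hw x hx)) (hw _ (hz x hx)) }
    refine fun z => FreeLieAlgebra.subalgebra_eq_top S (fun g => ?_) z
    cases g with
    | h i => intro x hx; rw [hh]; exact R.lie_h_mem_triangular b i hx
    | e i => intro x hx; rw [he]; exact R.lie_e_mem_triangular b i hx
    | f i => intro x hx; rw [hf]; exact R.lie_f_mem_triangular b i hx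
  let S : LieSubalgebra ℂ (Free I) :=
    { (triangular h e f b).comap (p : Free I →ₗ[ℂ] L) with
      lie_mem' := fun {z w} _ hw => by
        change p ⁅z, w⁆ ∈ triangular h e f b
        rw [LieHom.map_lie]
        exact h1 z _ hw }
  refine FreeLieAlgebra.subalgebra_eq_top S (fun g => ?_) z
  cases g with
  | h i =>
    change p (freeH i) ∈ triangular h e f b
    rw [hh]
    exact Submodule.mem_sup_left (Submodule.mem_sup_right (Submodule.subset_span ⟨i, rfl⟩))
  | e i =>
    change p (freeE i) ∈ triangular h e f b
    rw [he]
    exact Submodule.mem_sup_left (Submodule.mem_sup_left (IsBracket.base i).mem)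
  | f i =>
    change p (freeF i) ∈ triangular h e f b
    rw [hf]
    exact Submodule.mem_sup_right (IsBracket.base i).mem

theorem map {L' : Type*} [LieRing L'] [LieAlgebra ℂ L'] (R : ChevalleyRelations A h e f)
    (φ : L →ₗ⁅ℂ⁆ L') :
    ChevalleyRelations A (fun i => φ (h i)) (fun i => φ (e i)) (fun i => φ (f i)) where
  he i k := by rw [← LieHom.map_lie, R.he, map_smul]
  hf i k := by rw [← LieHom.map_lie, R.hf, map_neg, map_smul]
  ef_same i := by rw [← LieHom.map_lie, R.ef_same]
  ef_ne i j hij := by rw [← LieHom.map_lie, R.ef_ne i j hij, map_zero]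

theorem lie_isBracket {ε : L} {b : I → ℤ} {s : ℂ} (hε : ∀ i, ⁅ε, e i⁆ = s • e i) {l x}
    (hx : IsBracket e b l x) : ⁅ε, x⁆ = (s * (l.1 : ℂ)) • x := by
  induction hx with
  | base i => simp [hε]
  | step i _ ih =>
    rw [leibniz_lie, hε, ih, smul_lie, lie_smul, ← add_smul, Prod.fst_add]
    congr 1
    push_cast
    ring

/-- An element of the triangular decomposition that commutes with a grading element lies in the
span of the coroots. -/
theorem mem_span_of_lie_eq_zero (R : ChevalleyRelations A h e f) {b : I → ℤ} {ε : L}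
    (hεh : ε ∈ Submodule.span ℂ (Set.range h)) (hε : ∀ i, ⁅ε, e i⁆ = e i)
    (hε' : ∀ i, ⁅ε, f i⁆ = -f i) {y : L} (hy : y ∈ triangular h e f b) (h0 : ⁅ε, y⁆ = 0) :
    y ∈ Submodule.span ℂ (Set.range h) := by
  obtain ⟨y', hy', z, hz, rfl⟩ := Submodule.mem_sup.1 hy
  obtain ⟨u, hu, v, hv, rfl⟩ := Submodule.mem_sup.1 hy'
  let T : Module.End ℂ L := LieAlgebra.ad ℂ L ε
  have hv0 : ⁅ε, v⁆ = 0 := by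
    have : ⁅ε, v⁆ ∈ (⊥ : Submodule ℂ L) := by
      refine lie_mem_of_span ε ?_ hv
      rintro _ ⟨i, rfl⟩
      rw [← lie_skew]
      refine neg_mem (lie_mem_of_span (h i) ?_ hεh)
      rintro _ ⟨j, rfl⟩
      rw [R.hh]
      exact zero_mem _
    simpa using this
  -- The grading element has positive integer eigenvalues on brackets of the `e i`, negative ones on
  -- brackets of the `f i`. Hence `u + z` lies both in the kernel and in the sum of the nonzero
  -- eigenspaces.
  have hpos : bracketSpan e b ≤ ⨆ μ : ℂ, ⨆ _ : μ ≠ 0, T.eigenspace μ := by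
    refine Submodule.span_le.2 ?_
    rintro x ⟨l, hx⟩
    refine Submodule.mem_iSup_of_mem ((1 : ℂ) * l.1) (Submodule.mem_iSup_of_mem ?_ ?_)
    · have := hx.one_le
      simp only [one_mul, ne_eq, Int.cast_eq_zero]
      omega
    · exact Module.End.mem_eigenspace_iff.2 (lie_isBracket (s := 1) (by simpa using hε) hx)
  have hneg : bracketSpan f b ≤ ⨆ μ : ℂ, ⨆ _ : μ ≠ 0, T.eigenspace μ := by
    refine Submodule.span_le.2 ?_
    rintro x ⟨l, hx⟩
    refine Submodule.mem_iSup_of_mem ((-1 : ℂ) * l.1) (Submodule.mem_iSup_of_mem ?_ ?_)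
    · have := hx.one_le
      simp only [neg_mul, one_mul, ne_eq, neg_eq_zero, Int.cast_eq_zero]
      omega
    · exact Module.End.mem_eigenspace_iff.2 (lie_isBracket (s := -1) (by simpa using hε') hx)
  have h1 : u + z ∈ ⨆ μ : ℂ, ⨆ _ : μ ≠ 0, T.eigenspace μ := add_mem (hpos hu) (hneg hz)
  have h2 : u + z ∈ T.eigenspace 0 := by
    rw [Module.End.mem_eigenspace_iff, zero_smul]
    change ⁅ε, u + z⁆ = 0
    rw [lie_add, lie_add, hv0, add_zero] at h0
    rw [lie_add, h0]
  have h3 : u + z = 0 := Submodule.disjoint_def.1 (T.eigenspaces_iSupIndep 0) _ h2 h1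
  rw [add_right_comm, h3, zero_add]
  exact hv

end ChevalleyRelations

end BKM

/-! ### The standard cobracket as a cocycle on the free Lie algebra -/

namespace BKM

open ExteriorAlgebra

variable {I : Type*} {L : Type*} [LieRing L] [LieAlgebra ℂ L]

section AffineAction

attribute [local instance] LieRing.ofAssociativeRing

/-- The affine action `(u, t) ↦ (x • u + t m, 0)`. -/
noncomputable def affineAction (x : L) (m : ExteriorAlgebra ℂ L) :
    Module.End ℂ (ExteriorAlgebra ℂ L × ℂ) :=
  LinearMap.inl ℂ _ _ ∘ₗ (adjoint x ∘ₗ LinearMap.fst ℂ _ _ +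
    (LinearMap.snd ℂ _ _).smulRight m)

theorem affineAction_apply (x : L) (m : ExteriorAlgebra ℂ L) (v : ExteriorAlgebra ℂ L × ℂ) :
    affineAction x m v = (adjoint x v.1 + v.2 • m, 0) := rfl

theorem affineAction_lie (x y : L) (m n : ExteriorAlgebra ℂ L) :
    ⁅affineAction x m, affineAction y n⁆ =
      affineAction ⁅x, y⁆ (adjoint x n - adjoint y m) := by
  refine LinearMap.ext fun v => ?_
  rw [LieRing.of_associative_ring_bracket, LinearMap.sub_apply, Module.End.mul_apply,
    Module.End.mul_apply]
  simp only [affineAction_apply, map_add, map_smul, zero_smul, add_zero, adjoint_lie, smul_sub,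
    Prod.mk_sub_mk, sub_self]
  congr 1
  abel

/-- A Lie algebra homomorphism from a free Lie algebra has a 1-cocycle with given values on the
generators. -/
theorem exists_cocycle {X : Type*} (p : FreeLieAlgebra ℂ X →ₗ⁅ℂ⁆ L)
    (μ : X → ExteriorAlgebra ℂ L) :
    ∃ δ : FreeLieAlgebra ℂ X →ₗ[ℂ] ExteriorAlgebra ℂ L,
      (∀ g, δ (FreeLieAlgebra.of ℂ g) = μ g) ∧
      ∀ z w, δ ⁅z, w⁆ = adjoint (p z) (δ w) - adjoint (p w) (δ z) := by
  -- A cocycle with values in a module is the translation part of a homomorphism to affine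
  -- endomorphisms, and such a homomorphism is free to choose on generators. Applying it to `(0, 1)`
  -- reads off the translation part.
  let r : FreeLieAlgebra ℂ X →ₗ⁅ℂ⁆ Module.End ℂ (ExteriorAlgebra ℂ L × ℂ) :=
    FreeLieAlgebra.lift ℂ fun g => affineAction (p (FreeLieAlgebra.of ℂ g)) (μ g)
  let δ : FreeLieAlgebra ℂ X →ₗ[ℂ] ExteriorAlgebra ℂ L :=
    LinearMap.fst ℂ _ _ ∘ₗ LinearMap.applyₗ ((0, 1) : ExteriorAlgebra ℂ L × ℂ) ∘ₗ (r : FreeLieAlgebra ℂ X →ₗ[ℂ] Module.End ℂ (ExteriorAlgebra ℂ L × ℂ))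
  have hδ : ∀ z, δ z = (r z (0, 1)).1 := fun z => rfl
  let S : LieSubalgebra ℂ (FreeLieAlgebra ℂ X) :=
    { carrier := {z | ∃ m, r z = affineAction (p z) m}
      add_mem' := by
        rintro z w ⟨m, hm⟩ ⟨n, hn⟩
        refine ⟨m + n, LinearMap.ext fun v => ?_⟩
        rw [map_add, hm, hn, LinearMap.add_apply]
        simp only [affineAction_apply, map_add, LinearMap.add_apply, smul_add, Prod.mk_add_mk,
          add_zero]
        congr 1
        abel
      zero_mem' := ⟨0, LinearMap.ext fun v => by
        simp [affineAction_apply, Prod.zero_eq_mk]⟩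
      smul_mem' := by
        rintro c z ⟨m, hm⟩
        refine ⟨c • m, LinearMap.ext fun v => ?_⟩
        rw [map_smul, hm, LinearMap.smul_apply]
        simp only [affineAction_apply, map_smul, LinearMap.smul_apply, Prod.smul_mk, smul_add,
          smul_zero, smul_comm c]
      lie_mem' := by
        rintro z w ⟨m, hm⟩ ⟨n, hn⟩
        exact ⟨_, by rw [LieHom.map_lie, LieHom.map_lie, hm, hn, affineAction_lie]⟩ }
  have hr : ∀ z, r z = affineAction (p z) (δ z) := by
    intro z
    obtain ⟨m, hm⟩ := FreeLieAlgebra.subalgebra_eq_top S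
      (fun g => ⟨μ g, FreeLieAlgebra.lift_of_apply _ g⟩) z
    have : δ z = m := by rw [hδ, hm, affineAction_apply]; simp
    rw [hm, this]
  refine ⟨δ, fun g => ?_, fun z w => ?_⟩
  · rw [hδ, FreeLieAlgebra.lift_of_apply, affineAction_apply]
    simp
  · rw [hδ, LieHom.map_lie, hr, hr, affineAction_lie, affineAction_apply]
    simp

end AffineAction

section Cocycle

variable {p : Free I →ₗ⁅ℂ⁆ L} {δ : Free I →ₗ[ℂ] ExteriorAlgebra ℂ L}

/-- One bracketing with `x` in the Serre computation: the Cartan factor gains `q₀ h₀`, and the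
coefficient of the correction `x ∧ w` grows by `2 q₀ u`. The condition `hz` carries the factor `d`
so that it is empty at the start, where there is no correction term. -/
theorem cocycle_step (hδ : ∀ z w, δ ⁅z, w⁆ = adjoint (p z) (δ w) - adjoint (p w) (δ z))
    {x w : Free I} {h₀ t z : L} {q₀ u d : ℂ}
    (hx : ⁅t, p x⁆ = (q₀ * u) • p x) (hw : ⁅h₀, p w⁆ = u • p w)
    (hz : d • ⁅p x, z⁆ = d • p w)
    (hδx : δ x = q₀ • (ι ℂ h₀ * ι ℂ (p x)))
    (hδw : δ w = ι ℂ t * ι ℂ (p w) - d • (ι ℂ (p x) * ι ℂ z)) :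
    δ ⁅x, w⁆ = ι ℂ (t + q₀ • h₀) * ι ℂ (p ⁅x, w⁆) -
      (d + 2 * q₀ * u) • (ι ℂ (p x) * ι ℂ (p w)) := by
  have h1 : ⁅p x, t⁆ = -((q₀ * u) • p x) := by rw [← lie_skew, hx]
  have h2 : ⁅p w, h₀⁆ = -(u • p w) := by rw [← lie_skew, hw]
  have h3 : ⁅p w, p x⁆ = -⁅p x, p w⁆ := (lie_skew _ _).symm
  have h4 : d • (ι ℂ (p x) * ι ℂ ⁅p x, z⁆) = d • (ι ℂ (p x) * ι ℂ (p w)) := by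
    rw [← mul_smul_comm, ← map_smul, hz, map_smul, mul_smul_comm]
  have h5 := eq_neg_of_add_eq_zero_left (ι_add_mul_swap (R := ℂ) (p w) (p x))
  rw [hδ, hδw, hδx, map_sub, map_smul, map_smul, adjoint_mul, adjoint_mul, adjoint_mul]
  simp only [adjoint_ι, h1, h2, h3, lie_self, map_zero, zero_mul, zero_add, h4, map_neg, map_smul,
    map_add, LieHom.map_lie, neg_mul, mul_neg, smul_mul_assoc, h5, add_mul]
  module

theorem lie_ad_pow {x y : Free I} {h₀ : L} {s a : ℂ} (hx : ⁅h₀, p x⁆ = (2 * s) • p x)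
    (hy : ⁅h₀, p y⁆ = (s * a) • p y) (m : ℕ) :
    ⁅h₀, p (((LieAlgebra.ad ℂ (Free I) x) ^ m) y)⁆ =
      (s * (a + 2 * m)) • p (((LieAlgebra.ad ℂ (Free I) x) ^ m) y) := by
  induction m with
  | zero => simpa using hy
  | succ m ih =>
    rw [pow_succ', Module.End.mul_apply, LieAlgebra.ad_apply, LieHom.map_lie, leibniz_lie, hx, ih,
      smul_lie, lie_smul, ← add_smul]
    congr 1
    push_cast
    ring

/-- Summing the steps gives the coefficient `2 s q₀ (m + 1) (a + m)`, which vanishes at `m = -a`,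
the exponent of the Serre relation. The sign `s = ±1` treats the `e` and the `f` relations together,
and `hq` is the symmetry of `QA`. -/
theorem cocycle_serre (hδ : ∀ z w, δ ⁅z, w⁆ = adjoint (p z) (δ w) - adjoint (p w) (δ z))
    {x y : Free I} {h₀ h₁ : L} {q₀ q₁ s a c : ℂ}
    (hx : ⁅h₀, p x⁆ = (2 * s) • p x) (hy : ⁅h₀, p y⁆ = (s * a) • p y)
    (hx' : ⁅h₁, p x⁆ = (s * c) • p x) (hq : q₁ * c = q₀ * a)
    (hδx : δ x = q₀ • (ι ℂ h₀ * ι ℂ (p x))) (hδy : δ y = q₁ • (ι ℂ h₁ * ι ℂ (p y))) (m : ℕ) :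
    δ (((LieAlgebra.ad ℂ (Free I) x) ^ (m + 1)) y) =
      ι ℂ (q₁ • h₁ + ((m + 1 : ℂ) * q₀) • h₀) * ι ℂ (p (((LieAlgebra.ad ℂ (Free I) x) ^ (m + 1)) y))
      - (2 * s * q₀ * (m + 1) * (a + m)) •
        (ι ℂ (p x) * ι ℂ (p (((LieAlgebra.ad ℂ (Free I) x) ^ m) y))) := by
  have ht : ∀ k : ℂ, ⁅q₁ • h₁ + (k * q₀) • h₀, p x⁆ = (q₀ * (s * (a + 2 * k))) • p x := by
    intro k
    rw [add_lie, smul_lie, smul_lie, hx, hx', smul_smul, smul_smul, ← add_smul]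
    congr 1
    linear_combination s * hq
  induction m with
  | zero =>
    have h1 := cocycle_step hδ (t := q₁ • h₁) (w := y) (z := 0) (d := 0) (u := s * a)
      (by simpa using ht 0) hy (by simp) hδx (by rw [hδy]; simp)
    rw [zero_add, pow_one, LieAlgebra.ad_apply, h1, pow_zero, Module.End.one_apply]
    congr 1
    · simp
    · congr 1
      push_cast
      ring
  | succ m ih =>
    have h1 := cocycle_step hδ (u := s * (a + 2 * (m + 1 : ℂ)))
      (ht (m + 1)) (by simpa using lie_ad_pow hx hy (m + 1)) (by
        rw [pow_succ' _ m, Module.End.mul_apply, LieAlgebra.ad_apply, LieHom.map_lie]) hδx ih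
    rw [pow_succ' _ (m + 1), Module.End.mul_apply, LieAlgebra.ad_apply, h1]
    congr 1
    · congr 2
      push_cast
      module
    · congr 1
      push_cast
      ring

variable {A : Matrix I I ℝ} {q : I → ℂ}

/-- The cobracket respects each relation. Symmetry of `QA` cancels the terms in `e i ∧ f j`, makes
the orthogonality relations harmless, and enters the Serre relations, where the coefficient of the
last term is `a + n = 0`. -/
theorem cocycle_relator
    (R : ChevalleyRelations A (fun i => p (freeH i)) (fun i => p (freeE i)) fun i => p (freeF i))
    (hδ : ∀ z w, δ ⁅z, w⁆ = adjoint (p z) (δ w) - adjoint (p w) (δ z))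
    (hq : ∀ i j, q i * A i j = q j * A j i) (htwo : ∀ i, 0 < A i i → A i i = 2)
    (hh : ∀ i, δ (freeH i) = 0)
    (he : ∀ i, δ (freeE i) = q i • (ι ℂ (p (freeH i)) * ι ℂ (p (freeE i))))
    (hf : ∀ i, δ (freeF i) = q i • (ι ℂ (p (freeH i)) * ι ℂ (p (freeF i))))
    {z : Free I} (hz : IsRelator A z) (hpz : p z = 0) : δ z = 0 := by
  have hswap : ∀ x y : L, ι ℂ x * ι ℂ y = -(ι ℂ y * ι ℂ x) := fun x y =>
    eq_neg_of_add_eq_zero_left (ι_add_mul_swap (R := ℂ) x y)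
  have hef : ∀ i j, ⁅p (freeH j), p (freeE i)⁆ = (A j i : ℂ) • p (freeE i) := fun i j => R.he j i
  have hff : ∀ i j, ⁅p (freeH j), p (freeF i)⁆ = -((A j i : ℂ) • p (freeF i)) :=
    fun i j => R.hf j i
  have hhh : ∀ i j, ⁅p (freeH i), p (freeH j)⁆ = 0 := R.hh
  have hef_zero : ∀ i j, adjoint (p (freeE i)) (δ (freeF j)) -
      adjoint (p (freeF j)) (δ (freeE i)) = q j • (ι ℂ (p (freeH j)) * ι ℂ ⁅p (freeE i), p (freeF j)⁆)
        + q i • (ι ℂ (p (freeH i)) * ι ℂ ⁅p (freeE i), p (freeF j)⁆) := by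
    intro i j
    have h1 : ⁅p (freeE i), p (freeH j)⁆ = -((A j i : ℂ) • p (freeE i)) := by
      rw [← lie_skew, hef]
    have h2 : ⁅p (freeF j), p (freeH i)⁆ = (A i j : ℂ) • p (freeF j) := by
      rw [← lie_skew, hff, neg_neg]
    have h3 : ⁅p (freeF j), p (freeE i)⁆ = -⁅p (freeE i), p (freeF j)⁆ := (lie_skew _ _).symm
    have h4 := hswap (p (freeF j)) (p (freeE i))
    simp only [he, hf, map_smul, adjoint_mul, adjoint_ι, h1, h2, h3, map_neg, smul_mul_assoc,
      neg_mul, mul_neg, h4, smul_add, smul_neg, smul_smul, hq i j]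
    module
  have horth : ∀ (s : ℂ) (i j : I) (x y : Free I), A i j = 0 →
      ⁅p (freeH i), p y⁆ = (s * A i j) • p y → ⁅p (freeH j), p x⁆ = (s * A j i) • p x →
      δ x = q i • (ι ℂ (p (freeH i)) * ι ℂ (p x)) → δ y = q j • (ι ℂ (p (freeH j)) * ι ℂ (p y)) →
      p ⁅x, y⁆ = 0 → δ ⁅x, y⁆ = 0 := by
    intro s i j x y hij h1 h2 h3 h4 h5
    have h6 : q j * A j i = 0 := by rw [← hq, hij]; simp
    rw [LieHom.map_lie] at h5
    have h7 : ⁅p y, p x⁆ = 0 := by rw [← lie_skew, h5, neg_zero]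
    have h8 : ⁅p x, p (freeH j)⁆ = -((s * A j i) • p x) := by rw [← lie_skew, h2]
    have h9 : ⁅p y, p (freeH i)⁆ = 0 := by rw [← lie_skew, h1, hij]; simp
    rw [hδ, h3, h4]
    simp only [map_smul, adjoint_mul, adjoint_ι, h5, h7, h8, h9, map_zero, mul_zero, zero_mul,
      add_zero, smul_zero, sub_zero, map_neg, neg_mul, smul_mul_assoc, smul_neg, smul_smul]
    rw [mul_left_comm, h6]
    simp
  have hserre : ∀ (s : ℂ) (i j : I) (n : ℕ) (x y : Free I), 0 < A i i → A i j = -(n : ℝ) →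
      ⁅p (freeH i), p x⁆ = (s * A i i) • p x → ⁅p (freeH i), p y⁆ = (s * A i j) • p y →
      ⁅p (freeH j), p x⁆ = (s * A j i) • p x →
      δ x = q i • (ι ℂ (p (freeH i)) * ι ℂ (p x)) → δ y = q j • (ι ℂ (p (freeH j)) * ι ℂ (p y)) →
      p (((LieAlgebra.ad ℂ (Free I) x) ^ (n + 1)) y) = 0 →
      δ (((LieAlgebra.ad ℂ (Free I) x) ^ (n + 1)) y) = 0 := by
    intro s i j n x y hi hn h0 h1 h2 h3 h4 h5
    rw [htwo i hi, mul_comm] at h0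
    rw [cocycle_serre hδ (by simpa using h0) h1 h2 (hq i j).symm h3 h4 n, h5, hn]
    simp
  cases hz with
  | he i k =>
    rw [map_sub, map_smul, hδ, hh, he, map_zero, sub_zero, map_smul, adjoint_mul, adjoint_ι,
      adjoint_ι, hhh, hef, map_zero, zero_mul, zero_add, map_smul, mul_smul_comm, smul_comm,
      sub_self]
  | hf i k =>
    rw [map_add, map_smul, hδ, hh, hf, map_zero, sub_zero, map_smul, adjoint_mul, adjoint_ι,
      adjoint_ι, hhh, hff, map_zero, zero_mul, zero_add, map_neg, map_smul, mul_neg,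
      mul_smul_comm, smul_neg, smul_comm, neg_add_cancel]
  | ef_same i =>
    rw [map_sub, hδ, hef_zero, hh, R.ef_same, ι_sq_zero]
    simp
  | ef_ne i j hij =>
    rw [hδ, hef_zero, R.ef_ne i j hij]
    simp
  | serre_e i j n hi hij hn =>
    exact hserre 1 i j n _ _ hi hn (by simpa using hef i i) (by simpa using hef j i)
      (by simpa using hef i j) (he i) (he j) hpz
  | serre_f i j n hi hij hn =>
    exact hserre (-1) i j n _ _ hi hn (by simpa using hff i i) (by simpa using hff j i)
      (by simpa using hff i j) (hf i) (hf j) hpz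
  | orth_e i j hij =>
    exact horth 1 i j _ _ hij (by simpa using hef j i) (by simpa using hef i j) (he i) (he j) hpz
  | orth_f i j hij =>
    exact horth (-1) i j _ _ hij (by simpa using hff j i) (by simpa using hff i j) (hf i) (hf j) hpz

/-- By the cocycle rule the common kernel of `p` and `δ` is an ideal, although the kernel of `δ`
alone need not be one. -/
theorem cocycle_relatorIdeal
    (hδ : ∀ z w, δ ⁅z, w⁆ = adjoint (p z) (δ w) - adjoint (p w) (δ z))
    (hp : ∀ z, IsRelator A z → p z = 0) (hrel : ∀ z, IsRelator A z → δ z = 0)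
    {z : Free I} (hz : z ∈ relatorIdeal A) : δ z = 0 := by
  let K : LieIdeal ℂ (Free I) :=
    { LinearMap.ker (p : Free I →ₗ[ℂ] L) ⊓ LinearMap.ker δ with
      lie_mem := by
        rintro w z ⟨h1, h2⟩
        change p z = 0 at h1
        change δ z = 0 at h2
        refine ⟨?_, ?_⟩
        · change p ⁅w, z⁆ = 0
          rw [LieHom.map_lie, h1, lie_zero]
        · change δ ⁅w, z⁆ = 0
          rw [hδ, h1, h2, map_zero, map_zero, LinearMap.zero_apply, sub_zero] }
  have h1 : relatorIdeal A ≤ K :=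
    LieSubmodule.lieSpan_le.2 fun z hz => ⟨hp z hz, hrel z hz⟩
  exact (h1 hz).2

end Cocycle

end BKM

/-! ### Descent of the cobracket to a Borcherds-Kac-Moody Lie algebra -/

/-- The factor is `g` after a section of `f` on its range, extended by a projection. All its values
are values of `g`, so the extended cobracket still takes values in the exterior square outside the
range. -/
theorem LinearMap.exists_factor_of_ker_le {K V W U : Type*} [Field K] [AddCommGroup V] [Module K V]
    [AddCommGroup W] [Module K W] [AddCommGroup U] [Module K U] (f : V →ₗ[K] W) (g : V →ₗ[K] U)
    (h : ∀ x, f x = 0 → g x = 0) :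
    ∃ k : W →ₗ[K] U, (∀ x, k (f x) = g x) ∧ ∀ y, ∃ x, k y = g x := by
  obtain ⟨s, hs⟩ := f.rangeRestrict.exists_rightInverse_of_surjective
    (LinearMap.range_eq_top.2 f.surjective_rangeRestrict)
  refine ⟨g ∘ₗ s ∘ₗ (LinearMap.range f).someProjection, fun x => ?_, fun y => ⟨_, rfl⟩⟩
  have h1 : (LinearMap.range f).someProjection (f x) = f.rangeRestrict x :=
    Submodule.someProjection_coe _ (f.rangeRestrict x)
  have h2 : f (s (f.rangeRestrict x)) = f x := congrArg Subtype.val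
    (LinearMap.congr_fun hs (f.rangeRestrict x))
  have h3 := h (s (f.rangeRestrict x) - x) (by rw [map_sub, h2, sub_self])
  rw [map_sub, sub_eq_zero] at h3
  simp only [LinearMap.comp_apply, h1, h3]

namespace BKM

variable {I : Type*} (A : Matrix I I ℝ)

/-- The quotient map onto the universal Borcherds-Kac-Moody Lie algebra. -/
noncomputable def mkHom : Free I →ₗ⁅ℂ⁆ Universal A :=
  { (LieSubmodule.Quotient.mk' (relatorIdeal A) : Free I →ₗ[ℂ] Universal A) with
    map_lie' := fun {x y} => LieSubmodule.Quotient.mk_bracket (relatorIdeal A) x y }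

theorem mkHom_surjective : Function.Surjective (mkHom A) :=
  LieSubmodule.Quotient.surjective_mk' (relatorIdeal A)

theorem mkHom_eq_zero_iff {z : Free I} : mkHom A z = 0 ↔ z ∈ relatorIdeal A :=
  LieSubmodule.Quotient.mk_eq_zero (relatorIdeal A)

variable {A}

theorem mkHom_relator {z : Free I} (hz : IsRelator A z) : mkHom A z = 0 :=
  (mkHom_eq_zero_iff A).2 (LieSubmodule.subset_lieSpan hz)

theorem chevalleyRelations_universal : ChevalleyRelations A (fun i => gen A (.h i))
    (fun i => gen A (.e i)) (fun i => gen A (.f i)) where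
  he i k := by
    have h := mkHom_relator (IsRelator.he (A := A) i k)
    rwa [map_sub, map_smul, LieHom.map_lie, sub_eq_zero] at h
  hf i k := by
    have h := mkHom_relator (IsRelator.hf (A := A) i k)
    rwa [map_add, map_smul, LieHom.map_lie, add_eq_zero_iff_eq_neg] at h
  ef_same i := by
    have h := mkHom_relator (IsRelator.ef_same (A := A) i)
    rwa [map_sub, LieHom.map_lie, sub_eq_zero] at h
  ef_ne i j hij := by
    have h := mkHom_relator (IsRelator.ef_ne (A := A) i j hij)
    rwa [LieHom.map_lie] at h

end BKM

namespace BorcherdsKacMoody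

open BKM

variable {I : Type*} {A : Matrix I I ℝ} {𝔤 : Type*} [LieRing 𝔤] [LieAlgebra ℂ 𝔤]

/-- The Chevalley generators of a Borcherds-Kac-Moody Lie algebra. -/
noncomputable abbrev chev (B : BorcherdsKacMoody A 𝔤) (g : BKMGenerator I) : 𝔤 := B.φ (gen A g)

theorem chevalleyRelations (B : BorcherdsKacMoody A 𝔤) :
    ChevalleyRelations A (fun i => B.chev (.h i)) (fun i => B.chev (.e i))
      (fun i => B.chev (.f i)) :=
  chevalleyRelations_universal.map B.φ

theorem chev_h_mem_cartan (B : BorcherdsKacMoody A 𝔤) (i : I) : B.chev (.h i) ∈ B.cartan := by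
  rw [B.cartan_eq]
  exact Submodule.mem_sup_left (Submodule.subset_span ⟨i, rfl⟩)

theorem lie_chev_h (B : BorcherdsKacMoody A 𝔤) (t : B.cartan) (i : I) :
    ⁅(t : 𝔤), B.chev (.h i)⁆ = 0 := by
  rw [← B.chevalleyRelations.ef_same i, leibniz_lie, B.lie_e, B.lie_f, smul_lie, lie_neg,
    lie_smul, add_neg_cancel]

theorem cartan_abelian (B : BorcherdsKacMoody A 𝔤) (t : B.cartan) {x : 𝔤} (hx : x ∈ B.cartan) :
    ⁅(t : 𝔤), x⁆ = 0 := by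
  have hD : ∀ d ∈ B.D, d ∈ B.cartan := fun d hd => by
    rw [B.cartan_eq]; exact Submodule.mem_sup_right hd
  have key : ∀ (q : Submodule ℂ 𝔤) (z : 𝔤), (∀ i, ⁅z, B.chev (.h i)⁆ ∈ q) → (∀ d ∈ B.D, ⁅z, d⁆ ∈ q) →
      ∀ x ∈ B.cartan, ⁅z, x⁆ ∈ q := by
    intro q z h1 h2 x hx
    rw [B.cartan_eq] at hx
    obtain ⟨u, hu, v, hv, rfl⟩ := Submodule.mem_sup.1 hx
    rw [lie_add]
    refine add_mem (lie_mem_of_span z ?_ hu) (h2 v hv)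
    rintro _ ⟨i, rfl⟩
    exact h1 i
  refine (Submodule.mem_bot ℂ).1 (key ⊥ t (fun i => ?_) (fun d hd => ?_) x hx)
  · rw [B.lie_chev_h]; exact zero_mem _
  · rw [← lie_skew]
    refine neg_mem (key ⊥ d (fun i => ?_) (fun d' hd' => ?_) t t.2)
    · rw [B.lie_chev_h ⟨d, hD d hd⟩]; exact zero_mem _
    · have h1 := B.abelian_D.trivial ⟨d, hd⟩ ⟨d', hd'⟩
      have h2 : ⁅d, d'⁆ = 0 := congrArg Subtype.val h1
      rw [h2]
      exact zero_mem _

theorem mem_triangular (B : BorcherdsKacMoody A 𝔤) (b : I → ℤ) {x : 𝔤} (hx : x ∈ B.φ.range) :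
    x ∈ ChevalleyRelations.triangular (fun i => B.chev (.h i)) (fun i => B.chev (.e i))
      (fun i => B.chev (.f i)) b := by
  obtain ⟨y, rfl⟩ := hx
  obtain ⟨z, rfl⟩ := mkHom_surjective A y
  exact B.chevalleyRelations.mem_triangular b (B.φ.comp (mkHom A)) (fun i => rfl) (fun i => rfl)
    (fun i => rfl) z

/-- The standard cobracket of a Borcherds-Kac-Moody Lie algebra with a grading element. -/
theorem exists_cobracket (B : BorcherdsKacMoody A 𝔤) {q : I → ℂ}
    (hq : ∀ i j, q i * A i j = q j * A j i)
    (hε : ∃ ε ∈ Submodule.span ℂ (Set.range fun i => gen A (.h i)),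
      (∀ i, ⁅ε, gen A (.e i)⁆ = gen A (.e i)) ∧ ∀ i, ⁅ε, gen A (.f i)⁆ = -gen A (.f i)) :
    ∃ δ : 𝔤 →ₗ[ℂ] ExteriorAlgebra ℂ 𝔤,
      (∀ x, δ x ∈ LinearMap.range (ExteriorAlgebra.ι ℂ (M := 𝔤)) *
        LinearMap.range (ExteriorAlgebra.ι ℂ (M := 𝔤))) ∧
      (∀ x ∈ B.φ.range, ∀ y ∈ B.φ.range, δ ⁅x, y⁆ =
        ExteriorAlgebra.adjoint x (δ y) - ExteriorAlgebra.adjoint y (δ x)) ∧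
      ∀ i, δ (B.chev (.e i)) = q i •
        (ExteriorAlgebra.ι ℂ (B.chev (.h i)) * ExteriorAlgebra.ι ℂ (B.chev (.e i))) := by
  set p := B.φ.comp (mkHom A) with hp
  obtain ⟨δ, hδg, hδ⟩ := exists_cocycle p fun g => match g with
    | .h _ => 0
    | .e i => q i • (ExteriorAlgebra.ι ℂ (B.chev (.h i)) * ExteriorAlgebra.ι ℂ (B.chev (.e i)))
    | .f i => q i • (ExteriorAlgebra.ι ℂ (B.chev (.h i)) * ExteriorAlgebra.ι ℂ (B.chev (.f i)))
  have hsq : ∀ z, δ z ∈ LinearMap.range (ExteriorAlgebra.ι ℂ (M := 𝔤)) *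
      LinearMap.range (ExteriorAlgebra.ι ℂ (M := 𝔤)) := by
    let S : LieSubalgebra ℂ (Free I) :=
      { (LinearMap.range (ExteriorAlgebra.ι ℂ (M := 𝔤)) *
          LinearMap.range (ExteriorAlgebra.ι ℂ (M := 𝔤))).comap δ with
        lie_mem' := fun {z w} hz hw => by
          change δ ⁅z, w⁆ ∈ LinearMap.range (ExteriorAlgebra.ι ℂ (M := 𝔤)) *
            LinearMap.range (ExteriorAlgebra.ι ℂ (M := 𝔤))
          rw [hδ]
          exact sub_mem (ExteriorAlgebra.derivation_mem_sq _ hw)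
            (ExteriorAlgebra.derivation_mem_sq _ hz) }
    refine fun z => FreeLieAlgebra.subalgebra_eq_top S (fun g => ?_) z
    change δ (FreeLieAlgebra.of ℂ g) ∈ LinearMap.range (ExteriorAlgebra.ι ℂ (M := 𝔤)) *
            LinearMap.range (ExteriorAlgebra.ι ℂ (M := 𝔤))
    rw [hδg]
    cases g with
    | h i => exact zero_mem _
    | e i => exact Submodule.smul_mem _ _ (Submodule.mul_mem_mul ⟨_, rfl⟩ ⟨_, rfl⟩)
    | f i => exact Submodule.smul_mem _ _ (Submodule.mul_mem_mul ⟨_, rfl⟩ ⟨_, rfl⟩)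
  have hideal : ∀ z ∈ relatorIdeal A, δ z = 0 := by
    have hpz : ∀ z, IsRelator A z → p z = 0 := fun z hz => by
      rw [hp, LieHom.comp_apply, mkHom_relator hz, map_zero]
    intro z hz
    refine cocycle_relatorIdeal hδ hpz (fun z hz => ?_) hz
    exact cocycle_relator (q := q) B.chevalleyRelations hδ hq B.cartanMatrix.diag_eq_two
      (fun i => hδg _) (fun i => hδg _) (fun i => hδg _) hz (hpz z hz)
  -- The kernel of `φ` is central, so modulo relators `z` commutes with the grading element and is a
  -- combination of the `h i`, on which the cocycle is zero.
  have hker : ∀ z, p z = 0 → δ z = 0 := by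
    intro z hz
    obtain ⟨ε, hεh, hεe, hεf⟩ := hε
    have h1 : mkHom A z ∈ LieAlgebra.center ℂ (Universal A) :=
      B.ker_le_center (LieHom.mem_ker.2 hz)
    have h2 : mkHom A z ∈ Submodule.span ℂ (Set.range fun i => gen A (.h i)) :=
      chevalleyRelations_universal.mem_span_of_lie_eq_zero (b := fun _ => 0) hεh hεe hεf
        (chevalleyRelations_universal.mem_triangular _ (mkHom A) (fun i => rfl) (fun i => rfl)
          (fun i => rfl) z) (h1 ε)
    have h3 : Submodule.span ℂ (Set.range fun i => gen A (.h i)) =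
        (Submodule.span ℂ (Set.range fun i => (freeH i : Free I))).map
          (mkHom A : Free I →ₗ[ℂ] Universal A) := by
      rw [Submodule.map_span, ← Set.range_comp]
      rfl
    rw [h3] at h2
    obtain ⟨w, hw, hwz⟩ := h2
    have h4 : δ w = 0 := by
      have : Submodule.span ℂ (Set.range fun i => (freeH i : Free I)) ≤ LinearMap.ker δ := by
        refine Submodule.span_le.2 ?_
        rintro _ ⟨i, rfl⟩
        exact hδg (.h i)
      exact this hw
    have h5 := hideal (w - z) ((mkHom_eq_zero_iff A).1 (by
      rw [map_sub, sub_eq_zero]; exact hwz))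
    rwa [map_sub, h4, zero_sub, neg_eq_zero] at h5
  obtain ⟨D, hD1, hD2⟩ := (p : Free I →ₗ[ℂ] 𝔤).exists_factor_of_ker_le δ hker
  refine ⟨D, fun x => ?_, ?_, fun i => ?_⟩
  · obtain ⟨z, hz⟩ := hD2 x
    rw [hz]
    exact hsq z
  · rintro _ ⟨x, rfl⟩ _ ⟨y, rfl⟩
    obtain ⟨x, rfl⟩ := mkHom_surjective A x
    obtain ⟨y, rfl⟩ := mkHom_surjective A y
    have h1 := hD1 ⁅x, y⁆
    have h2 := hδ x y
    rw [← hD1 x, ← hD1 y, ← h1] at h2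
    simp only [LieHom.coe_toLinearMap, LieHom.map_lie] at h2
    exact h2
  · exact (hD1 (freeE i)).trans (hδg (.e i))

end BorcherdsKacMoody

/-! ### Bidegrees, root spaces and the grading element of a Fricke Lie algebra -/

namespace FrickeLieAlgebra

open BKM

variable {I : Type*} {A : Matrix I I ℝ} {𝔤 : Type*} [LieRing 𝔤] [LieAlgebra ℂ 𝔤]

/-- Coordinates on the Cartan subalgebra that are dual to the weights of bidegrees `(1, 0)` and
`(0, 1)`, together with the bidegrees `(1, b i)` of the simple roots. -/
structure Coordinates (F : FrickeLieAlgebra A 𝔤) where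
  ta : F.cartan
  tb : F.cartan
  b : I → ℤ
  weight_ta : ∀ m n : ℤ, F.weight m n ta = m
  weight_tb : ∀ m n : ℤ, F.weight m n tb = n
  α_eq : ∀ i, F.α i = F.weight 1 (b i)
  b_real : b F.i₀ = -1
  one_le_b : ∀ i, i ≠ F.i₀ → 1 ≤ b i
  finite_b : ∀ M : ℤ, {i | b i ≤ M}.Finite
  coroot_eq : ∀ i, (F.Q i : ℂ) • F.coroot i = -((F.Q F.i₀ : ℂ) • (tb + (b i : ℂ) • ta))

/-- The weights `-ρ` and `-ρ - α i₀` are isotropic with product `-Q i₀`, hence form a hyperbolic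
basis. In these coordinates the Weyl condition and the pairing with `α i₀` determine each simple
root as `(1, 1 - A i₀ i)`. -/
theorem nonempty_coordinates (F : FrickeLieAlgebra A 𝔤) : Nonempty F.Coordinates := by
  have hfd : FiniteDimensional ℂ F.cartan :=
    Module.finite_of_finrank_pos (by rw [F.rank_eq_two]; norm_num)
  set w₁ : Module.Dual ℂ F.cartan := -F.ρ with hw₁
  set w₂ : Module.Dual ℂ F.cartan := -F.ρ - F.α F.i₀ with hw₂
  set q : ℂ := (F.Q F.i₀ : ℂ) with hq
  have hq0 : q ≠ 0 := by
    rw [hq]; exact_mod_cast (F.Q_pos F.i₀).ne'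
  have hA0 : A F.i₀ F.i₀ = 2 := F.cartanMatrix.diag_eq_two _ ((F.real_iff _).2 rfl)
  have hsymm : ∀ x y, F.form x y = F.form y x := fun x y => by
    simpa using F.form_symm.eq x y
  have hα0 : F.α F.i₀ = w₁ - w₂ := by rw [hw₁, hw₂]; abel
  have h00 : F.form (F.α F.i₀) (F.α F.i₀) = 2 * q := by
    rw [F.form_α, F.α_coroot, hA0, hq]; push_cast; ring
  have h0ρ : F.form (F.α F.i₀) F.ρ = -q := by rw [F.weyl, h00]; ring
  have h11 : F.form w₁ w₁ = 0 := by rw [hw₁]; simp [F.weyl_norm]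
  have h12 : F.form w₁ w₂ = -q := by
    rw [hw₁, hw₂]
    simp [F.weyl_norm, hsymm F.ρ, h0ρ]
  have h21 : F.form w₂ w₁ = -q := by rw [hsymm, h12]
  have h22 : F.form w₂ w₂ = 0 := by
    rw [hw₂]
    simp [F.weyl_norm, hsymm F.ρ, h0ρ, h00]
    ring
  have hind : LinearIndependent ℂ ![w₁, w₂] := by
    rw [LinearIndependent.pair_iff]
    intro s t hst
    have h1 := congrArg (F.form w₁) hst
    have h2 := congrArg (F.form w₂) hst
    simp only [map_add, map_smul, h11, h12, h21, h22, smul_eq_mul, map_zero, mul_zero, zero_add,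
      add_zero, mul_eq_zero, neg_eq_zero, hq0, or_false] at h1 h2
    exact ⟨h2, h1⟩
  let bw := basisOfLinearIndependentOfCardEqFinrank hind
    (by rw [Subspace.dual_finrank_eq, F.rank_eq_two, Fintype.card_fin])
  have hbw : ⇑bw = ![w₁, w₂] := coe_basisOfLinearIndependentOfCardEqFinrank _ _
  have hb0 : bw 0 = w₁ := by rw [hbw]; rfl
  have hb1 : bw 1 = w₂ := by rw [hbw]; rfl
  let ta := (Module.evalEquiv ℂ F.cartan).symm (bw.coord 0)
  let tb := (Module.evalEquiv ℂ F.cartan).symm (bw.coord 1)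
  have hta : ∀ l, l ta = bw.coord 0 l := fun l => Module.apply_evalEquiv_symm_apply _ _ l _
  have htb : ∀ l, l tb = bw.coord 1 l := fun l => Module.apply_evalEquiv_symm_apply _ _ l _
  have hl : ∀ l : Module.Dual ℂ F.cartan, l = l ta • w₁ + l tb • w₂ := by
    intro l
    conv_lhs => rw [← bw.sum_repr l]
    rw [Fin.sum_univ_two, hb0, hb1, hta, htb]
    rfl
  have h1a : w₁ ta = 1 := by rw [hta, ← hb0]; simp
  have h2a : w₂ ta = 0 := by rw [hta, ← hb1]; simp
  have h1b : w₁ tb = 0 := by rw [htb, ← hb0]; simp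
  have h2b : w₂ tb = 1 := by rw [htb, ← hb1]; simp
  have hform : ∀ l m : Module.Dual ℂ F.cartan,
      F.form l m = -(q * (l ta * m tb + l tb * m ta)) := by
    intro l m
    conv_lhs => rw [hl l, hl m]
    simp only [map_add, map_smul, LinearMap.add_apply, LinearMap.smul_apply, h11, h12, h21, h22,
      smul_eq_mul]
    ring
  have hext : ∀ s t : F.cartan, (∀ l : Module.Dual ℂ F.cartan, l s = l t) → s = t := by
    intro s t h
    rw [← sub_eq_zero, ← Module.forall_dual_apply_eq_zero_iff ℂ]
    intro l
    rw [map_sub, h l, sub_self]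
  have hρ : ∀ l, F.form l F.ρ = q * l tb := by
    intro l
    have h1 : F.ρ ta = -1 := by rw [← h1a, hw₁, LinearMap.neg_apply, neg_neg]
    have h2 : F.ρ tb = 0 := by rw [← neg_eq_zero, ← LinearMap.neg_apply, ← hw₁, h1b]
    rw [hform, h1, h2]
    ring
  -- The Weyl condition becomes `α(tb) * (α(ta) - 1) = 0`, and `α(tb) = 0` would make the simple
  -- root isotropic.
  have hαa : ∀ i, F.α i ta = 1 ∧ F.α i tb ≠ 0 := by
    intro i
    have h1 := F.weyl i
    rw [hρ, hform] at h1
    have h2 : F.α i tb ≠ 0 := by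
      intro h0
      have h3 := F.form_α i (F.α i)
      rw [hform, h0, F.α_coroot] at h3
      have h4 : ((F.Q i * A i i : ℝ) : ℂ) = 0 := by push_cast; rw [← h3]; ring
      rw [Complex.ofReal_eq_zero] at h4
      exact (mul_ne_zero (F.Q_pos i).ne' (F.norm_ne_zero i)) h4
    refine ⟨?_, h2⟩
    have h3 : q * F.α i tb * (F.α i ta - 1) = 0 := by linear_combination -h1
    rcases mul_eq_zero.1 h3 with h4 | h4
    · exact absurd h4 (mul_ne_zero hq0 h2)
    · exact sub_eq_zero.1 h4
  choose z hz using F.cartanMatrix.integral F.i₀ ((F.real_iff _).2 rfl)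
  have hαb : ∀ i, F.α i tb = ((1 - z i : ℤ) : ℂ) := by
    intro i
    have h1 := F.form_α F.i₀ (F.α i)
    have h3 : F.α F.i₀ ta = 1 := (hαa F.i₀).1
    have h4 : F.α F.i₀ tb = -1 := by
      have := LinearMap.congr_fun hα0 tb
      rw [this, LinearMap.sub_apply, h1b, h2b, zero_sub]
    rw [hform, h3, h4, F.α_coroot, hz, (hαa i).1] at h1
    push_cast
    have h2 : q * (F.α i tb - (1 - z i)) = 0 := by
      push_cast at h1
      linear_combination -h1
    exact sub_eq_zero.1 ((mul_eq_zero.1 h2).resolve_left hq0)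
  -- The norm of a simple root is `-2 * Q i₀ * b i`, so a bound on the norms is a bound on the `b
  -- i`.
  have hnorm : ∀ i, F.Q i * A i i = -(2 * F.Q F.i₀ * (1 - z i : ℤ)) := by
    intro i
    have h1 := F.form_α i (F.α i)
    rw [hform, F.α_coroot, (hαa i).1, hαb] at h1
    have h2 : ((F.Q i * A i i : ℝ) : ℂ) = ((-(2 * F.Q F.i₀ * (1 - z i : ℤ)) : ℝ) : ℂ) := by
      push_cast
      push_cast at h1
      rw [← h1]
      ring
    exact_mod_cast h2
  refine ⟨{ ta := ta
            tb := tb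
            b := fun i => 1 - z i
            weight_ta := fun m n => ?_
            weight_tb := fun m n => ?_
            α_eq := fun i => ?_
            b_real := ?_
            one_le_b := fun i hi => ?_
            finite_b := fun M => ?_
            coroot_eq := fun i => ?_ }⟩
  · change (m : ℂ) * w₁ ta + (n : ℂ) * w₂ ta = m
    rw [h1a, h2a]; ring
  · change (m : ℂ) * w₁ tb + (n : ℂ) * w₂ tb = n
    rw [h1b, h2b]; ring
  · change F.α i = ((1 : ℤ) : ℂ) • w₁ + ((1 - z i : ℤ) : ℂ) • w₂
    conv_lhs => rw [hl (F.α i)]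
    rw [(hαa i).1, hαb]
    simp
  · have h1 : (z F.i₀ : ℝ) = 2 := by rw [← hz, hA0]
    have h2 : z F.i₀ = 2 := by exact_mod_cast h1
    rw [h2]; norm_num
  · have h1 := F.cartanMatrix.off_diag_nonpos F.i₀ i hi.symm
    rw [hz] at h1
    have h2 : z i ≤ 0 := by exact_mod_cast h1
    omega
  · refine (F.finite_norm_gt (2 * F.Q F.i₀ * M + 1)).subset fun i hi => ?_
    have h1 : ((1 - z i : ℤ) : ℝ) ≤ M := by exact_mod_cast hi
    have h2 := mul_le_mul_of_nonneg_left h1 (mul_nonneg zero_le_two (F.Q_pos F.i₀).le)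
    change -(2 * F.Q F.i₀ * M + 1) < F.Q i * A i i
    rw [hnorm]
    linarith
  · refine hext _ _ fun l => ?_
    have h1 := F.form_α i l
    rw [hform, (hαa i).1, hαb] at h1
    rw [map_smul, smul_eq_mul, ← h1, map_neg, map_smul, map_add, map_smul, smul_eq_mul,
      smul_eq_mul]
    ring

variable {F : FrickeLieAlgebra A 𝔤} (c : F.Coordinates)

theorem mem_piece_iff {m n : ℤ} {x : 𝔤} :
    x ∈ F.piece m n ↔ ∀ t : F.cartan, ⁅(t : 𝔤), x⁆ = F.weight m n t • x := by
  simp only [piece, Submodule.mem_iInf, Module.End.mem_eigenspace_iff, LieAlgebra.ad_apply]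

theorem weight_add (m n m' n' : ℤ) :
    F.weight (m + m') (n + n') = F.weight m n + F.weight m' n' := by
  simp only [weight]
  push_cast
  module

theorem lie_mem_piece {w v : ℤ × ℤ} {x y : 𝔤} (hx : x ∈ F.piece w.1 w.2)
    (hy : y ∈ F.piece v.1 v.2) : ⁅x, y⁆ ∈ F.piece (w + v).1 (w + v).2 := by
  rw [mem_piece_iff] at hx hy ⊢
  intro t
  rw [leibniz_lie, hx, hy, Prod.fst_add, Prod.snd_add, weight_add, LinearMap.add_apply, add_smul,
    smul_lie, lie_smul]

namespace Coordinates

theorem neg_one_le_b (i : I) : -1 ≤ c.b i := by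
  by_cases hi : i = F.i₀
  · rw [hi, c.b_real]
  · have := c.one_le_b i hi
    omega

theorem e_mem_piece (i : I) : F.chev (.e i) ∈ F.piece 1 (c.b i) := by
  rw [mem_piece_iff]
  intro t
  rw [F.lie_e, c.α_eq]

theorem f_mem_piece (i : I) : F.chev (.f i) ∈ F.piece (-1) (-c.b i) := by
  rw [mem_piece_iff]
  intro t
  rw [F.lie_f, c.α_eq, ← neg_smul, ← LinearMap.neg_apply]
  congr 2
  simp only [weight]
  push_cast
  module

theorem piece_of_isBracket_e {w : ℤ × ℤ} {x : 𝔤}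
    (hx : IsBracket (fun i => F.chev (.e i)) c.b w x) : x ∈ F.piece w.1 w.2 := by
  induction hx with
  | base i => exact c.e_mem_piece i
  | step i _ ih => exact lie_mem_piece (w := (1, c.b i)) (c.e_mem_piece i) ih

theorem piece_of_isBracket_f {w : ℤ × ℤ} {x : 𝔤}
    (hx : IsBracket (fun i => F.chev (.f i)) c.b w x) : x ∈ F.piece (-w).1 (-w).2 := by
  induction hx with
  | base i => exact c.f_mem_piece i
  | step i _ ih =>
    rw [neg_add]
    exact lie_mem_piece (w := -(1, c.b i)) (c.f_mem_piece i) ih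

theorem cartan_le_piece : F.cartan ≤ F.piece 0 0 := by
  intro x hx
  rw [mem_piece_iff]
  intro t
  rw [F.cartan_abelian t hx]
  simp [weight]

/-- The single element `ta + i tb` has eigenvalue `a + i b` on the piece `(a, b)`, and these are
distinct Gaussian integers. -/
theorem iSupIndep_piece (c : F.Coordinates) : iSupIndep fun w : ℤ × ℤ => F.piece w.1 w.2 := by
  let t : F.cartan := c.ta + Complex.I • c.tb
  let T : Module.End ℂ 𝔤 := LieAlgebra.ad ℂ 𝔤 (t : 𝔤)
  have hinj : Function.Injective fun w : ℤ × ℤ => (w.1 : ℂ) + Complex.I * w.2 := by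
    rintro ⟨a, b⟩ ⟨a', b'⟩ h
    have h1 := congrArg Complex.re h
    have h2 := congrArg Complex.im h
    simp at h1 h2
    exact Prod.ext h1 h2
  refine (T.eigenspaces_iSupIndep.comp hinj).mono fun w x hx => ?_
  rw [mem_piece_iff] at hx
  rw [Function.comp_apply, Module.End.mem_eigenspace_iff]
  change ⁅(t : 𝔤), x⁆ = _
  rw [hx, map_add, map_smul, c.weight_ta, c.weight_tb, smul_eq_mul]

/-- The subspaces on the right lie in the pieces and together span the Lie algebra, while the pieces
are independent; so each inclusion is an equality. -/
theorem piece_eq (w : ℤ × ℤ) : F.piece w.1 w.2 =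
    Submodule.span ℂ {x | IsBracket (fun i => F.chev (.e i)) c.b w x} ⊔
    Submodule.span ℂ {x | IsBracket (fun i => F.chev (.f i)) c.b (-w) x} ⊔
    (if w = 0 then F.cartan else ⊥) := by
  set S : ℤ × ℤ → Submodule ℂ 𝔤 := fun w =>
    Submodule.span ℂ {x | IsBracket (fun i => F.chev (.e i)) c.b w x} ⊔
    Submodule.span ℂ {x | IsBracket (fun i => F.chev (.f i)) c.b (-w) x} ⊔
    (if w = 0 then F.cartan else ⊥) with hS
  have hle : S ≤ fun w : ℤ × ℤ => F.piece w.1 w.2 := by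
    intro w
    refine sup_le (sup_le ?_ ?_) ?_
    · exact Submodule.span_le.2 fun x hx => c.piece_of_isBracket_e hx
    · refine Submodule.span_le.2 fun x hx => ?_
      have := c.piece_of_isBracket_f hx
      rwa [neg_neg] at this
    · split_ifs with h0
      · rw [h0]; exact cartan_le_piece
      · exact bot_le
  have hcartan : F.cartan ≤ ⨆ w, S w := by
    refine le_trans ?_ (le_iSup S 0)
    simp only [hS, if_true]
    exact le_sup_right
  have htop : ⨆ w, S w = ⊤ := by
    rw [eq_top_iff, ← F.isCompl.sup_eq_top]
    refine sup_le (fun x hx => ?_) (le_trans ?_ hcartan)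
    · have h1 : ChevalleyRelations.triangular (fun i => F.chev (.h i)) (fun i => F.chev (.e i))
          (fun i => F.chev (.f i)) c.b ≤ ⨆ w, S w := by
        refine sup_le (sup_le ?_ (le_trans ?_ hcartan)) ?_
        · refine Submodule.span_le.2 ?_
          rintro x ⟨l, hx⟩
          exact Submodule.mem_iSup_of_mem l (Submodule.mem_sup_left (Submodule.mem_sup_left
            (Submodule.subset_span hx)))
        · refine Submodule.span_le.2 ?_
          rintro _ ⟨i, rfl⟩
          exact F.chev_h_mem_cartan i
        · refine Submodule.span_le.2 ?_
          rintro x ⟨l, hx⟩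
          refine Submodule.mem_iSup_of_mem (-l) (Submodule.mem_sup_left (Submodule.mem_sup_right
            (Submodule.subset_span ?_)))
          rwa [Set.mem_ofPred_eq, neg_neg]
      exact h1 (F.mem_triangular c.b hx)
    · rw [F.toBorcherdsKacMoody.cartan_eq]
      exact le_sup_right
  have := (c.iSupIndep_piece.le_iff_eq_of_iSup_eq_top htop).1 hle
  exact (congrFun this w).symm

theorem finiteDimensional_piece (c : F.Coordinates) (m n : ℤ) : FiniteDimensional ℂ (F.piece m n) := by
  rw [← Submodule.fg_iff_finiteDimensional, c.piece_eq (m, n)]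
  refine Submodule.FG.sup (Submodule.FG.sup ?_ ?_) ?_
  · exact Submodule.fg_span (finite_isBracket _ c.neg_one_le_b c.finite_b _)
  · exact Submodule.fg_span (finite_isBracket _ c.neg_one_le_b c.finite_b _)
  · split_ifs
    · rw [Submodule.fg_iff_finiteDimensional]
      exact Module.finite_of_finrank_pos (by rw [F.rank_eq_two]; norm_num)
    · exact Submodule.fg_bot

theorem piece_eq_span {w : ℤ × ℤ} (hw : 1 ≤ w.1) : F.piece w.1 w.2 =
    Submodule.span ℂ {x | IsBracket (fun i => F.chev (.e i)) c.b w x} := by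
  have h1 : {x | IsBracket (fun i => F.chev (.f i)) c.b (-w) x} = ∅ := by
    ext x
    simp only [Set.mem_ofPred_eq, Set.mem_empty_iff_false, iff_false]
    intro hx
    have := hx.one_le
    rw [Prod.fst_neg] at this
    omega
  have h2 : w ≠ 0 := by
    rintro rfl
    simp at hw
  rw [c.piece_eq, h1, if_neg h2, Submodule.span_empty, sup_bot_eq, sup_bot_eq]

/-- A combination of the coroots that takes the value `1` at all simple roots. -/
theorem exists_grading_element (c : F.Coordinates) :
    ∃ ε ∈ Submodule.span ℂ (Set.range fun i => gen A (.h i)),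
      (∀ i, ⁅ε, gen A (.e i)⁆ = gen A (.e i)) ∧ ∀ i, ⁅ε, gen A (.f i)⁆ = -gen A (.f i) := by
  have R := chevalleyRelations_universal (A := A)
  have hα : ∀ i k, (F.Q i : ℂ) * A i k = -(F.Q F.i₀ * (c.b k + c.b i)) := by
    intro i k
    have h1 := congrArg (F.α k) (c.coroot_eq i)
    rw [map_smul, F.α_coroot, smul_eq_mul] at h1
    rw [h1, c.α_eq, map_neg, map_smul, map_add, map_smul, c.weight_ta, c.weight_tb, smul_eq_mul,
      smul_eq_mul]
    push_cast
    ring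
  have hq0 : (F.Q F.i₀ : ℂ) ≠ 0 := by exact_mod_cast (F.Q_pos F.i₀).ne'
  have key : ∀ (i : I) (s t : ℂ), (∀ k, s * A F.i₀ k + t * A i k = 1) →
      ∃ ε ∈ Submodule.span ℂ (Set.range fun i => gen A (.h i)),
      (∀ i, ⁅ε, gen A (.e i)⁆ = gen A (.e i)) ∧ ∀ i, ⁅ε, gen A (.f i)⁆ = -gen A (.f i) := by
    intro i s t h
    refine ⟨s • gen A (.h F.i₀) + t • gen A (.h i), add_mem
      (Submodule.smul_mem _ _ (Submodule.subset_span ⟨_, rfl⟩))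
      (Submodule.smul_mem _ _ (Submodule.subset_span ⟨_, rfl⟩)), fun k => ?_, fun k => ?_⟩
    · rw [add_lie, smul_lie, smul_lie, R.he, R.he, smul_smul, smul_smul, ← add_smul, h, one_smul]
    · rw [add_lie, smul_lie, smul_lie, R.hf, R.hf, smul_neg, smul_neg, ← neg_add, smul_smul,
        smul_smul, ← add_smul, h, one_smul]
  -- The element is sought in `𝔤(A)`, where only coroots are available. With another simple root
  -- `i`, the coroots of `i₀` and `i` take the values `1 - b k` and `-(Q i₀ / Q i) * (b k + b i)` at
  -- `α k`, and eliminating `b k` gives the coefficients. Otherwise half the real coroot works.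
  by_cases hI : ∃ i, i ≠ F.i₀
  · obtain ⟨i, hi⟩ := hI
    have hb : (1 + c.b i : ℂ) ≠ 0 := by
      have := c.one_le_b i hi
      have h2 : (1 + c.b i : ℤ) ≠ 0 := by omega
      exact_mod_cast h2
    refine key i ((1 + c.b i)⁻¹) (-(F.Q i / (F.Q F.i₀ * (1 + c.b i)))) fun k => ?_
    have h1 := hα F.i₀ k
    have h2 := hα i k
    have h3 : (A F.i₀ k : ℂ) = 1 - c.b k := by
      rw [c.b_real] at h1
      push_cast at h1
      exact mul_left_cancel₀ hq0 (by linear_combination h1)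
    rw [h3]
    field_simp
    linear_combination -h2
  · push Not at hI
    refine key F.i₀ (1 / 2) 0 fun k => ?_
    have hA0 : A F.i₀ F.i₀ = 2 := F.cartanMatrix.diag_eq_two _ ((F.real_iff _).2 rfl)
    rw [hI k, hA0]
    norm_num

end Coordinates

end FrickeLieAlgebra

/-! ### The positive part and its twisted cobracket -/

namespace FrickeLieAlgebra

open BKM ExteriorAlgebra

variable {I : Type*} {A : Matrix I I ℝ} {𝔤 : Type*} [LieRing 𝔤] [LieAlgebra ℂ 𝔤]
  {F : FrickeLieAlgebra A 𝔤}

/-- The positive pieces. -/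
noncomputable def posPiece (F : FrickeLieAlgebra A 𝔤) (l : ℤ × ℤ) : Submodule ℂ 𝔤 :=
  if 1 ≤ l.1 then F.piece l.1 l.2 else ⊥

theorem posPiece_of_one_le {l : ℤ × ℤ} (hl : 1 ≤ l.1) : F.posPiece l = F.piece l.1 l.2 := if_pos hl

theorem posPiece_le (l : ℤ × ℤ) : F.posPiece l ≤ F.piece l.1 l.2 := by
  rw [posPiece]
  split_ifs
  exacts [le_rfl, bot_le]

theorem lie_mem_posPiece (l m : ℤ × ℤ) (x : 𝔤) (hx : x ∈ F.posPiece l) (y : 𝔤)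
    (hy : y ∈ F.posPiece m) : ⁅x, y⁆ ∈ F.posPiece (l + m) := by
  by_cases hl : 1 ≤ l.1
  · by_cases hm : 1 ≤ m.1
    · rw [posPiece_of_one_le (by rw [Prod.fst_add]; omega)]
      exact lie_mem_piece (posPiece_le _ hx) (posPiece_le _ hy)
    · rw [posPiece, if_neg hm] at hy
      rw [(Submodule.mem_bot ℂ).1 hy, lie_zero]
      exact zero_mem _
  · rw [posPiece, if_neg hl] at hx
    rw [(Submodule.mem_bot ℂ).1 hx, zero_lie]
    exact zero_mem _

theorem Q_mul_comm (F : FrickeLieAlgebra A 𝔤) (i j : I) :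
    (F.Q i : ℂ) * A i j = F.Q j * A j i := by
  rw [← F.α_coroot, ← F.α_coroot, ← F.form_α, ← F.form_α]
  simpa using F.form_symm.eq (F.α i) (F.α j)

namespace Coordinates

variable (c : F.Coordinates)

theorem posPiece_eq_span (l : ℤ × ℤ) : F.posPiece l =
    Submodule.span ℂ {x | IsBracket (fun i => F.chev (.e i)) c.b l x} := by
  rw [posPiece]
  split_ifs with hl
  · exact c.piece_eq_span hl
  · refine (Submodule.span_eq_bot.2 fun x hx => absurd ?_ hl).symm
    exact IsBracket.one_le hx

theorem coneSupported_posPiece (c : F.Coordinates) : ConeSupported F.posPiece := by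
  intro l x hx h0
  by_contra h
  refine h0 ?_
  rw [c.posPiece_eq_span] at hx
  have : {x | IsBracket (fun i => F.chev (.e i)) c.b l x} = ∅ :=
    Set.eq_empty_of_forall_notMem fun y hy =>
      h ⟨IsBracket.one_le hy, IsBracket.cone c.neg_one_le_b hy⟩
  rwa [this, Submodule.span_empty, Submodule.mem_bot] at hx

theorem finiteDimensional_posPiece (c : F.Coordinates) (l : ℤ × ℤ) :
    FiniteDimensional ℂ (F.posPiece l) := by
  have := c.finiteDimensional_piece l.1 l.2
  exact Submodule.finiteDimensional_of_le (posPiece_le l)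

theorem iSupIndep_posPiece (c : F.Coordinates) : iSupIndep F.posPiece :=
  c.iSupIndep_piece.mono posPiece_le

theorem mem_range_of_posPiece (c : F.Coordinates) {l : ℤ × ℤ} {x : 𝔤} (hx : x ∈ F.posPiece l) : x ∈ F.φ.range := by
  rw [c.posPiece_eq_span] at hx
  have : Submodule.span ℂ {x | IsBracket (fun i => F.chev (.e i)) c.b l x} ≤
      F.φ.range.toSubmodule := Submodule.span_le.2 fun x hx =>
    IsBracket.mem_lieSubalgebra hx F.φ.range fun i => ⟨_, rfl⟩
  exact this hx

theorem lie_ta {l : ℤ × ℤ} {x : 𝔤} (hx : x ∈ F.posPiece l) : ⁅(c.ta : 𝔤), x⁆ = (l.1 : ℂ) • x := by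
  rw [mem_piece_iff.1 (posPiece_le _ hx), c.weight_ta]

theorem lie_tb {l : ℤ × ℤ} {x : 𝔤} (hx : x ∈ F.posPiece l) : ⁅(c.tb : 𝔤), x⁆ = (l.2 : ℂ) • x := by
  rw [mem_piece_iff.1 (posPiece_le _ hx), c.weight_tb]

/-- The cobracket, twisted so as to vanish on the simple root vectors. -/
theorem exists_twisted_cobracket (c : F.Coordinates) :
    ∃ δ : 𝔤 →ₗ[ℂ] ExteriorAlgebra ℂ 𝔤,
      (∀ x, δ x ∈ LinearMap.range (ι ℂ (M := 𝔤)) * LinearMap.range (ι ℂ (M := 𝔤))) ∧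
      (∀ l m, ∀ x ∈ F.posPiece l, ∀ y ∈ F.posPiece m,
        δ ⁅x, y⁆ = adjoint x (δ y) - adjoint y (δ x) +
          ((2 * F.Q F.i₀ : ℂ) * ((l.1 : ℂ) * m.2 + l.2 * m.1)) • (ι ℂ x * ι ℂ y)) ∧
      ∀ i, δ (F.chev (.e i)) = 0 := by
  obtain ⟨δ, hδ, hcoc, he⟩ := F.exists_cobracket (q := fun i => (F.Q i : ℂ)) F.Q_mul_comm
    c.exists_grading_element
  generalize hq : (F.Q F.i₀ : ℂ) = q
  -- On weight `l` the correction is `q (l.1 tb + l.2 ta) ∧ x`. At a simple root it cancels `Q i h_i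
  -- ∧ e_i` by `coroot_eq`; the price is the bilinear twist in the cocycle condition.
  let D : 𝔤 →ₗ[ℂ] ExteriorAlgebra ℂ 𝔤 := δ + q • (
    LinearMap.mulLeft ℂ (ι ℂ (c.tb : 𝔤)) ∘ₗ ι ℂ ∘ₗ (LieAlgebra.ad ℂ 𝔤 (c.ta : 𝔤) : 𝔤 →ₗ[ℂ] 𝔤) +
    LinearMap.mulLeft ℂ (ι ℂ (c.ta : 𝔤)) ∘ₗ ι ℂ ∘ₗ (LieAlgebra.ad ℂ 𝔤 (c.tb : 𝔤) : 𝔤 →ₗ[ℂ] 𝔤))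
  have hD : ∀ x, D x = δ x + q • (ι ℂ (c.tb : 𝔤) * ι ℂ ⁅(c.ta : 𝔤), x⁆ +
      ι ℂ (c.ta : 𝔤) * ι ℂ ⁅(c.tb : 𝔤), x⁆) := fun x => rfl
  have hDl : ∀ l, ∀ x ∈ F.posPiece l, D x = δ x + q • ((l.1 : ℂ) • (ι ℂ (c.tb : 𝔤) * ι ℂ x) +
      (l.2 : ℂ) • (ι ℂ (c.ta : 𝔤) * ι ℂ x)) := fun l x hx => by
    rw [hD, c.lie_ta hx, c.lie_tb hx, map_smul, map_smul, mul_smul_comm, mul_smul_comm]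
  clear_value D
  refine ⟨D, fun x => ?_, fun l m x hx y hy => ?_, fun i => ?_⟩
  · rw [hD]
    exact add_mem (hδ x) (Submodule.smul_mem _ _ (add_mem
      (Submodule.mul_mem_mul ⟨_, rfl⟩ ⟨_, rfl⟩) (Submodule.mul_mem_mul ⟨_, rfl⟩ ⟨_, rfl⟩)))
  · have hxa : ⁅x, (c.ta : 𝔤)⁆ = -((l.1 : ℂ) • x) := by rw [← lie_skew, c.lie_ta hx]
    have hxb : ⁅x, (c.tb : 𝔤)⁆ = -((l.2 : ℂ) • x) := by rw [← lie_skew, c.lie_tb hx]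
    have hya : ⁅y, (c.ta : 𝔤)⁆ = -((m.1 : ℂ) • y) := by rw [← lie_skew, c.lie_ta hy]
    have hyb : ⁅y, (c.tb : 𝔤)⁆ = -((m.2 : ℂ) • y) := by rw [← lie_skew, c.lie_tb hy]
    have hyx : ⁅y, x⁆ = -⁅x, y⁆ := (lie_skew y x).symm
    have hs : ι ℂ y * ι ℂ x = -(ι ℂ x * ι ℂ y) :=
      eq_neg_of_add_eq_zero_left (ι_add_mul_swap (R := ℂ) y x)
    rw [hDl _ _ (lie_mem_posPiece l m x hx y hy), hDl _ _ hx, hDl _ _ hy,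
      hcoc x (c.mem_range_of_posPiece hx) y (c.mem_range_of_posPiece hy)]
    simp only [map_add, map_smul, adjoint_mul, adjoint_ι, hxa, hxb, hya, hyb, hyx, map_neg,
      neg_mul, mul_neg, smul_mul_assoc, hs, Prod.fst_add, Prod.snd_add, Int.cast_add]
    module
  · have hei : F.chev (.e i) ∈ F.posPiece (1, c.b i) := by
      rw [posPiece_of_one_le le_rfl]
      exact c.e_mem_piece i
    have h1 := congrArg (Subtype.val : F.cartan → 𝔤) (c.coroot_eq i)
    simp only [Submodule.coe_smul, Submodule.coe_neg, Submodule.coe_add, F.coroot_eq, hq] at h1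
    have h2 := congrArg (ι ℂ (M := 𝔤)) h1
    rw [map_smul, map_neg, map_smul, map_add, map_smul] at h2
    rw [hDl _ _ hei, he, ← smul_mul_assoc, h2, Int.cast_one, one_smul, neg_mul, smul_mul_assoc,
      add_mul, smul_mul_assoc, neg_add_cancel]

/-- Every hypothesis of `supertrace_map_eq_zero` is checked by induction on brackets of simple root
vectors, starting from `δ e_i = 0`. Killing the simple root vectors is what confines the cobracket
to the exterior square of the positive part. -/
theorem supertrace_eq_zero (c : F.Coordinates) {g : 𝔤 →ₗ[ℂ] 𝔤}
    (hg : ∀ l, ∀ x ∈ F.posPiece l, g x ∈ F.posPiece l) (hlie : ∀ x y, g ⁅x, y⁆ = ⁅g x, g y⁆)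
    {w : ℤ × ℤ} (hw1 : w.1 ≠ 1) (hw2 : w.2 ≠ 0) :
    supertrace F.posPiece w (map g).toLinearMap = 0 := by
  obtain ⟨δ, hδ, hcoc, he⟩ := c.exists_twisted_cobracket
  have hP := c.coneSupported_posPiece
  have hq : (2 * F.Q F.i₀ : ℂ) ≠ 0 := mul_ne_zero two_ne_zero (by exact_mod_cast (F.Q_pos F.i₀).ne')
  generalize (2 * F.Q F.i₀ : ℂ) = κ at hcoc hq
  have hei : ∀ i, F.chev (.e i) ∈ F.posPiece (1, c.b i) := fun i => by
    rw [posPiece_of_one_le le_rfl]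
    exact c.e_mem_piece i
  have hbr : ∀ l x, IsBracket (fun i => F.chev (.e i)) c.b l x → x ∈ F.posPiece l := fun l x hx => by
    rw [c.posPiece_eq_span]
    exact Submodule.subset_span hx
  refine supertrace_map_eq_zero hP c.finiteDimensional_posPiece lie_mem_posPiece hδ (κ := κ) ?_ hcoc
    ?_ hg hlie (mul_ne_zero hq (mul_ne_zero ?_ (by exact_mod_cast hw2)))
  · intro l x hx
    rw [c.posPiece_eq_span] at hx
    have : Submodule.span ℂ {x | IsBracket (fun i => F.chev (.e i)) c.b l x} ≤
        (graded F.posPiece 2 l).comap δ := by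
      refine Submodule.span_le.2 fun x hx => ?_
      change δ x ∈ graded F.posPiece 2 l
      rw [Set.mem_ofPred_eq] at hx
      clear * - hx he hcoc hei hbr
      induction hx with
      | base i => rw [he]; exact zero_mem _
      | @step m y i hy ih =>
        rw [hcoc _ _ _ (hei i) _ (hbr _ _ hy), he, map_zero, sub_zero]
        refine add_mem (adjoint_mem_graded lie_mem_posPiece (hei i) ih) (Submodule.smul_mem _ _ ?_)
        exact ι_mul_mem_graded (hei i) (ι_mem_graded (hbr _ _ hy))
    exact this hx
  · intro l x hx
    rw [c.posPiece_eq_span] at hx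
    have : Submodule.span ℂ {x | IsBracket (fun i => F.chev (.e i)) c.b l x} ≤
        LinearMap.ker (boundary ∘ₗ δ - (κ * (((l.1 : ℂ) - 1) * l.2)) • ι ℂ) := by
      refine Submodule.span_le.2 fun x hx => ?_
      rw [Set.mem_ofPred_eq] at hx
      rw [SetLike.mem_coe, LinearMap.mem_ker, LinearMap.sub_apply, sub_eq_zero,
        LinearMap.comp_apply, LinearMap.smul_apply]
      clear * - hx he hcoc hei hbr
      induction hx with
      -- A simple root has first coordinate `1`, so the scalar `κ * (1 - 1) * b i` is zero as well.
      | base i => rw [he, map_zero]; simp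
      | @step m y i hy ih =>
        rw [hcoc _ _ _ (hei i) _ (hbr _ _ hy), he, map_zero, sub_zero, map_add, map_smul,
          boundary_ι_mul_ι, boundary_adjoint, ih, map_smul, adjoint_ι, ← add_smul]
        congr 1
        simp only [Prod.fst_add, Prod.snd_add, Int.cast_add]
        push_cast
        ring
    have h := this hx
    rwa [LinearMap.mem_ker, LinearMap.sub_apply, sub_eq_zero] at h
  · rw [sub_ne_zero]
    exact_mod_cast hw1

end Coordinates

end FrickeLieAlgebra

/-! ### Generating series of traces and supertraces -/

namespace ExteriorAlgebra

variable {K V : Type*} [Field K] [AddCommGroup V] [Module K V] {P : ℤ × ℤ → Submodule K V}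

theorem ConeSupported.eq_bot (hP : ConeSupported P) {l : ℤ × ℤ} (hl : l.1 + l.2 < 0) : P l = ⊥ := by
  refine (Submodule.eq_bot_iff _).2 fun x hx => ?_
  by_contra h0
  have := hP l x hx h0
  omega

theorem ConeSupported.traceOn_eq_zero (hP : ConeSupported P) {l : ℤ × ℤ} (hl : l.1 + l.2 < 0)
    (g : V →ₗ[K] V) : LinearMap.traceOn (P l) g = 0 := by
  refine LinearMap.traceOn_eq_zero fun x hx => ?_
  rw [hP.eq_bot hl] at hx
  rw [(Submodule.mem_bot K).1 hx, map_zero]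

theorem ConeSupported.supertrace_eq_zero_of_neg (hP : ConeSupported P) {w : ℤ × ℤ}
    (hw : w.1 + w.2 < 0) (T : ExteriorAlgebra K V →ₗ[K] ExteriorAlgebra K V) :
    supertrace P w T = 0 := by
  rw [hP.supertrace_eq (M := w.1.toNat + 1) (by omega)]
  refine Finset.sum_eq_zero fun k _ => ?_
  rw [hP.graded_eq_bot (Or.inr hw), LinearMap.traceOn_eq_zero, mul_zero]
  intro x hx
  rw [(Submodule.mem_bot K).1 hx, map_zero]

theorem ConeSupported.supertrace_zero_of_ne (hP : ConeSupported P) {b : ℤ} (hb : b ≠ 0)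
    (T : ExteriorAlgebra K V →ₗ[K] ExteriorAlgebra K V) : supertrace P (0, b) T = 0 := by
  rw [hP.supertrace_eq (M := 1) (by simp), Finset.sum_range_one,
    graded_zero_of_ne (fun h => hb (Prod.ext_iff.1 h).2), LinearMap.traceOn_eq_zero, mul_zero]
  intro x hx
  rw [(Submodule.mem_bot K).1 hx, map_zero]

theorem ConeSupported.supertrace_zero_zero (hP : ConeSupported P) (g : V →ₗ[K] V) :
    supertrace P (0, 0) (map g).toLinearMap = 1 := by
  rw [hP.supertrace_eq (M := 1) (by simp), Finset.sum_range_one, pow_zero, one_mul]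
  have : FiniteDimensional K (graded P 0 (0, 0)) := by
    rw [← Prod.zero_eq_mk, graded_zero_zero]
    infer_instance
  have h1 : LinearMap.traceOn (graded P 0 (0, 0)) (map g).toLinearMap =
      LinearMap.trace K _ (LinearMap.id : graded P 0 (0, 0) →ₗ[K] graded P 0 (0, 0)) := by
    refine LinearMap.traceOn_eq_trace _ fun x => ?_
    have hx : (x : ExteriorAlgebra K V) ∈ Submodule.span K {1} := by
      rw [← graded_zero_zero (P := P)]; exact x.2
    obtain ⟨r, hr⟩ := Submodule.mem_span_singleton.1 hx
    rw [LinearMap.id_apply, ← hr, map_smul, AlgHom.toLinearMap_apply, map_one]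
  rw [h1, LinearMap.trace_id, ← Prod.zero_eq_mk, graded_zero_zero, finrank_span_singleton one_ne_zero,
    Nat.cast_one]

/-- The generating series of the traces of the `j`-th power of an endomorphism on the pieces in
the column `d`. -/
noncomputable def ConeSupported.traceSeries (hP : ConeSupported P) (g : V →ₗ[K] V) (j d : ℕ) :
    HahnSeries ℤ K :=
  HahnSeries.ofSuppBddBelow
    (fun B => if (j : ℤ) ∣ B then LinearMap.traceOn (P (d, B / j)) (g ^ j) else 0)
    ⟨-(j * d), fun B hB => by
      rw [Function.mem_support, ite_ne_right_iff] at hB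
      obtain ⟨⟨e, rfl⟩, hB⟩ := hB
      rcases Nat.eq_zero_or_pos j with rfl | hj
      · simp
      · rw [Int.mul_ediv_cancel_left _ (by omega)] at hB
        have h1 : 0 ≤ (d : ℤ) + e := by
          by_contra h
          exact hB (hP.traceOn_eq_zero (l := (d, e)) (by simpa using h) _)
        nlinarith⟩

theorem ConeSupported.traceSeries_coeff (hP : ConeSupported P) (g : V →ₗ[K] V) (j d : ℕ) (B : ℤ) :
    (hP.traceSeries g j d).coeff B =
      if (j : ℤ) ∣ B then LinearMap.traceOn (P (d, B / j)) (g ^ j) else 0 := rfl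

/-- The generating series of the supertraces in the column `m` of the exterior algebra. -/
noncomputable def ConeSupported.supertraceSeries (hP : ConeSupported P) (g : V →ₗ[K] V) (m : ℕ) :
    HahnSeries ℤ K :=
  HahnSeries.ofSuppBddBelow (fun B => supertrace P (m, B) (map g).toLinearMap)
    ⟨-m, fun B hB => by
      by_contra h
      exact hB (hP.supertrace_eq_zero_of_neg (w := (m, B)) (by simp only; omega) _)⟩

theorem ConeSupported.supertraceSeries_coeff (hP : ConeSupported P) (g : V →ₗ[K] V) (m : ℕ)
    (B : ℤ) : (hP.supertraceSeries g m).coeff B = supertrace P (m, B) (map g).toLinearMap := rfl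

/-- The first factor is supported on multiples `j * e`. The cone bounds `-d ≤ e` and `j * e ≤ m + c`
place `e` in the given interval, which depends on `n` and `c` alone and so serves all terms of
Newton's identity at once. -/
theorem ConeSupported.traceSeries_mul_supertraceSeries (hP : ConeSupported P) (g : V →ₗ[K] V)
    {j d m n : ℕ} (hj : j ≠ 0) (hn : m + j * d = n) (c : ℤ) :
    (hP.traceSeries g j d * hP.supertraceSeries g m).coeff c =
      ∑ e ∈ Finset.Icc (-n : ℤ) (n + c), LinearMap.traceOn (P (d, e)) (g ^ j) *
        supertrace P (m, c - j * e) (map g).toLinearMap := by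
  have hcoeff : ∀ e : ℤ, (hP.traceSeries g j d).coeff (j * e) =
      LinearMap.traceOn (P (d, e)) (g ^ j) := fun e => by
    rw [traceSeries_coeff, if_pos (dvd_mul_right _ _), Int.mul_ediv_cancel_left _ (by omega)]
  classical
  rw [HahnSeries.coeff_mul, ← Finset.sum_filter_ne_zero (s := Finset.Icc _ _)]
  symm
  refine Finset.sum_of_injOn (fun e : ℤ => ((j : ℤ) * e, c - j * e)) ?_ ?_ ?_ ?_
  · intro e _ e' _ h
    exact mul_left_cancel₀ (by exact_mod_cast hj) (Prod.ext_iff.1 h).1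
  · intro e he
    have h0 := (Finset.mem_filter.1 he).2
    rw [Finset.mem_coe, Finset.mem_antidiagonal, HahnSeries.mem_support, HahnSeries.mem_support,
      hcoeff, supertraceSeries_coeff]
    exact ⟨left_ne_zero_of_mul h0, right_ne_zero_of_mul h0, by ring⟩
  · rintro ⟨B, B'⟩ hB h
    rw [Finset.mem_antidiagonal, HahnSeries.mem_support, HahnSeries.mem_support] at hB
    obtain ⟨h1, h2, h3⟩ := hB
    have h4 := h1
    rw [traceSeries_coeff, ite_ne_right_iff] at h4
    obtain ⟨⟨e, he⟩, -⟩ := h4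
    simp only at he h3 h1 h2
    obtain rfl : B' = c - j * e := by omega
    subst he
    refine absurd ⟨e, ?_, rfl⟩ h
    rw [hcoeff] at h1
    rw [supertraceSeries_coeff] at h2
    have h5 : 0 ≤ (d : ℤ) + e := by
      by_contra h
      exact h1 (hP.traceOn_eq_zero (l := (d, e)) (by simpa using h) _)
    have h6 : 0 ≤ (m : ℤ) + (c - j * e) := by
      by_contra h
      exact h2 (hP.supertrace_eq_zero_of_neg (w := (m, c - j * e)) (by simpa using h) _)
    rw [Finset.mem_coe, Finset.mem_filter, Finset.mem_Icc]
    have hj1 : (1 : ℤ) ≤ j := by omega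
    have hn' : (m : ℤ) + j * d = n := by exact_mod_cast hn
    refine ⟨⟨by nlinarith, by nlinarith⟩, mul_ne_zero h1 h2⟩
  · intro e _
    rw [hcoeff, supertraceSeries_coeff]

/-- The power sums that correspond to the supertraces. -/
noncomputable def ConeSupported.powerSumSeries (hP : ConeSupported P) (g : V →ₗ[K] V) (n : ℕ) :
    HahnSeries ℤ K :=
  ∑ p ∈ n.divisorsAntidiagonal, (p.2 : K) • hP.traceSeries g p.1 p.2

theorem ConeSupported.newton_series (hP : ConeSupported P) (hfd : ∀ l, FiniteDimensional K (P l))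
    (hind : iSupIndep P) {g : V →ₗ[K] V} (hg : ∀ l, ∀ x ∈ P l, g x ∈ P l) (n : ℕ) :
    (n : HahnSeries ℤ K) * hP.supertraceSeries g n =
      -∑ k ∈ Finset.Icc 1 n, hP.powerSumSeries g k * hP.supertraceSeries g (n - k) := by
  -- The pairs `j * d = k` are reindexed by `(d, i)` with `j = i + 1`, the form in which the powers
  -- of `g` occur in `newton_supertrace`.
  have hsum : ∑ k ∈ Finset.Icc 1 n, hP.powerSumSeries g k * hP.supertraceSeries g (n - k) =
      ∑ p ∈ (Finset.Icc 1 n ×ˢ Finset.range (n + 1)).filter (fun p => (p.2 + 1) * p.1 ≤ n),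
        (p.1 : K) • (hP.traceSeries g (p.2 + 1) p.1 *
          hP.supertraceSeries g (n - (p.2 + 1) * p.1)) := by
    simp only [powerSumSeries, Finset.sum_mul, Finset.sum_sigma']
    refine Finset.sum_bij' (fun x _ => (x.2.2, x.2.1 - 1))
      (fun p _ => ⟨(p.2 + 1) * p.1, (p.2 + 1, p.1)⟩) ?_ ?_ ?_ ?_ ?_
    · rintro ⟨k, j, d⟩ h
      simp only [Finset.mem_sigma, Finset.mem_Icc, Nat.mem_divisorsAntidiagonal] at h
      obtain ⟨⟨h1, h2⟩, rfl, h4⟩ := h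
      have hj := Nat.pos_of_ne_zero (left_ne_zero_of_mul h4)
      have hd := Nat.pos_of_ne_zero (right_ne_zero_of_mul h4)
      simp only [Finset.mem_filter, Finset.mem_product, Finset.mem_Icc, Finset.mem_range]
      have h5 : d ≤ j * d := Nat.le_mul_of_pos_left d hj
      have h6 : j ≤ j * d := Nat.le_mul_of_pos_right j hd
      rw [Nat.sub_add_cancel hj]
      exact ⟨⟨⟨hd, h5.trans h2⟩, by omega⟩, h2⟩
    · rintro ⟨d, i⟩ h
      simp only [Finset.mem_filter, Finset.mem_product, Finset.mem_Icc] at h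
      obtain ⟨⟨⟨h1, h2⟩, h3⟩, h5⟩ := h
      have := Nat.mul_pos i.succ_pos h1
      simp only [Finset.mem_sigma, Finset.mem_Icc, Nat.mem_divisorsAntidiagonal]
      exact ⟨⟨this, h5⟩, trivial, this.ne'⟩
    · rintro ⟨k, j, d⟩ h
      simp only [Finset.mem_sigma, Finset.mem_Icc, Nat.mem_divisorsAntidiagonal] at h
      obtain ⟨-, rfl, h4⟩ := h
      simp only [Nat.sub_add_cancel (Nat.pos_of_ne_zero (left_ne_zero_of_mul h4))]
    · rintro ⟨d, i⟩ _
      rfl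
    · rintro ⟨k, j, d⟩ h
      simp only [Finset.mem_sigma, Finset.mem_Icc, Nat.mem_divisorsAntidiagonal] at h
      obtain ⟨-, rfl, h4⟩ := h
      simp only [Nat.sub_add_cancel (Nat.pos_of_ne_zero (left_ne_zero_of_mul h4))]
      rw [← HahnSeries.C_mul_eq_smul, ← HahnSeries.C_mul_eq_smul, mul_assoc]
  rw [hsum]
  ext c
  have h2 := newton_supertrace hP hfd hind hg (n, c)
  rw [← map_natCast (HahnSeries.C (Γ := ℤ) (R := K)) n, HahnSeries.C_mul_eq_smul,
    HahnSeries.coeff_smul, HahnSeries.coeff_neg, HahnSeries.coeff_sum, supertraceSeries_coeff,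
    smul_eq_mul]
  simp only [Int.cast_natCast, Int.toNat_natCast] at h2
  rw [h2, neg_inj, Finset.sum_filter, Finset.sum_product]
  have h3 : Finset.Icc ((1 : ℤ), -(n : ℤ)) (n, n + c) =
      ((Finset.Icc 1 n).map Nat.castEmbedding) ×ˢ Finset.Icc (-n : ℤ) (n + c) := by
    ext ⟨a, b⟩
    simp only [Finset.mem_Icc, Prod.mk_le_mk, Finset.mem_product, Finset.mem_map,
      Nat.castEmbedding_apply]
    constructor
    · rintro ⟨⟨h1, h2⟩, h3, h4⟩
      exact ⟨⟨a.toNat, by omega, by omega⟩, h2, h4⟩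
    · rintro ⟨⟨k, ⟨h1, h2⟩, rfl⟩, h3, h4⟩
      refine ⟨⟨?_, h3⟩, ?_, h4⟩ <;> omega
  rw [h3, Finset.sum_product, Finset.sum_map]
  refine Finset.sum_congr rfl fun d hd => ?_
  simp only [← Finset.mul_sum, Nat.castEmbedding_apply, Int.cast_natCast]
  rw [Finset.sum_comm, Finset.mul_sum]
  refine Finset.sum_congr rfl fun i _ => ?_
  have hw : ∀ e : ℤ, ((n : ℤ), c) - (i + 1) • ((d : ℤ), e) =
      ((n : ℤ) - ((i + 1) * d : ℕ), c - (i + 1 : ℕ) * e) := fun e => by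
    rw [Prod.smul_mk, Prod.mk_sub_mk]
    simp only [nsmul_eq_mul, Nat.cast_mul]
  simp only [hw]
  split_ifs with h
  · rw [HahnSeries.coeff_smul, smul_eq_mul,
      hP.traceSeries_mul_supertraceSeries g i.succ_ne_zero (Nat.sub_add_cancel h), Nat.cast_sub h]
  -- The terms with `(i + 1) * d > n` have negative first coordinate and contribute nothing.
  · rw [Finset.sum_eq_zero, mul_zero]
    intro e _
    rw [hP.supertrace_eq_zero (by simp only; omega), mul_zero]

end ExteriorAlgebra

/-! ### From Newton's identities to monic polynomials -/

open Polynomial in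
/-- If the complete symmetric functions of degree at least two are constants, then the power sums
are monic polynomials in the first one. -/
theorem exists_monic_eval₂_eq {K R : Type*} [Field K] [CommRing R] (φ : K →+* R) {U L : ℕ → R}
    (h0 : L 0 = 1) (hL : ∀ m, 2 ≤ m → ∃ r, L m = φ r)
    (hN : ∀ n : ℕ, (n : R) * L n = -∑ k ∈ Finset.Icc 1 n, U k * L (n - k)) (n : ℕ) (hn : 1 ≤ n) :
    ∃ P : K[X], P.Monic ∧ P.natDegree = n ∧ eval₂ φ (U 1) P = U n := by
  induction n using Nat.strong_induction_on with
  | _ n ih =>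
  obtain rfl | ⟨m, rfl⟩ : n = 1 ∨ ∃ m, n = m + 2 := by
    rcases n with _ | _ | m
    exacts [absurd hn (by omega), Or.inl rfl, Or.inr ⟨m, rfl⟩]
  · exact ⟨X, monic_X, natDegree_X, eval₂_X _ _⟩
  · have h1 : L 1 = -U 1 := by simpa [h0] using hN 1
    choose! P hPm hPd hPe using ih
    choose! r hr using hL
    -- Solving Newton's identity for the last power sum, the term `k = m + 1` gives `U 1 * U (m +
    -- 1)` because `L 1 = -U 1`. All the other terms have constant `L` and degree at most `m` in `U
    -- 1`.
    let q : K[X] := ∑ k ∈ Finset.Icc 1 m, P k * C (r (m + 2 - k)) +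
      C (((m + 2 : ℕ) : K) * r (m + 2))
    have hq : q.natDegree < (P (m + 1) * X).natDegree := by
      rw [(hPm (m + 1) (by omega) (by omega)).natDegree_mul monic_X, natDegree_X,
        hPd (m + 1) (by omega) (by omega)]
      refine lt_of_le_of_lt (natDegree_add_le_of_degree_le (n := m) (natDegree_sum_le_of_forall_le _ _
        fun k hk => ?_) ?_) (by omega)
      · rw [Finset.mem_Icc] at hk
        refine (natDegree_mul_C_le _ _).trans ?_
        rw [hPd k (by omega) (by omega)]
        exact hk.2
      · rw [natDegree_C]; exact Nat.zero_le _
    have hm : (P (m + 1) * X).Monic := (hPm (m + 1) (by omega) (by omega)).mul monic_X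
    refine ⟨P (m + 1) * X - q, hm.sub_of_left (degree_lt_degree hq), ?_, ?_⟩
    · rw [natDegree_sub_eq_left_of_natDegree_lt hq,
        (hPm (m + 1) (by omega) (by omega)).natDegree_mul monic_X, natDegree_X,
        hPd (m + 1) (by omega) (by omega)]
    · have h2 := hN (m + 2)
      rw [Finset.sum_Icc_succ_top (by omega), Finset.sum_Icc_succ_top (by omega), Nat.sub_self, h0,
        show m + 2 - (m + 1) = 1 by omega, h1, hr (m + 2) (by omega),
        ← map_natCast φ, ← map_mul] at h2
      have h3 : eval₂ φ (U 1) q = ∑ k ∈ Finset.Icc 1 m, U k * L (m + 2 - k) +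
          φ (((m + 2 : ℕ) : K) * r (m + 2)) := by
        rw [eval₂_add, eval₂_finsetSum, eval₂_C]
        congr 1
        refine Finset.sum_congr rfl fun k hk => ?_
        rw [Finset.mem_Icc] at hk
        rw [eval₂_mul, hPe k (by omega) (by omega), eval₂_C, hr (m + 2 - k) (by omega)]
      rw [eval₂_sub, eval₂_mul, eval₂_X, hPe (m + 1) (by omega) (by omega), h3, h2]
      ring

/-! ### Character sums and the equivariant Hecke operators -/

theorem sum_exp_eq_ite {d : ℕ} (hd : d ≠ 0) (t : ℤ) :
    ∑ b ∈ Finset.range d, Complex.exp (2 * Real.pi * Complex.I * ((b : ℂ) * t / d)) =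
      if (d : ℤ) ∣ t then (d : ℂ) else 0 := by
  have hd' : (d : ℂ) ≠ 0 := Nat.cast_ne_zero.2 hd
  have h1 : ∀ b : ℕ, Complex.exp (2 * Real.pi * Complex.I * ((b : ℂ) * t / d)) =
      Complex.exp (2 * Real.pi * Complex.I * (t / d)) ^ b := fun b => by
    rw [← Complex.exp_nat_mul]
    congr 1
    ring
  have h2 : Complex.exp (2 * Real.pi * Complex.I * (t / d)) ^ d = 1 := by
    rw [← Complex.exp_nat_mul, Complex.exp_eq_one_iff]
    exact ⟨t, by field_simp⟩
  have h3 : Complex.exp (2 * Real.pi * Complex.I * (t / d)) = 1 ↔ (d : ℤ) ∣ t := by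
    rw [Complex.exp_eq_one_iff]
    have hpi : (2 * Real.pi * Complex.I : ℂ) ≠ 0 := Complex.two_pi_I_ne_zero
    refine exists_congr fun n => ?_
    rw [mul_comm (n : ℂ), mul_right_inj' hpi, div_eq_iff hd', mul_comm (n : ℂ)]
    exact_mod_cast Iff.rfl
  simp only [h1]
  split_ifs with h
  · rw [h3.2 h]
    simp
  · rw [geom_sum_eq (fun h' => h (h3.1 h')), h2, sub_self, zero_div]

/-- Writing `M = d s + N t`, the substitution phase and the phase from `r = s/N` combine to `e^{2πi
b t/d}`. The sum over `b` thus detects `d ∣ t`, that is, `M = d e` with `e` in the class `s`. -/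
theorem sum_exp_mul_exp_eq_ite {N d : ℕ} [NeZero N] (hd : d ≠ 0) {M : ℤ} {s : ZMod N}
    (hs : (d : ZMod N) * s = M) [Decidable (∃ e : ℤ, M = d * e ∧ (e : ZMod N) = s)] :
    ∑ b ∈ Finset.range d, Complex.exp (2 * Real.pi * Complex.I * ((b : ℂ) * ((M : ℂ) / N) / d)) *
      Complex.exp (2 * Real.pi * Complex.I * (-(b : ℂ)) * ((s.val : ℂ) / N)) =
      if ∃ e : ℤ, M = d * e ∧ (e : ZMod N) = s then (d : ℂ) else 0 := by
  have hN : (N : ℂ) ≠ 0 := Nat.cast_ne_zero.2 (NeZero.ne N)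
  have hd' : (d : ℂ) ≠ 0 := Nat.cast_ne_zero.2 hd
  obtain ⟨t, ht⟩ : (N : ℤ) ∣ M - d * s.val := by
    rw [← ZMod.intCast_eq_intCast_iff_dvd_sub]
    push_cast
    rw [ZMod.natCast_zmod_val, hs]
  have hM : M = d * s.val + N * t := by omega
  have h1 : ∀ b : ℕ, Complex.exp (2 * Real.pi * Complex.I * ((b : ℂ) * ((M : ℂ) / N) / d)) *
      Complex.exp (2 * Real.pi * Complex.I * (-(b : ℂ)) * ((s.val : ℂ) / N)) =
      Complex.exp (2 * Real.pi * Complex.I * ((b : ℂ) * t / d)) := fun b => by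
    rw [← Complex.exp_add, hM]
    congr 1
    push_cast
    field_simp
    ring
  simp only [h1]
  rw [sum_exp_eq_ite hd]
  refine if_congr ⟨?_, ?_⟩ rfl rfl
  · rintro ⟨u, rfl⟩
    refine ⟨s.val + N * u, by rw [hM]; ring, ?_⟩
    push_cast
    rw [ZMod.natCast_zmod_val, ZMod.natCast_self, zero_mul, add_zero]
  · rintro ⟨e, he, hes⟩
    obtain ⟨u, hu⟩ : (N : ℤ) ∣ e - s.val := by
      rw [← ZMod.intCast_eq_intCast_iff_dvd_sub]
      push_cast
      rw [ZMod.natCast_zmod_val, hes]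
    refine ⟨u, mul_left_cancel₀ (Nat.cast_ne_zero.2 (NeZero.ne N) : (N : ℤ) ≠ 0) ?_⟩
    rw [← ht, he, ← mul_sub, hu]
    ring

namespace QModules

variable {I : Type*} {A : Matrix I I ℝ} {𝔤 : Type*} [LieRing 𝔤] [LieAlgebra ℂ 𝔤]
  {F : FrickeLieAlgebra A 𝔤} {H : Type*} [Group H] {σ : HomogeneousAction F H} {N : ℕ}

theorem traceFunction_int_div [NeZero N] (W : QModules σ N) (h : H) (k l m M : ℤ) :
    W.traceFunction h k l m ((M : ℚ) / N) =
      ∑ s : ZMod N, if (k : ZMod N) * s = (M : ZMod N) then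
        Complex.exp (2 * Real.pi * Complex.I * (l : ℂ) * ((s.val : ℂ) / (N : ℂ))) *
          LinearMap.trace ℂ _ (W.rep (k : ZMod N) s M (h ^ m)) else 0 := by
  have hN : (N : ℚ) ≠ 0 := Nat.cast_ne_zero.2 (NeZero.ne N)
  have h1 : ((N : ℚ) * ((M : ℚ) / N)).num = M := by
    rw [mul_div_cancel₀ _ hN, Rat.num_intCast]
  rw [traceFunction, if_pos ⟨M, rfl⟩]
  have h2 : ∀ z : ℤ, z = M → (∑ s : ZMod N, if (k : ZMod N) * s = (z : ZMod N) then
      Complex.exp (2 * Real.pi * Complex.I * (l : ℂ) * ((s.val : ℂ) / (N : ℂ))) *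
        LinearMap.trace ℂ _ (W.rep (k : ZMod N) s z (h ^ m)) else 0) =
      ∑ s : ZMod N, if (k : ZMod N) * s = (M : ZMod N) then
      Complex.exp (2 * Real.pi * Complex.I * (l : ℂ) * ((s.val : ℂ) / (N : ℂ))) *
        LinearMap.trace ℂ _ (W.rep (k : ZMod N) s M (h ^ m)) else 0 := by
    rintro _ rfl
    rfl
  exact h2 _ h1

theorem trace_rep (W : QModules σ N) (h : H) {d : ℕ} (hd : d ≠ 0) (e : ℤ) (a : ℕ) :
    LinearMap.trace ℂ _ (W.rep ((d : ℤ) : ZMod N) (e : ZMod N) (d * e) (h ^ (a : ℤ))) =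
      LinearMap.traceOn (F.posPiece (d, e)) (σ.act h ^ a) := by
  obtain ⟨E⟩ := W.equiv d e (by simpa using fun h => absurd h hd)
  rw [FrickeLieAlgebra.posPiece_of_one_le (by simp only; omega),
    LinearMap.traceOn_eq_trace (σ.pieceRep d e (h ^ (a : ℤ))), ← LinearMap.trace_conj' _ E.toLinearEquiv]
  · congr 1
    refine LinearMap.ext fun x => ?_
    have h1 := LinearMap.congr_fun (E.isIntertwining' (h ^ (a : ℤ))) (E.toLinearEquiv.symm x)
    rw [LinearEquiv.conj_apply_apply]
    refine Eq.trans ?_ h1.symm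
    exact congrArg _ (E.toLinearEquiv.apply_symm_apply x).symm
  · intro x
    rw [← map_pow, ← zpow_natCast]
    rfl

/-- Among the classes `s` allowed by `d s ≡ d e`, the sum over `b` keeps only that of `e`, and there
the module is the actual piece `(d, e)`. The other classes, whose modules may be arbitrary, drop
out. -/
theorem sum_twistedSubst_eq [NeZero N] (W : QModules σ N) (h : H) {a d : ℕ} (ha : a ≠ 0) (hd : d ≠ 0) (e : ℤ) :
    ∑ b ∈ Finset.range d, twistedSubst (W.traceFunction h d (-b) a) a b d ((a * e : ℤ) / N) =
      d * LinearMap.traceOn (F.posPiece (d, e)) (σ.act h ^ a) := by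
  classical
  have ha' : (a : ℚ) ≠ 0 := Nat.cast_ne_zero.2 ha
  have hy : ((a * e : ℤ) : ℚ) / N * d / a = ((d * e : ℤ) : ℚ) / N := by
    push_cast
    field_simp
  simp only [twistedSubst, hy, traceFunction_int_div, Finset.mul_sum]
  rw [Finset.sum_comm, Finset.sum_eq_single (e : ZMod N)]
  · rw [← W.trace_rep h hd]
    have hs : (d : ZMod N) * (e : ZMod N) = ((d * e : ℤ) : ZMod N) := by push_cast; rfl
    have h1 := sum_exp_mul_exp_eq_ite hd hs
    rw [if_pos ⟨e, rfl, rfl⟩] at h1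
    refine Eq.trans ?_ (congrArg (· * LinearMap.trace ℂ _
      (W.rep ((d : ℤ) : ZMod N) (e : ZMod N) (d * e) (h ^ (a : ℤ)))) h1)
    change _ = (∑ _ ∈ _, _) * _
    rw [Finset.sum_mul]
    refine Finset.sum_congr rfl fun b _ => ?_
    rw [if_pos (by push_cast; rfl), ← mul_assoc]
    push_cast
    rfl
  · intro s _ hse
    by_cases hs : (d : ZMod N) * s = ((d * e : ℤ) : ZMod N)
    · have h1 := sum_exp_mul_exp_eq_ite hd hs
      rw [if_neg] at h1
      · rw [← zero_mul (LinearMap.trace ℂ _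
          (W.rep ((d : ℤ) : ZMod N) s (d * e) (h ^ (a : ℤ)))), ← h1, Finset.sum_mul]
        refine Finset.sum_congr rfl fun b _ => ?_
        rw [if_pos (by rw [← hs]; push_cast; rfl), ← mul_assoc]
        push_cast
        rfl
      · rintro ⟨e', h2, rfl⟩
        rw [mul_right_inj' (Nat.cast_ne_zero.2 hd)] at h2
        exact hse (by rw [h2])
    · refine Finset.sum_eq_zero fun b _ => ?_
      rw [if_neg (by rw [Int.cast_natCast]; exact hs), mul_zero]
  · exact fun h => absurd (Finset.mem_univ _) h

/-- An exponent that is not of the form `a e / N` either falls outside the support of the trace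
function or leads to `M` not divisible by `d`, where the sum over `b` vanishes. -/
theorem sum_twistedSubst_eq_zero [NeZero N] (W : QModules σ N) (h : H) {a d : ℕ} (ha : a ≠ 0) (hd : d ≠ 0)
    {x : ℚ} (hx : ∀ e : ℤ, x ≠ ((a * e : ℤ) : ℚ) / N) :
    ∑ b ∈ Finset.range d, twistedSubst (W.traceFunction h d (-b) a) a b d x = 0 := by
  classical
  have hN : (N : ℚ) ≠ 0 := Nat.cast_ne_zero.2 (NeZero.ne N)
  have ha' : (a : ℚ) ≠ 0 := Nat.cast_ne_zero.2 ha
  have hd' : (d : ℚ) ≠ 0 := Nat.cast_ne_zero.2 hd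
  by_cases hM : ∃ M : ℤ, x * d / a = (M : ℚ) / N
  · obtain ⟨M, hM⟩ := hM
    simp only [twistedSubst, hM, traceFunction_int_div, Finset.mul_sum]
    rw [Finset.sum_comm]
    refine Finset.sum_eq_zero fun s _ => ?_
    by_cases hs : (d : ZMod N) * s = (M : ZMod N)
    · have h1 := sum_exp_mul_exp_eq_ite hd hs
      rw [if_neg] at h1
      · rw [← zero_mul (LinearMap.trace ℂ _
          (W.rep ((d : ℤ) : ZMod N) s M (h ^ (a : ℤ)))), ← h1, Finset.sum_mul]
        refine Finset.sum_congr rfl fun b _ => ?_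
        rw [if_pos (by rw [← hs]; push_cast; rfl), ← mul_assoc]
        push_cast
        rfl
      · rintro ⟨e, rfl, -⟩
        refine hx e ?_
        push_cast at hM ⊢
        field_simp at hM ⊢
        linear_combination hM
    · refine Finset.sum_eq_zero fun b _ => ?_
      rw [if_neg (by rw [Int.cast_natCast]; exact hs), mul_zero]
  · refine Finset.sum_eq_zero fun b _ => ?_
    rw [twistedSubst, traceFunction, if_neg hM, mul_zero]

end QModules

/-! ### Hecke-monicity -/

namespace FrickeLieAlgebra.Coordinates

open ExteriorAlgebra

variable {I : Type*} {A : Matrix I I ℝ} {𝔤 : Type*} [LieRing 𝔤] [LieAlgebra ℂ 𝔤]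
  {F : FrickeLieAlgebra A 𝔤}

/-- The power sums of the traces are monic polynomials in the first of them. -/
theorem exists_monic_eval₂_powerSumSeries (c : F.Coordinates) {g : 𝔤 →ₗ[ℂ] 𝔤}
    (hg : ∀ l, ∀ x ∈ F.posPiece l, g x ∈ F.posPiece l) (hlie : ∀ x y, g ⁅x, y⁆ = ⁅g x, g y⁆)
    (n : ℕ) (hn : 1 ≤ n) :
    ∃ P : Polynomial ℂ, P.Monic ∧ P.natDegree = n ∧
      Polynomial.eval₂ HahnSeries.C (c.coneSupported_posPiece.powerSumSeries g 1) P =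
        c.coneSupported_posPiece.powerSumSeries g n := by
  have hP := c.coneSupported_posPiece
  refine exists_monic_eval₂_eq HahnSeries.C (L := hP.supertraceSeries g) ?_ (fun m hm => ?_)
    (hP.newton_series c.finiteDimensional_posPiece c.iSupIndep_posPiece hg) n hn
  · ext B
    rw [hP.supertraceSeries_coeff, Nat.cast_zero, HahnSeries.coeff_one]
    split_ifs with h
    · rw [h, hP.supertrace_zero_zero]
    · exact hP.supertrace_zero_of_ne h _
  -- For `m ≥ 2` the Laplacian kills every coefficient except the one at second coordinate `0`, so
  -- the series is a constant.
  · refine ⟨supertrace F.posPiece (m, 0) (map g).toLinearMap, ?_⟩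
    ext B
    rw [hP.supertraceSeries_coeff, HahnSeries.C_apply]
    by_cases h : B = 0
    · rw [h, HahnSeries.coeff_single_same]
    · rw [HahnSeries.coeff_single_of_ne h]
      exact c.supertrace_eq_zero hg hlie (by simp only; omega) h

end FrickeLieAlgebra.Coordinates

theorem mainTheorem3 {I : Type*} {A : Matrix I I ℝ} {𝔤 : Type*} [LieRing 𝔤] [LieAlgebra ℂ 𝔤]
    (F : FrickeLieAlgebra A 𝔤) {H : Type*} [Group H] (σ : HomogeneousAction F H)
    (N : ℕ) [NeZero N] (hσ : σ.IsQCompatible N) (W : QModules σ N) (h : H) :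
    (∀ a b : ℤ, FiniteDimensional ℂ (F.piece a b)) ∧
      IsHeckeMonic (W.traceFunction h) 1 0 1 := by
  obtain ⟨c⟩ := F.nonempty_coordinates
  refine ⟨c.finiteDimensional_piece, ?_⟩
  have hP := c.coneSupported_posPiece
  have hg : ∀ l, ∀ x ∈ F.posPiece l, σ.act h x ∈ F.posPiece l := fun l x hx => by
    rw [FrickeLieAlgebra.posPiece] at hx ⊢
    split_ifs with hl
    · rw [if_pos hl] at hx
      exact σ.act_mem h _ _ x hx
    · rw [if_neg hl] at hx
      rw [(Submodule.mem_bot ℂ).1 hx, map_zero]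
      exact zero_mem _
  have hN : (0 : ℚ) < N := Nat.cast_pos.2 (Nat.pos_of_ne_zero (NeZero.ne N))
  let ν : ℤ →+ ℚ := (AddMonoidHom.mulRight (N : ℚ)⁻¹).comp (Int.castAddHom ℚ)
  have hν : ∀ B : ℤ, ν B = (B : ℚ) / N := fun B => (div_eq_mul_inv _ _).symm
  have hν1 : ∀ B B' : ℤ, ν B ≤ ν B' ↔ B ≤ B' := fun B B' => by
    rw [hν, hν, div_le_div_iff_of_pos_right hN, Int.cast_le]
  have hν0 : Function.Injective ν := fun B B' hB =>
    le_antisymm ((hν1 _ _).1 hB.le) ((hν1 _ _).1 hB.ge)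
  -- The series above are in `q^{1/N}` with integer exponents; `Φ` rescales the exponents by `1/N`.
  let Φ : HahnSeries ℤ ℂ →+* HahnSeries ℚ ℂ := HahnSeries.embDomainRingHom ν hν0 hν1
  have hΦ : ∀ (s : HahnSeries ℤ ℂ) (B : ℤ), (Φ s).coeff ((B : ℚ) / N) = s.coeff B := fun s B => by
    rw [← hν]
    exact HahnSeries.embDomain_mk_coeff hν0 hν1
  have hΦ0 : ∀ (s : HahnSeries ℤ ℂ) (x : ℚ), (∀ B : ℤ, x ≠ (B : ℚ) / N) → (Φ s).coeff x = 0 :=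
    fun s x hx => HahnSeries.embDomain_of_notMem_range fun ⟨B, hB⟩ =>
      hx B (hB.symm.trans (hν B))
  have hecke : ∀ n : ℕ, 1 ≤ n → ∀ x : ℚ, (n : ℂ) * equivariantHecke n (W.traceFunction h) 1 0 1 x =
      (Φ (hP.powerSumSeries (σ.act h) n)).coeff x := by
    intro n hn x
    have hn' : (n : ℂ) ≠ 0 := Nat.cast_ne_zero.2 (by omega)
    rw [equivariantHecke, ← mul_assoc, mul_one_div_cancel hn', one_mul]
    simp only [mul_one, mul_zero, zero_sub]
    by_cases hx : ∃ B : ℤ, x = (B : ℚ) / N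
    · obtain ⟨B, rfl⟩ := hx
      rw [hΦ, ExteriorAlgebra.ConeSupported.powerSumSeries, HahnSeries.coeff_sum]
      refine Finset.sum_congr rfl fun p hp => ?_
      obtain ⟨hp1, hp2⟩ := Nat.mem_divisorsAntidiagonal.1 hp
      have ha : p.1 ≠ 0 := fun h0 => hp2 (by rw [← hp1, h0, zero_mul])
      have hd : p.2 ≠ 0 := fun h0 => hp2 (by rw [← hp1, h0, mul_zero])
      rw [HahnSeries.coeff_smul, hP.traceSeries_coeff, smul_eq_mul]
      split_ifs with hB
      · obtain ⟨e, rfl⟩ := hB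
        rw [Int.mul_ediv_cancel_left _ (by omega), W.sum_twistedSubst_eq h ha hd]
      · rw [mul_zero, W.sum_twistedSubst_eq_zero h ha hd]
        intro e he
        rw [div_left_inj' hN.ne', Int.cast_inj] at he
        exact hB ⟨e, he⟩
    · push Not at hx
      rw [hΦ0 _ _ hx]
      refine Finset.sum_eq_zero fun p hp => ?_
      obtain ⟨hp1, hp2⟩ := Nat.mem_divisorsAntidiagonal.1 hp
      have ha : p.1 ≠ 0 := fun h0 => hp2 (by rw [← hp1, h0, zero_mul])
      have hd : p.2 ≠ 0 := fun h0 => hp2 (by rw [← hp1, h0, mul_zero])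
      exact W.sum_twistedSubst_eq_zero h ha hd fun e => hx _
  -- The operator for `n = 1` is the identity, so `hecke` at `1` identifies the trace function with
  -- the first power sum.
  refine ⟨Φ (hP.powerSumSeries (σ.act h) 1), ?_, fun n hn => ?_⟩
  · funext x
    rw [← hecke 1 le_rfl, equivariantHecke]
    simp [twistedSubst]
  · obtain ⟨P, hPm, hPd, hPe⟩ := c.exists_monic_eval₂_powerSumSeries hg (σ.act_lie h) n hn
    refine ⟨P, hPm, hPd, fun x => ?_⟩
    have h1 : algebraMap ℂ (HahnSeries ℚ ℂ) = Φ.comp HahnSeries.C := by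
      refine RingHom.ext fun r => ?_
      rw [RingHom.comp_apply, HahnSeries.embDomainRingHom_C, HahnSeries.algebraMap_apply',
        PowerSeries.algebraMap_apply, Algebra.algebraMap_self_apply, HahnSeries.ofPowerSeries_C]
    rw [hecke n hn, ← hPe, Polynomial.aeval_def, h1, Polynomial.hom_eval₂]
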